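/- Let $Q$ be a smooth (finite-dimensional, Hausdorff, second countable) manifold, $\kappa$ a Riemannian metric on $Q$, $U\in C^\infty(Q)$ and $D\subset TQ$ a smooth distribution of constant rank; write $\mathcal L(v)=\tfrac12\kappa(v,v)+U$. Let $\mathcal M=\{\kappa(v,\cdot): v\in D\}\subset T^*Q$, with inclusion $\iota:\mathcal M\to T^*Q$ and projection $\tau:\mathcal M\to Q$. Let $\Theta_Q$ be the Liouville 1-form, $\Omega_Q=-d\Theta_Q$, $\Theta_{\mathcal M}=\iota^*\Theta_Q$, $\Omega_{\mathcal M}=\iota^*\Omega_Q$, and $\mathcal C_m=\{v\in T_m\mathcal M: T\tau(v)\in D_{\tau(m)}\}$. For a bivector field $\pi$ let $\pi^\sharp:T^*\mathcal M\to T\mathcal M$ be given by $\beta(\pi^\sharp\alpha)=\pi(\alpha,\beta)$, and for a 3-form $\phi$ put $\pi^\sharp(\phi)(\alpha,\beta,\gamma)=-\phi(\pi^\sharp\alpha,\pi^\sharp\beta,\pi^\sharp\gamma)$. The Schouten bracket is normalized by $\tfrac12[\pi,\pi](df,dg,dh)=\{f,\{g,h\}\}+\{g,\{h,f\}\}+\{h,\{f,g\}\}$,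 where $\{f,g\}=\pi(df,dg)$. The nonholonomic bivector field $\pi_{nh}$ is determined by: for $X\in\mathcal C$, $\mathbf i_X\Omega_{\mathcal M}|_{\mathcal C}=\alpha|_{\mathcal C}$ if and only if $\pi_{nh}^\sharp(\alpha)=-X$. Let $G$ be a Lie group with Lie algebra $\mathfrak g$ that acts smoothly, freely and properly on $Q$ and whose lifted action on $TQ$ leaves $\mathcal L$ and $D$ invariant. Then the cotangent lift restricts to an action $\varphi$ of $G$ on $\mathcal M$, with infinitesimal generators $\xi_{\mathcal M}$, $\xi\in\mathfrak g$; let $\mathcal V_m=\{\xi_{\mathcal M}(m):\xi\in\mathfrak g\}$ be the tangent space of the orbit, and let $\mathcal J:\mathcal M\to\mathfrak g^*$, $\langle\mathcal J(m),\eta\rangle=\Theta_{\mathcal M}(\eta_{\mathcal M}(m))$, be the canonical momentum map. Assume that $T_m\mathcal M=\mathcal C_m+\mathcal V_m$ for all $m\in\mathcal M$ (the dimension assumption), and let $\mathcal W$ be a $G$-invariant vertical complement of $\mathcal C$, i.e. a $G$-invariant smooth distribution on $\mathcal M$ with $T\mathcal M=\mathcal C\oplus\mathcal W$ and $\mathcal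 W\subseteq\mathcal V$, with projections $P_{\mathcal C}$ and $P_{\mathcal W}$. Let $\mathcal A_{\mathcal W}$ be the $\mathfrak g$-valued 1-form on $\mathcal M$ with $\mathcal A_{\mathcal W}(v_m)=\xi$ if and only if $P_{\mathcal W}(v_m)=\xi_{\mathcal M}(m)$, let $\mathcal K_{\mathcal W}(X,Y)=d\mathcal A_{\mathcal W}(P_{\mathcal C}X,P_{\mathcal C}Y)$ be the $\mathcal W$-curvature, and let $(d\mathcal J\wedge\mathcal K_{\mathcal W})(X,Y,Z)$ be the cyclic sum over $(X,Y,Z)$ of $\langle d\mathcal J(Z),\mathcal K_{\mathcal W}(X,Y)\rangle$. Let $B$ be a 2-form on $\mathcal M$ with $\mathbf i_ZB=0$ for all $Z\in\mathcal W$, put $B^\flat(X)=\mathbf i_XB$, suppose that $\mathrm{Id}+B^\flat\circ\pi_{nh}^\sharp$ is invertible, and let $\pi_B$ be the gauge transformation of $\pi_{nh}$ by $B$, i.e. the bivector field with $\pi_B^\sharp=\pi_{nh}^\sharp\circ(\mathrm{Id}+B^\flat\circ\pi_{nh}^\sharp)^{-1}$. Then $$\tfrac12[\pi_B,\pi_B]=-\pi_B^\sharp\big(dB+d\mathcal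 J\wedge\mathcal K_{\mathcal W}\big)-\psi_{\pi_B},$$ where the trivector field $\psi_{\pi_B}$ is given by letting $\psi_{\pi_B}(\alpha,\beta,\gamma)$ be the cyclic sum over $(\alpha,\beta,\gamma)$ of $\gamma\big(\big(\mathcal K_{\mathcal W}(\pi_B^\sharp\alpha,\pi_B^\sharp\beta)\big)_{\mathcal M}\big)$, for $\alpha,\beta,\gamma\in T_m^*\mathcal M$, $m\in\mathcal M$. -/

import Mathlib

open Set Bundle Manifold
open scoped Manifold ContDiff Topology

noncomputable section

/-! ### Tensor calculus on manifolds without boundary -/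

section Calculus

variable {EP : Type*} [NormedAddCommGroup EP] [NormedSpace ℝ EP]
  {HP : Type*} [TopologicalSpace HP] (J : ModelWithCorners ℝ EP HP)
  {P : Type*} [TopologicalSpace P] [ChartedSpace HP P]

/-- A smooth local frame, with `r` elements, of a family `D` of subspaces of the tangent spaces. -/
structure LocalFrame [IsManifold J ∞ P] (D : (x : P) → Submodule ℝ (TangentSpace J x)) (r : ℕ) where
  /-- the domain -/
  dom : Set P
  isOpen_dom : IsOpen dom
  /-- the vector fields of the frame -/
  vec : Fin r → (x : P) → TangentSpace J x
  contMDiffOn_vec : ∀ a, ContMDiffOn J J.tangent ∞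
    (fun x ↦ (TotalSpace.mk' EP x (vec a x) : TangentBundle J P)) dom
  linearIndependent : ∀ x ∈ dom, LinearIndependent ℝ (fun a ↦ vec a x)
  span_eq : ∀ x ∈ dom, Submodule.span ℝ (range fun a ↦ vec a x) = D x

/-- A regular distribution of rank `r`: a family of subspaces of the tangent spaces
that has a smooth local frame with `r` elements around every point. -/
def IsRegularDistribution [IsManifold J ∞ P] (D : (x : P) → Submodule ℝ (TangentSpace J x)) (r : ℕ) : Prop :=
  ∀ x, ∃ s : LocalFrame J D r, x ∈ s.dom

/-- Fields of alternating `k`-linear forms with values in `F`: the differential `k`-forms on `P`,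
smoothness being a separate condition. -/
abbrev DForm (P : Type*) [TopologicalSpace P] [ChartedSpace HP P] (k : ℕ)
    (F : Type*) [NormedAddCommGroup F] [NormedSpace ℝ F] : Type _ :=
  (x : P) → TangentSpace J x [⋀^Fin k]→L[ℝ] F

variable {J}

/-- The representation of a form in the chart around `x₀`, a form on the model vector space. -/
def DForm.inChart {k : ℕ} {F : Type*} [NormedAddCommGroup F] [NormedSpace ℝ F]
    (θ : DForm J P k F) (x₀ : P) (y : EP) : EP [⋀^Fin k]→L[ℝ] F :=
  (θ ((extChartAt J x₀).symm y)).compContinuousLinearMap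
    (mfderiv 𝓘(ℝ, EP) J (extChartAt J x₀).symm y)

/-- A form is smooth if it is so in all charts. -/
def DForm.IsSmooth {k : ℕ} {F : Type*} [NormedAddCommGroup F] [NormedSpace ℝ F]
    (θ : DForm J P k F) : Prop :=
  ∀ x₀ : P, ContDiffOn ℝ ∞ (θ.inChart x₀) (extChartAt J x₀).target

/-- The exterior derivative, computed at `x₀` in the chart around `x₀`. -/
def DForm.d {k : ℕ} {F : Type*} [NormedAddCommGroup F] [NormedSpace ℝ F]
    (θ : DForm J P k F) : DForm J P (k + 1) F := fun x₀ ↦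
  (extDeriv (θ.inChart x₀) (extChartAt J x₀ x₀)).compContinuousLinearMap
    (mfderiv J 𝓘(ℝ, EP) (extChartAt J x₀) x₀)

/-- The pullback of a form along a map. -/
def DForm.pullback {k : ℕ} {F : Type*} [NormedAddCommGroup F] [NormedSpace ℝ F]
    {EN : Type*} [NormedAddCommGroup EN] [NormedSpace ℝ EN]
    {HN : Type*} [TopologicalSpace HN] {JN : ModelWithCorners ℝ EN HN}
    {N : Type*} [TopologicalSpace N] [ChartedSpace HN N]
    (f : N → P) (θ : DForm J P k F) : DForm JN N k F := fun x ↦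
  (θ (f x)).compContinuousLinearMap (mfderiv JN J f x)

variable (J) in
/-- The field of maps `π♯ : T*P → TP` of a bivector field `π`, with `β (π♯ α) = π (α, β)`. -/
abbrev SharpField (P : Type*) [TopologicalSpace P] [ChartedSpace HP P] : Type _ :=
  (x : P) → (TangentSpace J x →L[ℝ] ℝ) →L[ℝ] TangentSpace J x

/-- The representation of `π♯` in the chart around `x₀`. -/
def SharpField.inChart (p : SharpField J P) (x₀ : P) (y : EP) : (EP →L[ℝ] ℝ) →L[ℝ] EP :=
  let D : TangentSpace J ((extChartAt J x₀).symm y) →L[ℝ] EP :=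
    mfderiv J 𝓘(ℝ, EP) (extChartAt J x₀) ((extChartAt J x₀).symm y)
  D ∘L p ((extChartAt J x₀).symm y) ∘L ContinuousLinearMap.precomp ℝ D

variable (J P) in
/-- A smooth bivector field on `P`, given through `π♯ : T*P → TP`. -/
structure BivectorField where
  /-- the map `π♯` -/
  sharp : SharpField J P
  alternating : ∀ x (α : TangentSpace J x →L[ℝ] ℝ), α (sharp x α) = 0
  smooth : ∀ x₀ : P, ContDiffOn ℝ ∞ (sharp.inChart x₀) (extChartAt J x₀).target

/-- The Schouten bracket `[π, π]`, computed at `x₀` in the chart around `x₀`: it is normalized by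
`[π, π](df, dg, dh) = 2 ({f, {g, h}} + {g, {h, f}} + {h, {f, g}})` where
`{f, g} = π (df, dg) = dg (π♯ df)`. In the chart, a covector is the differential of a linear
function, and `{f, {g, h}}` is the derivative of `{g, h}` along `π♯ df`. -/
def BivectorField.schouten (p : BivectorField J P) (x₀ : P)
    (α β γ : TangentSpace J x₀ →L[ℝ] ℝ) : ℝ :=
  let y₀ : EP := extChartAt J x₀ x₀
  let toChart : (TangentSpace J x₀ →L[ℝ] ℝ) → (EP →L[ℝ] ℝ) := fun α ↦
    α ∘L (mfderiv J 𝓘(ℝ, EP) (extChartAt J x₀) x₀).inverse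
  let term : (EP →L[ℝ] ℝ) → (EP →L[ℝ] ℝ) → (EP →L[ℝ] ℝ) → ℝ := fun f g h ↦
    fderiv ℝ (fun y ↦ h (p.sharp.inChart x₀ y g)) y₀ (p.sharp.inChart x₀ y₀ f)
  2 * (term (toChart α) (toChart β) (toChart γ) + term (toChart β) (toChart γ) (toChart α)
    + term (toChart γ) (toChart α) (toChart β))

/-- The action of `π♯` on a 3-form: `π♯(φ)(α, β, γ) = (-1)³ φ(π♯ α, π♯ β, π♯ γ)`. -/
def BivectorField.sharp₃ (p : BivectorField J P) (x : P)
    (φ : TangentSpace J x → TangentSpace J x → TangentSpace J x → ℝ)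
    (α β γ : TangentSpace J x →L[ℝ] ℝ) : ℝ :=
  (-1) ^ 3 * φ (p.sharp x α) (p.sharp x β) (p.sharp x γ)

theorem update_pair_zero {V : Type*} (a b c : V) : Function.update ![a, b] 0 c = ![c, b] := by
  ext i; fin_cases i <;> rfl

theorem update_pair_one {V : Type*} (a b c : V) : Function.update ![a, b] 1 c = ![a, c] := by
  ext i; fin_cases i <;> rfl

/-- The contraction `i_X Ω = Ω (X, ·)` of a 2-form. -/
def DForm.contract (Ω : DForm J P 2 ℝ) (x : P) (X : TangentSpace J x) :
    TangentSpace J x →L[ℝ] ℝ where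
  toFun Y := Ω x ![X, Y]
  map_add' Y Z := by
    simpa only [update_pair_one] using (Ω x).map_update_add ![X, 0] 1 Y Z
  map_smul' c Y := by
    simpa only [update_pair_one, RingHom.id_apply] using (Ω x).map_update_smul ![X, 0] 1 c Y
  cont := (Ω x).cont.comp (by fun_prop)

/-- The map `X ↦ i_X Ω` from a subspace `C` of a tangent space to its dual. -/
def DForm.flatOn (Ω : DForm J P 2 ℝ) (x : P) (C : Submodule ℝ (TangentSpace J x)) :
    C →ₗ[ℝ] (C →ₗ[ℝ] ℝ) where
  toFun X := (Ω.contract x X : TangentSpace J x →ₗ[ℝ] ℝ) ∘ₗ C.subtype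
  map_add' X Y := by
    ext Z
    have h := (Ω x).map_update_add ![0, (Z : TangentSpace J x)] 0 X Y
    simp only [update_pair_zero] at h
    exact h
  map_smul' c X := by
    ext Z
    have h := (Ω x).map_update_smul ![0, (Z : TangentSpace J x)] 0 c X
    simp only [update_pair_zero] at h
    exact h

/-- The endomorphism `Id + B♭ ∘ π♯` of `T*P` at `x`, where `B♭ X = i_X B`. -/
def gaugeEndo (p : SharpField J P) (B : DForm J P 2 ℝ) (x : P)
    (α : TangentSpace J x →L[ℝ] ℝ) : TangentSpace J x →L[ℝ] ℝ :=
  α + B.contract x (p x α)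

/-- `q` is the gauge transformation of `p` by the 2-form `B`: the endomorphism `Id + B♭ ∘ p♯` of
`T*P` is invertible and `q♯ = p♯ ∘ (Id + B♭ ∘ p♯)⁻¹`. -/
def IsGaugeTransformation (p : SharpField J P) (B : DForm J P 2 ℝ) (q : SharpField J P) : Prop :=
  ∀ x, Function.Bijective (gaugeEndo p B x) ∧ ∀ α, q x (gaugeEndo p B x α) = p x α

variable (J) in
theorem finiteDimensional_tangentSpace [FiniteDimensional ℝ EP] (x : P) :
    FiniteDimensional ℝ (TangentSpace J x) :=
  inferInstanceAs (FiniteDimensional ℝ EP)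

/-- The bivector `π` associated to a family `C` of subspaces and a 2-form `Ω` that is nondegenerate
on `C`: for `X ∈ C`, `i_X Ω = α` on `C` if and only if `π♯ α = - X`. Here `π♯` is built
from the inverse of `C → C*`, `X ↦ i_X Ω` (`LinearMap.leftInverse` is the inverse
of a bijective linear map). -/
def sharpOfForm [FiniteDimensional ℝ EP] (C : (x : P) → Submodule ℝ (TangentSpace J x))
    (Ω : DForm J P 2 ℝ) : SharpField J P := fun x ↦
  haveI := finiteDimensional_tangentSpace J x
  haveI : T2Space (TangentSpace J x) := inferInstanceAs (T2Space EP)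
  LinearMap.toContinuousLinearMap
    { toFun := fun α ↦
        -((Ω.flatOn x (C x)).leftInverse ((α : TangentSpace J x →ₗ[ℝ] ℝ) ∘ₗ (C x).subtype) :
          TangentSpace J x)
      map_add' := fun α β ↦ by
        rw [ContinuousLinearMap.toLinearMap_add, LinearMap.add_comp, map_add, Submodule.coe_add,
          neg_add]
      map_smul' := fun c α ↦ by
        rw [ContinuousLinearMap.toLinearMap_smul, LinearMap.smul_comp, map_smul, Submodule.coe_smul,
          smul_neg, RingHom.id_apply] }

end Calculus

/-! ### Nonholonomic systems -/

section System

variable (E : Type*) [NormedAddCommGroup E] [NormedSpace ℝ E]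
  (Q : Type*) [TopologicalSpace Q] [ChartedSpace E Q] [IsManifold 𝓘(ℝ, E) ∞ Q]

/-- A nonholonomic system on `Q`: a kinetic energy metric `κ`, a potential energy `U` and
a regular distribution `D` of permitted velocities. -/
structure NonholonomicSystem where
  /-- the kinetic energy metric -/
  κ : ContMDiffRiemannianMetric 𝓘(ℝ, E) ∞ E (TangentSpace 𝓘(ℝ, E) : Q → Type _)
  /-- the potential energy -/
  U : Q → ℝ
  contMDiff_U : ContMDiff 𝓘(ℝ, E) 𝓘(ℝ, ℝ) ∞ U
  /-- the distribution of permitted velocities -/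
  D : (q : Q) → Submodule ℝ (TangentSpace 𝓘(ℝ, E) q)
  /-- the rank of the distribution -/
  rank : ℕ
  isRegular_D : IsRegularDistribution 𝓘(ℝ, E) D rank

/-- The cotangent bundle `T*Q`. -/
abbrev CotangentBundle : Type _ :=
  TotalSpace (E →L[ℝ] ℝ) (fun q : Q ↦ TangentSpace 𝓘(ℝ, E) q →L[ℝ] Bundle.Trivial Q ℝ q)

variable {E Q}

namespace NonholonomicSystem

variable (S : NonholonomicSystem E Q)

/-- The Lagrangian: kinetic energy plus `U`. -/
def lagrangian (v : TangentBundle 𝓘(ℝ, E) Q) : ℝ :=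
  (1 / 2) * S.κ.inner v.proj v.2 v.2 + S.U v.proj

/-- The fibre over `q` of the constraint submanifold `M = Leg(D)`, a subspace of the
cotangent space: the Legendre transform is `v ↦ κ(v, ·)`. -/
def fibre (q : Q) : Submodule ℝ (TangentSpace 𝓘(ℝ, E) q →L[ℝ] ℝ) :=
  (S.D q).map (S.κ.inner q : TangentSpace 𝓘(ℝ, E) q →ₗ[ℝ] TangentSpace 𝓘(ℝ, E) q →L[ℝ] ℝ)

/-- The fibre over `q` of the constraint submanifold, as a type. -/
def Fibre (q : Q) : Type _ := S.fibre q

instance (q : Q) : AddCommGroup (S.Fibre q) := inferInstanceAs (AddCommGroup (S.fibre q))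

instance (q : Q) : Module ℝ (S.Fibre q) := inferInstanceAs (Module ℝ (S.fibre q))

instance (q : Q) : TopologicalSpace (S.Fibre q) := inferInstanceAs (TopologicalSpace (S.fibre q))

instance (q : Q) : IsTopologicalAddGroup (S.Fibre q) :=
  inferInstanceAs (IsTopologicalAddGroup (S.fibre q))

instance (q : Q) : ContinuousSMul ℝ (S.Fibre q) := inferInstanceAs (ContinuousSMul ℝ (S.fibre q))

instance (q : Q) : T2Space (S.Fibre q) :=
  inferInstanceAs (T2Space (S.fibre q))

/-- The inclusion of a fibre of the constraint submanifold into the cotangent space. -/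
def covector (q : Q) : S.Fibre q →ₗ[ℝ] (TangentSpace 𝓘(ℝ, E) q →L[ℝ] ℝ) := (S.fibre q).subtype

/-- The constraint submanifold `M = Leg(D)`, the total space of a subbundle of `T*Q`. -/
abbrev M : Type _ := TotalSpace (Fin S.rank → ℝ) S.Fibre

/-- The inclusion of the constraint submanifold into `T*Q`. -/
def incl (m : S.M) : CotangentBundle E Q := ⟨m.proj, S.covector m.proj m.2⟩

theorem injective_leg (q : Q) : Function.Injective
    (S.κ.inner q : TangentSpace 𝓘(ℝ, E) q →ₗ[ℝ] TangentSpace 𝓘(ℝ, E) q →L[ℝ] ℝ) := by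
  rw [← LinearMap.ker_eq_bot, LinearMap.ker_eq_bot']
  intro v hv
  by_contra hne
  have h1 := S.κ.pos q v hne
  have h2 : S.κ.inner q v v = 0 := by
    have := congrArg (fun f : TangentSpace 𝓘(ℝ, E) q →L[ℝ] ℝ ↦ f v) hv
    simpa using this
  exact h1.ne' h2

variable {S}

/-- The frame of `M` given by a frame of `D`. -/
def frameBasis (s : LocalFrame 𝓘(ℝ, E) S.D S.rank) {q : Q} (hq : q ∈ s.dom) :
    Module.Basis (Fin S.rank) ℝ (S.Fibre q) :=
  (Module.Basis.span (s.linearIndependent q hq)).map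
    ((LinearEquiv.ofEq _ _ (s.span_eq q hq)).trans
      (Submodule.equivMapOfInjective _ (S.injective_leg q) (S.D q)) :
        Submodule.span ℝ (range fun a ↦ s.vec a q) ≃ₗ[ℝ] S.fibre q)

theorem coe_frameBasis (s : LocalFrame 𝓘(ℝ, E) S.D S.rank) {q : Q} (hq : q ∈ s.dom)
    (a : Fin S.rank) :
    S.covector q (frameBasis s hq a) = S.κ.inner q (s.vec a q) := by
  have h : (LinearEquiv.ofEq _ _ (s.span_eq q hq)
      (Module.Basis.span (s.linearIndependent q hq) a) : TangentSpace 𝓘(ℝ, E) q) = s.vec a q :=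
    congrArg Subtype.val (Module.Basis.span_apply (s.linearIndependent q hq) a)
  exact congrArg (S.κ.inner q) h

open Classical in
/-- The local trivialization of `M` given by a frame of `D`. -/
def pretriv (s : LocalFrame 𝓘(ℝ, E) S.D S.rank) :
    Pretrivialization (Fin S.rank → ℝ) (π (Fin S.rank → ℝ) S.Fibre) where
  toFun m := (m.proj, if h : m.proj ∈ s.dom then (frameBasis s h).equivFun m.2 else 0)
  invFun z := ⟨z.1, if h : z.1 ∈ s.dom then (frameBasis s h).equivFun.symm z.2 else 0⟩
  source := π (Fin S.rank → ℝ) S.Fibre ⁻¹' s.dom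
  target := s.dom ×ˢ univ
  baseSet := s.dom
  open_baseSet := s.isOpen_dom
  open_target := s.isOpen_dom.prod isOpen_univ
  source_eq := rfl
  target_eq := rfl
  proj_toFun _ _ := rfl
  map_source' m hm := ⟨hm, mem_univ _⟩
  map_target' z hz := hz.1
  left_inv' m hm := by
    obtain ⟨q, v⟩ := m
    have hq : q ∈ s.dom := hm
    simp [hq]
  right_inv' z hz := by
    obtain ⟨q, c⟩ := z
    have hq : q ∈ s.dom := hz.1
    simp only [hq, dite_true, LinearEquiv.apply_symm_apply]

open Classical in
theorem pretriv_apply (s : LocalFrame 𝓘(ℝ, E) S.D S.rank) {q : Q} (hq : q ∈ s.dom)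
    (v : S.Fibre q) : (pretriv s ⟨q, v⟩).2 = (frameBasis s hq).equivFun v := by
  change (if h : q ∈ s.dom then (frameBasis s h).equivFun v else 0) = _
  rw [dif_pos hq]

theorem pretriv_symm (s : LocalFrame 𝓘(ℝ, E) S.D S.rank) {q : Q} (hq : q ∈ s.dom)
    (c : Fin S.rank → ℝ) : (pretriv s).symm q c = (frameBasis s hq).equivFun.symm c := by
  rw [LinearEquiv.eq_symm_apply, ← pretriv_apply s hq]
  exact congrArg Prod.snd ((pretriv s).apply_mk_symm hq c)

/-- The matrix of scalar products of the elements of two frames of `D`. -/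
def gram (s t : LocalFrame 𝓘(ℝ, E) S.D S.rank) (q : Q) :
    (Fin S.rank → ℝ) →L[ℝ] (Fin S.rank → ℝ) :=
  ∑ a, ∑ b, S.κ.inner q (s.vec a q) (t.vec b q) •
    (ContinuousLinearMap.proj (R := ℝ) (φ := fun _ : Fin S.rank ↦ ℝ) a).smulRight
      (Pi.single b (1 : ℝ) : Fin S.rank → ℝ)

theorem gram_apply (s t : LocalFrame 𝓘(ℝ, E) S.D S.rank) (q : Q) (hq : q ∈ s.dom)
    (c : Fin S.rank → ℝ) (b : Fin S.rank) :
    gram s t q c b = S.covector q ((frameBasis s hq).equivFun.symm c) (t.vec b q) := by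
  simp [gram, Module.Basis.equivFun_symm_apply, coe_frameBasis, Finset.sum_apply, Pi.single_apply,
    mul_comm]

theorem contMDiffOn_gram (s t : LocalFrame 𝓘(ℝ, E) S.D S.rank) :
    ContMDiffOn 𝓘(ℝ, E) 𝓘(ℝ, (Fin S.rank → ℝ) →L[ℝ] (Fin S.rank → ℝ)) ∞ (gram s t)
      (s.dom ∩ t.dom) := by
  unfold gram
  have key : ∀ a b, ContMDiffOn 𝓘(ℝ, E) 𝓘(ℝ, ℝ) ∞
      (fun q ↦ S.κ.inner q (s.vec a q) (t.vec b q)) (s.dom ∩ t.dom) := by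
    intro a b
    have h := ContMDiffOn.clm_bundle_apply₂ (b := fun q : Q ↦ q) (F₃ := ℝ)
      (E₃ := Bundle.Trivial Q ℝ)
      (S.κ.contMDiff.contMDiffOn (s := s.dom ∩ t.dom))
      ((s.contMDiffOn_vec a).mono inter_subset_left)
      ((t.contMDiffOn_vec b).mono inter_subset_right)
    intro q hq
    have h2 := h q hq
    rw [Bundle.contMDiffWithinAt_section] at h2
    exact h2
  refine contMDiffOn_finsetSum fun a _ ↦ ?_
  refine contMDiffOn_finsetSum fun b _ ↦ ?_
  exact (ContinuousLinearMap.toSpanSingleton ℝ _).contMDiff.comp_contMDiffOn (key a b)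

theorem isInvertible_gram (s : LocalFrame 𝓘(ℝ, E) S.D S.rank) (q : Q) (hq : q ∈ s.dom) :
    (gram s s q).IsInvertible := by
  have hinj : Function.Injective (gram s s q : (Fin S.rank → ℝ) →ₗ[ℝ] (Fin S.rank → ℝ)) := by
    rw [← LinearMap.ker_eq_bot, LinearMap.ker_eq_bot']
    intro c hc
    have h0 : ∀ b, S.κ.inner q (∑ a, c a • s.vec a q) (s.vec b q) = 0 := by
      intro b
      have h1 := congrFun hc b
      rw [ContinuousLinearMap.coe_coe, gram_apply s s q hq] at h1
      simpa [Module.Basis.equivFun_symm_apply, coe_frameBasis] using h1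
    have h1 : ∑ a, c a • s.vec a q = 0 := by
      by_contra hne
      refine (S.κ.pos q _ hne).ne' ?_
      rw [map_sum]
      exact Finset.sum_eq_zero fun b _ ↦ by rw [map_smul, h0, smul_zero]
    exact funext (Fintype.linearIndependent_iff.mp (s.linearIndependent q hq) c h1)
  exact ⟨(LinearEquiv.ofInjectiveEndo _ hinj).toContinuousLinearEquiv, by ext; rfl⟩

theorem contMDiffOn_coordChange (s t : LocalFrame 𝓘(ℝ, E) S.D S.rank) :
    ContMDiffOn 𝓘(ℝ, E) 𝓘(ℝ, (Fin S.rank → ℝ) →L[ℝ] (Fin S.rank → ℝ)) ∞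
      (fun q ↦ (gram t t q).inverse ∘L gram s t q) (s.dom ∩ t.dom) := by
  refine ContMDiffOn.clm_comp (fun q hq ↦ ?_) (contMDiffOn_gram s t)
  have h1 : ContMDiffWithinAt 𝓘(ℝ, E) 𝓘(ℝ, (Fin S.rank → ℝ) →L[ℝ] (Fin S.rank → ℝ)) ∞ (gram t t)
      (s.dom ∩ t.dom) q :=
    (contMDiffOn_gram t t).mono (fun x hx ↦ ⟨hx.2, hx.2⟩) q hq
  have h2 := (ContinuousLinearMap.IsInvertible.contDiffAt_map_inverse (n := ∞)
    (isInvertible_gram t q hq.2)).contMDiffAt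
  exact h2.comp_contMDiffWithinAt q h1

theorem coordChange_apply (s t : LocalFrame 𝓘(ℝ, E) S.D S.rank) (q : Q) (hq : q ∈ s.dom ∩ t.dom)
    (c : Fin S.rank → ℝ) :
    ((gram t t q).inverse ∘L gram s t q) c = (pretriv t ⟨q, (pretriv s).symm q c⟩).2 := by
  have hinv := isInvertible_gram t q hq.2
  rw [pretriv_apply t hq.2, pretriv_symm s hq.1, ContinuousLinearMap.comp_apply]
  have h : gram s t q c =
      gram t t q ((frameBasis t hq.2).equivFun ((frameBasis s hq.1).equivFun.symm c)) := by
    ext b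
    rw [gram_apply s t q hq.1, gram_apply t t q hq.2, LinearEquiv.symm_apply_apply]
  rw [h]
  obtain ⟨e, he⟩ := hinv
  rw [← he, ContinuousLinearMap.inverse_equiv]
  simp

variable (S)

/-- The vector bundle structure of `M`, with the trivializations given by the frames of `D`. -/
def prebundle : VectorPrebundle ℝ (Fin S.rank → ℝ) S.Fibre where
  pretrivializationAtlas := range (pretriv (S := S))
  pretrivialization_linear' := by
    rintro _ ⟨s, rfl⟩
    refine ⟨fun q hq ↦ ⟨fun v w ↦ ?_, fun c v ↦ ?_⟩⟩
    · rw [pretriv_apply s hq, pretriv_apply s hq, pretriv_apply s hq, map_add]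
    · rw [pretriv_apply s hq, pretriv_apply s hq, map_smul]
  pretrivializationAt q := pretriv (S.isRegular_D q).choose
  mem_base_pretrivializationAt q := (S.isRegular_D q).choose_spec
  pretrivialization_mem_atlas q := ⟨_, rfl⟩
  exists_coordChange := by
    rintro _ ⟨s, rfl⟩ _ ⟨t, rfl⟩
    exact ⟨_, (contMDiffOn_coordChange s t).continuousOn, fun q hq c ↦ coordChange_apply s t q hq c⟩
  totalSpaceMk_isInducing q := by
    set s := (S.isRegular_D q).choose with hs
    have hq : q ∈ s.dom := (S.isRegular_D q).choose_spec
    have h1 : (pretriv s ∘ TotalSpace.mk q : S.Fibre q → Q × (Fin S.rank → ℝ))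
        = (fun c ↦ (q, c)) ∘ (frameBasis s hq).equivFun := by
      funext v
      exact Prod.ext rfl (pretriv_apply s hq v)
    rw [h1]
    have : FiniteDimensional ℝ (S.Fibre q) := (frameBasis s hq).finiteDimensional_of_finite
    exact (isInducing_prodMkRight q).comp
      (frameBasis s hq).equivFun.toContinuousLinearEquiv.toHomeomorph.isInducing

instance : S.prebundle.IsContMDiff 𝓘(ℝ, E) ∞ where
  exists_contMDiffCoordChange := by
    rintro _ ⟨s, rfl⟩ _ ⟨t, rfl⟩
    exact ⟨_, contMDiffOn_coordChange s t, fun q hq c ↦ coordChange_apply s t q hq c⟩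

instance : TopologicalSpace S.M := S.prebundle.totalSpaceTopology

instance : FiberBundle (Fin S.rank → ℝ) S.Fibre := S.prebundle.toFiberBundle

instance : VectorBundle ℝ (Fin S.rank → ℝ) S.Fibre := S.prebundle.toVectorBundle

instance : ContMDiffVectorBundle ∞ (Fin S.rank → ℝ) S.Fibre 𝓘(ℝ, E) :=
  S.prebundle.contMDiffVectorBundle 𝓘(ℝ, E)

/-- The model with corners of `M`. -/
abbrev modelM : ModelWithCorners ℝ (E × (Fin S.rank → ℝ)) (ModelProd E (Fin S.rank → ℝ)) :=
  𝓘(ℝ, E).prod 𝓘(ℝ, Fin S.rank → ℝ)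

end NonholonomicSystem

variable (E Q) in
/-- The model with corners of `T*Q`. -/
abbrev modelCotangent : ModelWithCorners ℝ (E × (E →L[ℝ] ℝ)) (ModelProd E (E →L[ℝ] ℝ)) :=
  𝓘(ℝ, E).prod 𝓘(ℝ, E →L[ℝ] ℝ)

variable (E Q) in
/-- The Liouville 1-form `Θ_Q` of `T*Q`: its value at a covector `p` is `p` composed with
the tangent map of the projection `T*Q → Q`. -/
def liouvilleForm : DForm (modelCotangent E) (CotangentBundle E Q) 1 ℝ := fun p ↦
  ContinuousAlternatingMap.ofSubsingleton ℝ _ ℝ (0 : Fin 1)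
    ((p.2 : TangentSpace 𝓘(ℝ, E) p.proj →L[ℝ] ℝ) ∘L
      mfderiv (modelCotangent E) 𝓘(ℝ, E)
        (TotalSpace.proj : CotangentBundle E Q → Q) p)

variable (E Q) in
/-- The canonical 2-form `Ω_Q = - dΘ_Q` of `T*Q`. -/
def canonicalForm : DForm (modelCotangent E) (CotangentBundle E Q) 2 ℝ :=
  fun p ↦ -(liouvilleForm E Q).d p

namespace NonholonomicSystem

variable (S : NonholonomicSystem E Q)

/-- The 1-form `Θ_M`, the pullback of the Liouville form to `M`. -/
def ΘM : DForm S.modelM S.M 1 ℝ := (liouvilleForm E Q).pullback S.incl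

/-- The 2-form `Ω_M`, the pullback of the canonical form to `M`. -/
def ΩM : DForm S.modelM S.M 2 ℝ := (canonicalForm E Q).pullback S.incl

/-- The distribution `C` on `M`: the tangent vectors whose projection to `Q` lies in `D`. -/
def C (m : S.M) : Submodule ℝ (TangentSpace S.modelM m) :=
  (S.D m.proj).comap
    (mfderiv S.modelM 𝓘(ℝ, E) (TotalSpace.proj : S.M → Q) m :
      TangentSpace S.modelM m →ₗ[ℝ] TangentSpace 𝓘(ℝ, E) m.proj)

/-- The nonholonomic bivector `π_nh`, associated to `C` and `Ω_M`. -/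
def nhSharp [FiniteDimensional ℝ E] : SharpField S.modelM S.M := sharpOfForm S.C S.ΩM

end NonholonomicSystem

end System

/-! ### Symmetries -/

section Symmetry

variable {E : Type*} [NormedAddCommGroup E] [NormedSpace ℝ E]
  {Q : Type*} [TopologicalSpace Q] [ChartedSpace E Q] [IsManifold 𝓘(ℝ, E) ∞ Q]
  {EG : Type*} [NormedAddCommGroup EG] [NormedSpace ℝ EG]
  {G : Type*} [Group G] [TopologicalSpace G] [ChartedSpace EG G] [MulAction G Q]

variable (E) in
/-- The tangent map at `q` of the action of `g` on `Q`. -/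
def tangentSMul {G : Type*} [Group G] [MulAction G Q] (g : G) (q : Q) :
    TangentSpace 𝓘(ℝ, E) q →L[ℝ] TangentSpace 𝓘(ℝ, E) (g • q) :=
  mfderiv 𝓘(ℝ, E) 𝓘(ℝ, E) (fun x : Q ↦ g • x) q

/-- The cotangent lift of the action of `g`: it maps a covector `p` at `q` to the covector
`p ∘ (T_q g)⁻¹` at `g • q`. -/
def cotangentLift {G : Type*} [Group G] [MulAction G Q] (g : G) (q : Q)
    (p : TangentSpace 𝓘(ℝ, E) q →L[ℝ] ℝ) : TangentSpace 𝓘(ℝ, E) (g • q) →L[ℝ] ℝ :=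
  p ∘L (tangentSMul E g q).inverse

namespace NonholonomicSystem

variable (S : NonholonomicSystem E Q)

variable (EG G) in
/-- The group `G` is a symmetry of the system: it acts smoothly on `Q`, and the lifted action
on `TQ` leaves the Lagrangian and the constraints invariant. -/
structure IsSymmetry : Prop where
  contMDiff_smul : ContMDiff (𝓘(ℝ, EG).prod 𝓘(ℝ, E)) 𝓘(ℝ, E) ∞ (fun p : G × Q ↦ p.1 • p.2)
  lagrangian_eq : ∀ (g : G) (q : Q) (v : TangentSpace 𝓘(ℝ, E) q),
    S.lagrangian ⟨g • q, tangentSMul E g q v⟩ = S.lagrangian ⟨q, v⟩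
  map_D : ∀ (g : G) (q : Q),
    (S.D q).map (tangentSMul E g q : TangentSpace 𝓘(ℝ, E) q →ₗ[ℝ] TangentSpace 𝓘(ℝ, E) (g • q))
      = S.D (g • q)

variable {S}

theorem IsSymmetry.inner_eq (h : S.IsSymmetry EG G) (g : G) (q : Q)
    (v w : TangentSpace 𝓘(ℝ, E) q) :
    S.κ.inner (g • q) (tangentSMul E g q v) (tangentSMul E g q w) = S.κ.inner q v w := by
  have hU : S.U (g • q) = S.U q := by
    have := h.lagrangian_eq g q 0
    simpa [lagrangian] using this
  have hK : ∀ u : TangentSpace 𝓘(ℝ, E) q,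
      S.κ.inner (g • q) (tangentSMul E g q u) (tangentSMul E g q u) = S.κ.inner q u u := by
    intro u
    have := h.lagrangian_eq g q u
    simp only [lagrangian, hU] at this
    linarith
  have h1 := hK (v + w)
  have h2 := hK v
  have h3 := hK w
  simp only [map_add, add_apply] at h1
  have h4 := S.κ.symm q w v
  have h5 := S.κ.symm (g • q) (tangentSMul E g q w) (tangentSMul E g q v)
  linarith

theorem IsSymmetry.isInvertible_tangentSMul (h : S.IsSymmetry EG G) (g : G) (q : Q) :
    (tangentSMul E g q).IsInvertible :=
  haveI : ContMDiffSMul 𝓘(ℝ, EG) 𝓘(ℝ, E) ∞ G Q := ⟨h.contMDiff_smul⟩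
  ⟨(Diffeomorph.smul 𝓘(ℝ, EG) 𝓘(ℝ, E) ∞ g).mfderivToContinuousLinearEquiv (by simp) q,
    Diffeomorph.mfderivToContinuousLinearEquiv_coe _ _⟩

/-- The constraint submanifold is invariant under the cotangent lift of the action. -/
theorem IsSymmetry.cotangentLift_mem (h : S.IsSymmetry EG G) (g : G) (q : Q)
    (p : TangentSpace 𝓘(ℝ, E) q →L[ℝ] ℝ) (hp : p ∈ S.fibre q) :
    cotangentLift g q p ∈ S.fibre (g • q) := by
  obtain ⟨v, hv, rfl⟩ := hp
  refine ⟨tangentSMul E g q v, ?_, ?_⟩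
  · rw [← h.map_D g q]
    exact ⟨v, hv, rfl⟩
  · obtain ⟨e, he⟩ := h.isInvertible_tangentSMul g q
    ext w
    obtain ⟨u, rfl⟩ := e.surjective w
    have h1 := h.inner_eq g q v u
    have h2 : (tangentSMul E g q).inverse (e u) = u := by
      rw [← he, ContinuousLinearMap.inverse_equiv]
      simp
    have h3 : tangentSMul E g q u = e u := by rw [← he]; rfl
    rw [h3] at h1
    change S.κ.inner (g • q) (tangentSMul E g q v) (e u)
      = S.κ.inner q v ((tangentSMul E g q).inverse (e u))
    rw [h1, h2]

/-- The action `φ_g : M → M`, the restriction of the cotangent lift of the action on `Q`. -/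
def IsSymmetry.act (h : S.IsSymmetry EG G) (g : G) (m : S.M) : S.M :=
  ⟨g • m.proj, (⟨cotangentLift g m.proj (S.covector m.proj m.2),
    h.cotangentLift_mem g m.proj _ (Subtype.prop (p := (· ∈ S.fibre m.proj)) m.2)⟩ :
      S.fibre (g • m.proj))⟩

/-- The infinitesimal generator `ξ ↦ ξ_M(m)`, the derivative of `g ↦ φ_g(m)` at the identity.
The Lie algebra of `G`, which is the tangent space at the identity, is by
definition the model space `EG`. -/
def IsSymmetry.generator (h : S.IsSymmetry EG G) (m : S.M) : EG →L[ℝ] TangentSpace S.modelM m :=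
  mfderiv 𝓘(ℝ, EG) S.modelM (fun g : G ↦ h.act g m) 1

/-- The tangent space `V_m` of the orbit of `m`. -/
def IsSymmetry.V (h : S.IsSymmetry EG G) (m : S.M) : Submodule ℝ (TangentSpace S.modelM m) :=
  LinearMap.range (h.generator m : EG →ₗ[ℝ] TangentSpace S.modelM m)

/-- The canonical momentum map `J : M → 𝔤*`, `⟨J(m), η⟩ = Θ_M(η_M(m))`. -/
def IsSymmetry.momentum (h : S.IsSymmetry EG G) (m : S.M) : EG →L[ℝ] ℝ :=
  (ContinuousAlternatingMap.ofSubsingleton ℝ _ ℝ (0 : Fin 1)).symm (S.ΘM m) ∘L h.generator m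

/-- A `G`-invariant vertical complement `W` of `C` in `TM`. -/
structure IsSymmetry.IsVerticalComplement (h : S.IsSymmetry EG G)
    (W : (m : S.M) → Submodule ℝ (TangentSpace S.modelM m)) : Prop where
  isRegular : ∃ k, IsRegularDistribution S.modelM W k
  isCompl : ∀ m, IsCompl (S.C m) (W m)
  le_vertical : ∀ m, W m ≤ h.V m
  invariant : ∀ (g : G) (m : S.M),
    (W m).map (mfderiv S.modelM S.modelM (h.act g) m :
      TangentSpace S.modelM m →ₗ[ℝ] TangentSpace S.modelM (h.act g m)) = W (h.act g m)

namespace IsSymmetry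

variable [FiniteDimensional ℝ E] {h : S.IsSymmetry EG G}
  {W : (m : S.M) → Submodule ℝ (TangentSpace S.modelM m)}

/-- The 1-form `A_W` with values in `𝔤`: `A_W(v) = ξ` if and only if `P_W(v) = ξ_M(m)`, where
`P_W` is the projection to `W` along `C`. Here `ξ ↦ ξ_M(m)` is injective for a free action
and `LinearMap.leftInverse` inverts it on its range, which contains `W`. -/
def IsVerticalComplement.connection (hW : h.IsVerticalComplement W) : DForm S.modelM S.M 1 EG :=
  fun m ↦
    haveI := finiteDimensional_tangentSpace S.modelM m
    haveI : T2Space (TangentSpace S.modelM m) :=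
      inferInstanceAs (T2Space (E × (Fin S.rank → ℝ)))
    ContinuousAlternatingMap.ofSubsingleton ℝ _ EG (0 : Fin 1) <| LinearMap.toContinuousLinearMap <|
      (h.generator m : EG →ₗ[ℝ] TangentSpace S.modelM m).leftInverse ∘ₗ
        (W m).projection (S.C m) (hW.isCompl m).symm

/-- The `W`-curvature `K_W(X, Y) = dA_W(P_C X, P_C Y)`, where `P_C` is the projection to `C`
along `W`. -/
def IsVerticalComplement.curvature (hW : h.IsVerticalComplement W) : DForm S.modelM S.M 2 EG :=
  fun m ↦
    haveI := finiteDimensional_tangentSpace S.modelM m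
    haveI : T2Space (TangentSpace S.modelM m) :=
      inferInstanceAs (T2Space (E × (Fin S.rank → ℝ)))
    (hW.connection.d m).compContinuousLinearMap <| LinearMap.toContinuousLinearMap <|
      (S.C m).projection (W m) (hW.isCompl m)

/-- The 3-form `dJ ∧ K_W`, the cyclic sum of `⟨dJ(Z), K_W(X, Y)⟩`. -/
def IsVerticalComplement.dJWedgeK (hW : h.IsVerticalComplement W) (m : S.M)
    (X Y Z : TangentSpace S.modelM m) : ℝ :=
  let dJ : TangentSpace S.modelM m →L[ℝ] (EG →L[ℝ] ℝ) :=
    mfderiv S.modelM 𝓘(ℝ, EG →L[ℝ] ℝ) h.momentum m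
  dJ Z (hW.curvature m ![X, Y]) + dJ X (hW.curvature m ![Y, Z]) + dJ Y (hW.curvature m ![Z, X])

/-- The trivector `ψ_π(α, β, γ)`, the cyclic sum of `γ((K_W(π♯ α, π♯ β))_M)`. -/
def IsVerticalComplement.ψ (hW : h.IsVerticalComplement W) (p : BivectorField S.modelM S.M)
    (m : S.M) (α β γ : TangentSpace S.modelM m →L[ℝ] ℝ) : ℝ :=
  γ (h.generator m (hW.curvature m ![p.sharp m α, p.sharp m β]))
    + α (h.generator m (hW.curvature m ![p.sharp m β, p.sharp m γ]))
    + β (h.generator m (hW.curvature m ![p.sharp m γ, p.sharp m α]))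

end IsSymmetry

end NonholonomicSystem

end Symmetry

end

/-! The bivector π_B is determined by C and the 2-form σ = Ω_M - B: π_B♯α lies in C and σ(Z, π_B♯α)
= α(Z) for all Z in C. This is `IsGaugeTransformation.spec`; it rests on the nondegeneracy of Ω_M on
C (`injective_flatOn_ΩM`), which in turn comes from the positivity of κ.

Fix m and a chart around it, extend the three covectors to differentials of linear functions ℓ_i,
and let X_i be their images under π_B♯. These fields are sections of C, with σ(X_i, X_j) = ℓ_j(X_i).
If C were integrable, differentiating this identity and comparing with dσ(X_0, X_1, X_2) would give
the usual statement that the Jacobiator is -dσ(X_0, X_1, X_2). In general the bracket [X_i, X_j]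
leaves C, and σ([X_i, X_j], X_k) = ℓ_k([X_i, X_j]) holds only after the W-component of the bracket
is removed. Since A_W annihilates the X_i, this component is the generator of A_W([X_i, X_j]) =
-dA_W(X_i, X_j) = -K_W(X_i, X_j). Hence the Jacobiator is -dσ plus the cyclic sum of σ(K_M, X_k) -
ℓ_k(K_M), where K_M is the generator of K_W(X_i, X_j). This computation on a vector space is
`jacobiator_eq`.

It remains to identify the terms. As dΩ_M = 0, -dσ is dB. As K_M lies in W, which B annihilates,
σ(K_M, X_k) = Ω_M(K_M, X_k), and this is ⟨dJ(X_k), K_W(X_i, X_j)⟩ by the momentum identity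
`ΩM_generator`. The terms ℓ_k(K_M) add up to ψ. The sign in the action of π♯ on 3-forms accounts for
the signs in the formula.

The rest is regularity. The differentiation of A_W needs its smoothness
(`contDiffAt_connection_inChart`), which uses the injectivity of ξ ↦ ξ_Q for a free action
(`eq_zero_of_mfderiv_smul_eq_zero`). The momentum identity is the derivative at the identity of the
invariance of the Liouville form (`fderiv_frameSum_generator`). -/

theorem ContinuousAlternatingMap.pair_swap {V F : Type*} [AddCommGroup V] [Module ℝ V]
    [TopologicalSpace V] [AddCommGroup F] [Module ℝ F] [TopologicalSpace F]
    (σ : V [⋀^Fin 2]→L[ℝ] F) (u v : V) :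
    σ ![u, v] = -σ ![v, u] := by
  have h := σ.toAlternatingMap.map_swap ![v, u] (i := 0) (j := 1) (by decide)
  have e : ![v, u] ∘ Equiv.swap (0 : Fin 2) 1 = ![u, v] := by ext i; fin_cases i <;> rfl
  rw [e] at h
  exact h

/-! ### Exterior derivatives and the Jacobiator on a vector space -/

section Coordinates

variable {V : Type*} [NormedAddCommGroup V] [NormedSpace ℝ V]
  {F : Type*} [NormedAddCommGroup F] [NormedSpace ℝ F]

theorem ContinuousAlternatingMap.pair_add_left (σ : V [⋀^Fin 2]→L[ℝ] F) (u v w : V) :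
    σ ![u + v, w] = σ ![u, w] + σ ![v, w] := by
  simpa only [update_pair_zero] using σ.map_update_add ![0, w] 0 u v

theorem ContinuousAlternatingMap.pair_sub_left (σ : V [⋀^Fin 2]→L[ℝ] F) (u v w : V) :
    σ ![u - v, w] = σ ![u, w] - σ ![v, w] := by
  simpa only [update_pair_zero] using σ.map_update_sub ![0, w] 0 u v

theorem ContinuousAlternatingMap.one_sub (A : V [⋀^Fin 1]→L[ℝ] F) (u v : V) :
    A ![u - v] = A ![u] - A ![v] := by
  simp

theorem extDeriv_one_apply {A : V → V [⋀^Fin 1]→L[ℝ] F} {y : V} (hA : DifferentiableAt ℝ A y)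
    (u v : V) : extDeriv A y ![u, v] = fderiv ℝ A y u ![v] - fderiv ℝ A y v ![u] := by
  have h : ∀ w : Fin 1 → V, fderiv ℝ (A · w) y = (fderiv ℝ A y).flipAlternating w := fun w ↦
    (hA.hasFDerivAt.continuousAlternatingMap_apply_const w).fderiv
  have h0 : Fin.removeNth 0 ![u, v] = ![v] := by ext i; fin_cases i; rfl
  have h1 : Fin.removeNth 1 ![u, v] = ![u] := by ext i; fin_cases i; rfl
  rw [extDeriv_apply hA]
  refine (Fin.sum_univ_two _).trans ?_
  simp only [h, h0, h1]
  simp [sub_eq_add_neg]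

theorem extDeriv_two_apply {σ : V → V [⋀^Fin 2]→L[ℝ] F} {y : V} (hσ : DifferentiableAt ℝ σ y)
    (u v w : V) : extDeriv σ y ![u, v, w]
      = fderiv ℝ σ y u ![v, w] - fderiv ℝ σ y v ![u, w] + fderiv ℝ σ y w ![u, v] := by
  have h : ∀ z : Fin 2 → V, fderiv ℝ (σ · z) y = (fderiv ℝ σ y).flipAlternating z := fun z ↦
    (hσ.hasFDerivAt.continuousAlternatingMap_apply_const z).fderiv
  have h0 : Fin.removeNth 0 ![u, v, w] = ![v, w] := by ext i; fin_cases i <;> rfl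
  have h1 : Fin.removeNth 1 ![u, v, w] = ![u, w] := by ext i; fin_cases i <;> rfl
  have h2 : Fin.removeNth 2 ![u, v, w] = ![u, v] := by ext i; fin_cases i <;> rfl
  rw [extDeriv_apply hσ]
  refine (Fin.sum_univ_three _).trans ?_
  simp only [h, h0, h1, h2]
  simp [sub_eq_add_neg]

theorem fderiv_one_apply {A : V → V [⋀^Fin 1]→L[ℝ] F} {X : V → V} {y : V}
    (hA : DifferentiableAt ℝ A y) (hX : DifferentiableAt ℝ X y) (v : V) :
    fderiv ℝ (fun z ↦ A z ![X z]) y v = fderiv ℝ A y v ![X y] + A y ![fderiv ℝ X y v] := by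
  have h := fderiv_continuousAlternatingMap_apply_apply (g := ![X])
    hA (fun i ↦ by fin_cases i; exact hX) v
  have e : ∀ z, (fun i ↦ ![X] i z) = ![X z] := fun z ↦ by ext i; fin_cases i; rfl
  have e' : ∀ a b : V, Function.update ![a] 0 b = ![b] := fun a b ↦ by ext i; fin_cases i; rfl
  simp only [e, Finset.univ_unique, Finset.sum_singleton] at h
  rw [h]
  exact congrArg _ (congrArg (A y) (e' _ _))

theorem fderiv_two_apply {σ : V → V [⋀^Fin 2]→L[ℝ] F} {X Y : V → V} {y : V}
    (hσ : DifferentiableAt ℝ σ y) (hX : DifferentiableAt ℝ X y) (hY : DifferentiableAt ℝ Y y)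
    (v : V) :
    fderiv ℝ (fun z ↦ σ z ![X z, Y z]) y v = fderiv ℝ σ y v ![X y, Y y]
      + σ y ![fderiv ℝ X y v, Y y] + σ y ![X y, fderiv ℝ Y y v] := by
  have h := fderiv_continuousAlternatingMap_apply_apply (g := ![X, Y])
    hσ (fun i ↦ by fin_cases i; exacts [hX, hY]) v
  have e : ∀ z, (fun i ↦ ![X, Y] i z) = ![X z, Y z] := fun z ↦ by ext i; fin_cases i <;> rfl
  simp only [e, Fin.sum_univ_two, update_pair_zero, update_pair_one] at h
  rw [add_assoc]
  exact h

/-- The exterior derivative of a 1-form on vector fields that it annihilates. -/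
theorem extDeriv_one_apply_of_eventually_zero {A : V → V [⋀^Fin 1]→L[ℝ] F} {X Y : V → V} {y : V}
    (hA : DifferentiableAt ℝ A y) (hX : DifferentiableAt ℝ X y) (hY : DifferentiableAt ℝ Y y)
    (hAX : ∀ᶠ z in 𝓝 y, A z ![X z] = 0) (hAY : ∀ᶠ z in 𝓝 y, A z ![Y z] = 0) :
    extDeriv A y ![X y, Y y] = -A y ![fderiv ℝ Y y (X y) - fderiv ℝ X y (Y y)] := by
  -- Leibniz rule for the function A(Z), which vanishes near y. The difference of two instances of
  -- it leaves A of the Lie bracket.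
  have key : ∀ {Z : V → V}, DifferentiableAt ℝ Z y → (∀ᶠ z in 𝓝 y, A z ![Z z] = 0) → ∀ u,
      fderiv ℝ A y u ![Z y] = -A y ![fderiv ℝ Z y u] := by
    intro Z hZ hAZ u
    rw [eq_neg_iff_add_eq_zero, ← fderiv_one_apply hA hZ]
    have : (fun z ↦ A z ![Z z]) =ᶠ[𝓝 y] fun _ ↦ (0 : F) := hAZ
    rw [this.fderiv_eq]
    simp
  rw [extDeriv_one_apply hA, key hX hAX, key hY hAY, ContinuousAlternatingMap.one_sub]
  abel

/-- The Jacobiator of a bivector on a vector space that is determined by a 2-form `σ` and the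
kernel of a 1-form `A`. The fields `X i` are the Hamiltonian vector fields of linear functions
`ℓ i`, and `v - gen (A v)` is the projection of `v` to the kernel of `A`. -/
theorem jacobiator_eq {σ : V → V [⋀^Fin 2]→L[ℝ] ℝ} {A : V → V [⋀^Fin 1]→L[ℝ] F} {gen : F →L[ℝ] V}
    {ℓ : Fin 3 → V →L[ℝ] ℝ} {X : Fin 3 → V → V} {y : V}
    (hσ : DifferentiableAt ℝ σ y) (hA : DifferentiableAt ℝ A y)
    (hX : ∀ i, DifferentiableAt ℝ (X i) y)
    (hσX : ∀ i j, ∀ᶠ z in 𝓝 y, σ z ![X i z, X j z] = ℓ j (X i z))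
    (hAX : ∀ i, ∀ᶠ z in 𝓝 y, A z ![X i z] = 0)
    (hC : ∀ v i, σ y ![v - gen (A y ![v]), X i y] = ℓ i (v - gen (A y ![v]))) :
    fderiv ℝ (fun z ↦ ℓ 2 (X 1 z)) y (X 0 y) + fderiv ℝ (fun z ↦ ℓ 0 (X 2 z)) y (X 1 y)
        + fderiv ℝ (fun z ↦ ℓ 1 (X 0 z)) y (X 2 y)
      = -extDeriv σ y ![X 0 y, X 1 y, X 2 y]
        + (σ y ![gen (extDeriv A y ![X 0 y, X 1 y]), X 2 y]
          + σ y ![gen (extDeriv A y ![X 1 y, X 2 y]), X 0 y]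
          + σ y ![gen (extDeriv A y ![X 2 y, X 0 y]), X 1 y])
        - (ℓ 2 (gen (extDeriv A y ![X 0 y, X 1 y])) + ℓ 0 (gen (extDeriv A y ![X 1 y, X 2 y]))
          + ℓ 1 (gen (extDeriv A y ![X 2 y, X 0 y]))) := by
  have hℓ : ∀ i j v, fderiv ℝ (fun z ↦ ℓ j (X i z)) y v = ℓ j (fderiv ℝ (X i) y v) := by
    intro i j v
    have := ((ℓ j).hasFDerivAt.comp y (hX i).hasFDerivAt).fderiv
    exact congrArg (fun L : V →L[ℝ] ℝ ↦ L v) this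
  -- Derivative of σ(X_i, X_j) = ℓ_j(X_i) along X_k; the ℓ_j have constant coefficients, so they
  -- contribute no term of their own.
  have h1 : ∀ i j k, fderiv ℝ σ y (X k y) ![X i y, X j y]
      + σ y ![fderiv ℝ (X i) y (X k y), X j y] + σ y ![X i y, fderiv ℝ (X j) y (X k y)]
      = ℓ j (fderiv ℝ (X i) y (X k y)) := by
    intro i j k
    rw [← fderiv_two_apply hσ (hX i) (hX j), ← hℓ]
    exact congrArg (fun L : V →L[ℝ] ℝ ↦ L (X k y)) (Filter.EventuallyEq.fderiv_eq (hσX i j))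
  have h3 : ∀ i j, extDeriv A y ![X i y, X j y]
      = -A y ![fderiv ℝ (X j) y (X i y) - fderiv ℝ (X i) y (X j y)] := fun i j ↦
    extDeriv_one_apply_of_eventually_zero hA (hX i) (hX j) (hAX i) (hAX j)
  -- The bracket corrected by gen(dA(X_i, X_j)) lies in the kernel of A by `h3`, so `hC` applies to
  -- it. Moving the bracket to the other side leaves its failure to satisfy σ([X_i, X_j], X_k) =
  -- ℓ_k([X_i, X_j]).
  have h4 : ∀ i j k, σ y ![gen (extDeriv A y ![X i y, X j y]), X k y]
      - ℓ k (gen (extDeriv A y ![X i y, X j y]))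
      = ℓ k (fderiv ℝ (X j) y (X i y)) - ℓ k (fderiv ℝ (X i) y (X j y))
        - (σ y ![fderiv ℝ (X j) y (X i y), X k y] - σ y ![fderiv ℝ (X i) y (X j y), X k y]) := by
    intro i j k
    have h := hC (fderiv ℝ (X j) y (X i y) - fderiv ℝ (X i) y (X j y)) k
    have h' : ∀ u : V, u - gen (A y ![u]) = u + gen (-A y ![u]) := fun u ↦ by
      rw [map_neg, sub_eq_add_neg]
    rw [h', ← h3, ContinuousAlternatingMap.pair_add_left, ContinuousAlternatingMap.pair_sub_left,
      map_add, map_sub] at h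
    linarith
  rw [extDeriv_two_apply hσ, hℓ, hℓ, hℓ]
  have e1 := h4 0 1 2
  have e2 := h4 1 2 0
  have e3 := h4 2 0 1
  have s := fun u v ↦ (σ y).pair_swap u v
  have s' := fun k u v ↦ (fderiv ℝ σ y (X k y)).pair_swap u v
  -- Each derivative of σ is taken with both orders of its arguments: the sum of the two gives
  -- ℓ_j(D_k X_i) = -ℓ_i(D_k X_j), where D_k is the derivative along X_k. By this skewness the
  -- ℓ-terms of `e1`, `e2`, `e3` add up to twice the Jacobiator, while dσ contains it once along
  -- with the same σ-terms. So `e1 + e2 + e3` is the Jacobiator plus dσ.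
  have f1 := h1 1 2 0
  have f1' := h1 2 1 0
  have f2 := h1 2 0 1
  have f2' := h1 0 2 1
  have f3 := h1 0 1 2
  have f3' := h1 1 0 2
  rw [s (X 1 y)] at f1
  rw [s (X 2 y)] at f1' f2
  rw [s (X 0 y)] at f2' f3
  rw [s (X 1 y)] at f3'
  rw [s' 0 (X 2 y)] at f1'
  rw [s' 1 (X 2 y)] at f2
  rw [s' 2 (X 1 y)] at f3'
  linarith

end Coordinates

theorem minSmoothness_two_le_infty : minSmoothness ℝ 2 ≤ ∞ := by
  rw [minSmoothness_of_isRCLikeNormedField]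
  exact WithTop.coe_le_coe.2 (le_top : (2 : ℕ∞) ≤ ⊤)

/-! ### Vector fields and forms in the charts of a manifold -/

section Charts

variable {EP : Type*} [NormedAddCommGroup EP] [NormedSpace ℝ EP]
  {HP : Type*} [TopologicalSpace HP] {J : ModelWithCorners ℝ EP HP}
  {P : Type*} [TopologicalSpace P] [ChartedSpace HP P]

variable (J) in
/-- The derivative at `x` of the chart around `x₀`, with values in the model space. -/
noncomputable def chartDeriv (x₀ x : P) : TangentSpace J x →L[ℝ] EP :=
  mfderiv J 𝓘(ℝ, EP) (extChartAt J x₀) x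

variable (J) in
/-- The derivative at `y` of the inverse of the chart around `x₀`. -/
noncomputable def chartSymmDeriv (x₀ : P) (y : EP) :
    EP →L[ℝ] TangentSpace J ((extChartAt J x₀).symm y) :=
  mfderiv 𝓘(ℝ, EP) J (extChartAt J x₀).symm y

/-- The coordinate representation of a vector field in the chart around `x₀`. -/
noncomputable def vectorFieldInChart (w : (x : P) → TangentSpace J x) (x₀ : P) (y : EP) : EP :=
  chartDeriv J x₀ ((extChartAt J x₀).symm y) (w ((extChartAt J x₀).symm y))

theorem symm_mem_chart_source {x₀ : P} {y : EP} (hy : y ∈ (extChartAt J x₀).target) :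
    (extChartAt J x₀).symm y ∈ (chartAt HP x₀).source := by
  rw [← extChartAt_source J]
  exact (extChartAt J x₀).map_target hy

section

variable [IsManifold J ∞ P]

/-- Smoothness of a section is tested in a trivialization of the tangent bundle, whereas forms and
bivectors are represented through derivatives of charts. This equality lets the former be used for
the latter. -/
theorem chartDeriv_eq_trivializationAt {x₀ x : P} (hx : x ∈ (chartAt HP x₀).source)
    (v : TangentSpace J x) :
    chartDeriv J x₀ x v = (trivializationAt EP (TangentSpace J : P → Type _) x₀ ⟨x, v⟩).2 := by
  have h := TangentBundle.continuousLinearMapAt_trivializationAt (I := J) hx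
  refine (congrArg (fun L : TangentSpace J x →L[ℝ] EP ↦ L v) h).symm.trans ?_
  refine congrFun (Trivialization.coe_linearMapAt_of_mem _ ?_) v
  rwa [TangentBundle.trivializationAt_baseSet]

theorem contDiffOn_vectorFieldInChart {w : (x : P) → TangentSpace J x} {s : Set P} (hs : IsOpen s)
    (hw : ContMDiffOn J J.tangent ∞ (fun x ↦ (TotalSpace.mk' EP x (w x) : TangentBundle J P)) s)
    (x₀ : P) :
    ContDiffOn ℝ ∞ (vectorFieldInChart w x₀)
      ((extChartAt J x₀).target ∩ (extChartAt J x₀).symm ⁻¹' s) := by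
  set e := trivializationAt EP (TangentSpace J : P → Type _) x₀
  have hb : e.baseSet = (chartAt HP x₀).source := TangentBundle.trivializationAt_baseSet x₀
  have h1 : ContMDiffOn J 𝓘(ℝ, EP) ∞ (fun x ↦ (e ⟨x, w x⟩).2) (s ∩ e.baseSet) :=
    (e.contMDiffOn_section_iff (hs.inter e.open_baseSet) inter_subset_right).1
      (hw.mono inter_subset_left)
  have h2 : ContMDiffOn 𝓘(ℝ, EP) 𝓘(ℝ, EP) ∞
      (fun y ↦ (e ⟨(extChartAt J x₀).symm y, w ((extChartAt J x₀).symm y)⟩).2)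
      ((extChartAt J x₀).target ∩ (extChartAt J x₀).symm ⁻¹' s) :=
    h1.comp ((contMDiffOn_extChartAt_symm x₀).mono inter_subset_left)
      fun y hy ↦ ⟨hy.2, hb ▸ symm_mem_chart_source hy.1⟩
  exact h2.contDiffOn.congr fun y hy ↦
    chartDeriv_eq_trivializationAt (symm_mem_chart_source hy.1) _

variable [J.Boundaryless]

theorem mdifferentiableAt_extChartAt_symm {x₀ : P} {y : EP} (hy : y ∈ (extChartAt J x₀).target) :
    MDifferentiableAt 𝓘(ℝ, EP) J (extChartAt J x₀).symm y := by
  have h := mdifferentiableWithinAt_extChartAt_symm (I := J) hy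
  rwa [J.range_eq_univ, mdifferentiableWithinAt_univ] at h

theorem contMDiffAt_extChartAt_symm {x₀ : P} {y : EP} (hy : y ∈ (extChartAt J x₀).target) :
    ContMDiffAt 𝓘(ℝ, EP) J ∞ (extChartAt J x₀).symm y :=
  (contMDiffOn_extChartAt_symm x₀).contMDiffAt ((isOpen_extChartAt_target x₀).mem_nhds hy)

theorem chartDeriv_chartSymmDeriv {x₀ : P} {y : EP} (hy : y ∈ (extChartAt J x₀).target) (v : EP) :
    chartDeriv J x₀ ((extChartAt J x₀).symm y) (chartSymmDeriv J x₀ y v) = v := by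
  have h := mfderiv_extChartAt_comp_mfderivWithin_extChartAt_symm (I := J) hy
  rw [J.range_eq_univ, mfderivWithin_univ] at h
  exact congrArg (fun L : EP →L[ℝ] EP ↦ L v) h

theorem chartSymmDeriv_chartDeriv {x₀ : P} {y : EP} (hy : y ∈ (extChartAt J x₀).target)
    (v : TangentSpace J ((extChartAt J x₀).symm y)) :
    chartSymmDeriv J x₀ y (chartDeriv J x₀ ((extChartAt J x₀).symm y) v) = v := by
  have h := mfderivWithin_extChartAt_symm_comp_mfderiv_extChartAt (I := J) hy
  rw [J.range_eq_univ, mfderivWithin_univ] at h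
  exact congrArg (fun L : TangentSpace J ((extChartAt J x₀).symm y) →L[ℝ]
    TangentSpace J ((extChartAt J x₀).symm y) ↦ L v) h

end

variable {F : Type*} [NormedAddCommGroup F] [NormedSpace ℝ F]

theorem DForm.inChart_apply {k : ℕ} (θ : DForm J P k F) (x₀ : P) (y : EP) (v : Fin k → EP) :
    θ.inChart x₀ y v = θ ((extChartAt J x₀).symm y) (fun i ↦ chartSymmDeriv J x₀ y (v i)) := rfl

theorem DForm.d_apply {k : ℕ} (θ : DForm J P k F) (x : P) (v : Fin (k + 1) → TangentSpace J x) :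
    θ.d x v = extDeriv (θ.inChart x) (extChartAt J x x) (fun i ↦ chartDeriv J x x (v i)) := rfl

/-- The derivatives of the chart and of its inverse are mutually inverse, so a form can be evaluated
at any point of the chart domain from its coordinate representation. -/
theorem DForm.inChart_chartDeriv [J.Boundaryless] [IsManifold J ∞ P] {k : ℕ}
    (θ : DForm J P k F) {x₀ x : P} (hx : x ∈ (extChartAt J x₀).source)
    (v : Fin k → TangentSpace J x) :
    θ.inChart x₀ (extChartAt J x₀ x) (fun i ↦ chartDeriv J x₀ x (v i)) = θ x v := by
  obtain ⟨y, hy, rfl⟩ : ∃ y ∈ (extChartAt J x₀).target, x = (extChartAt J x₀).symm y :=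
    ⟨_, (extChartAt J x₀).map_source hx, ((extChartAt J x₀).left_inv hx).symm⟩
  rw [(extChartAt J x₀).right_inv hy, DForm.inChart_apply]
  simp only [chartSymmDeriv_chartDeriv hy]

/-- The exterior derivative of a form commutes with the pullback along a smooth map from a vector
space. -/
theorem DForm.d_comp_mfderiv [J.Boundaryless] [IsManifold J ∞ P]
    {V : Type*} [NormedAddCommGroup V] [NormedSpace ℝ V] {k : ℕ}
    {θ : DForm J P k F} {f : V → P} {y : V}
    (hθ : DifferentiableAt ℝ (θ.inChart (f y)) (extChartAt J (f y) (f y)))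
    (hf : ContMDiffAt 𝓘(ℝ, V) J ∞ f y) :
    (θ.d (f y)).compContinuousLinearMap (mfderiv 𝓘(ℝ, V) J f y : V →L[ℝ] TangentSpace J (f y))
      = extDeriv (fun z ↦ (θ (f z)).compContinuousLinearMap
        (mfderiv 𝓘(ℝ, V) J f z : V →L[ℝ] TangentSpace J (f z))) y := by
  set φ := extChartAt J (f y)
  have hnf : ∀ᶠ z in 𝓝 y, MDifferentiableAt 𝓘(ℝ, V) J f z ∧ f z ∈ φ.source := by
    have h1 := (contMDiffAt_iff_contMDiffAt_nhds (by simp)).1 (hf.of_le (m := 1) (by simp))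
    have h2 := hf.continuousAt.preimage_mem_nhds (extChartAt_source_mem_nhds (I := J) (f y))
    filter_upwards [h1, h2] with z hz hz'
    exact ⟨hz.mdifferentiableAt (by simp), hz'⟩
  have hφ : ∀ {x}, x ∈ φ.source → MDifferentiableAt J 𝓘(ℝ, EP) φ x := fun hx ↦
    mdifferentiableAt_extChartAt (by rwa [← extChartAt_source J])
  have hd : ∀ {z}, MDifferentiableAt 𝓘(ℝ, V) J f z → f z ∈ φ.source → ∀ v : V,
      fderiv ℝ (φ ∘ f) z v = chartDeriv J (f y) (f z) (mfderiv 𝓘(ℝ, V) J f z v) := by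
    intro z hz hz' v
    rw [← mfderiv_eq_fderiv, mfderiv_comp z (hφ hz') hz]
    rfl
  have hcomp : ContDiffAt ℝ ∞ (φ ∘ f) y := by
    have : ContMDiffAt J 𝓘(ℝ, EP) ∞ φ (f y) := contMDiffAt_extChartAt
    exact (this.comp y hf).contDiffAt
  -- Near y the pulled back form is the pullback, between vector spaces, of the chart representation
  -- along φ ∘ f; there the exterior derivative is known to be natural. The equality is needed on a
  -- neighbourhood, whence `hnf`.
  have hev : (fun z ↦ (θ (f z)).compContinuousLinearMap
        (mfderiv 𝓘(ℝ, V) J f z : V →L[ℝ] TangentSpace J (f z))) =ᶠ[𝓝 y]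
      fun z ↦ (θ.inChart (f y) ((φ ∘ f) z)).compContinuousLinearMap (fderiv ℝ (φ ∘ f) z) := by
    filter_upwards [hnf] with z hz
    ext v
    refine (θ.inChart_chartDeriv hz.2 (fun i ↦ mfderiv 𝓘(ℝ, V) J f z (v i))).symm.trans ?_
    exact congrArg (θ.inChart (f y) (φ (f z))) (funext fun i ↦ (hd hz.1 hz.2 (v i)).symm)
  rw [hev.extDeriv_eq, extDeriv_pullback (f := φ ∘ f) (r := ∞) hθ hcomp minSmoothness_two_le_infty]
  ext v
  exact congrArg (extDeriv (θ.inChart (f y)) (φ (f y)))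
    (funext fun i ↦ (hd hnf.self_of_nhds.1 hnf.self_of_nhds.2 (v i)).symm)

end Charts

/-! ### Charts of the total space of a vector bundle -/

section BundleCharts

variable {E : Type*} [NormedAddCommGroup E] [NormedSpace ℝ E]
  {Q : Type*} [TopologicalSpace Q] [ChartedSpace E Q]

section

variable [IsManifold 𝓘(ℝ, E) ∞ Q]

theorem symmL_chartDeriv {q₀ q : Q} (hq : q ∈ (chartAt E q₀).source)
    (v : TangentSpace 𝓘(ℝ, E) q) :
    (trivializationAt E (TangentSpace 𝓘(ℝ, E) : Q → Type _) q₀).symmL ℝ q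
      (chartDeriv 𝓘(ℝ, E) q₀ q v) = v := by
  have hb : q ∈ (trivializationAt E (TangentSpace 𝓘(ℝ, E) : Q → Type _) q₀).baseSet := by
    rwa [TangentBundle.trivializationAt_baseSet]
  rw [chartDeriv_eq_trivializationAt hq, Trivialization.symmL_apply _ hb]
  exact (trivializationAt E (TangentSpace 𝓘(ℝ, E) : Q → Type _) q₀).symm_apply_apply_mk hb v

end

variable {F : Type*} [NormedAddCommGroup F] [NormedSpace ℝ F] {Fib : Q → Type*}
  [TopologicalSpace (TotalSpace F Fib)] [∀ q, TopologicalSpace (Fib q)] [FiberBundle F Fib]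

/-- The chart is a trivialization followed by a chart of the base, so two domains enter. For `S.M`
the base set is the domain of a frame of D, which need not be related to the chart domain of Q. -/
theorem TotalSpace.mem_extChartAt_source {p p' : TotalSpace F Fib} :
    p' ∈ (extChartAt (𝓘(ℝ, E).prod 𝓘(ℝ, F)) p).source ↔
      p'.proj ∈ (trivializationAt F Fib p.proj).baseSet ∧ p'.proj ∈ (chartAt E p.proj).source := by
  rw [FiberBundle.extChartAt, PartialEquiv.trans_source, mem_inter_iff]
  change p' ∈ (trivializationAt F Fib p.proj).source ∧ _ ↔ _
  rw [Trivialization.mem_source, and_congr_right_iff]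
  intro h
  simp [Trivialization.coe_fst' _ h]

theorem TotalSpace.extChartAt_apply {p p' : TotalSpace F Fib}
    (h : p'.proj ∈ (trivializationAt F Fib p.proj).baseSet) :
    extChartAt (𝓘(ℝ, E).prod 𝓘(ℝ, F)) p p'
      = (extChartAt 𝓘(ℝ, E) p.proj p'.proj, (trivializationAt F Fib p.proj p').2) := by
  rw [FiberBundle.extChartAt]
  simp [Trivialization.coe_fst' _ h]

theorem TotalSpace.proj_extChartAt_symm {p : TotalSpace F Fib} {y : E × F}
    (hy : y ∈ (extChartAt (𝓘(ℝ, E).prod 𝓘(ℝ, F)) p).target) :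
    ((extChartAt (𝓘(ℝ, E).prod 𝓘(ℝ, F)) p).symm y).proj
      = (extChartAt 𝓘(ℝ, E) p.proj).symm y.1 := by
  have hs := TotalSpace.mem_extChartAt_source.1
    ((extChartAt (𝓘(ℝ, E).prod 𝓘(ℝ, F)) p).map_target hy)
  have h := TotalSpace.extChartAt_apply (E := E) hs.1
  rw [(extChartAt (𝓘(ℝ, E).prod 𝓘(ℝ, F)) p).right_inv hy] at h
  rw [congrArg Prod.fst h]
  exact ((extChartAt 𝓘(ℝ, E) p.proj).left_inv (by rw [extChartAt_source]; exact hs.2)).symm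

theorem TotalSpace.trivializationAt_extChartAt_symm {p : TotalSpace F Fib} {y : E × F}
    (hy : y ∈ (extChartAt (𝓘(ℝ, E).prod 𝓘(ℝ, F)) p).target) :
    (trivializationAt F Fib p.proj ((extChartAt (𝓘(ℝ, E).prod 𝓘(ℝ, F)) p).symm y)).2 = y.2 := by
  have hs := TotalSpace.mem_extChartAt_source.1
    ((extChartAt (𝓘(ℝ, E).prod 𝓘(ℝ, F)) p).map_target hy)
  have h := TotalSpace.extChartAt_apply (E := E) hs.1
  rw [(extChartAt (𝓘(ℝ, E).prod 𝓘(ℝ, F)) p).right_inv hy] at h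
  exact (congrArg Prod.snd h).symm

variable [IsManifold 𝓘(ℝ, E) ∞ Q] [∀ q, AddCommGroup (Fib q)] [∀ q, Module ℝ (Fib q)]
  [VectorBundle ℝ F Fib] [ContMDiffVectorBundle ∞ F Fib 𝓘(ℝ, E)]

/-- In the bundle chart the projection is `Prod.fst`; the equality of the two maps near the point is
differentiated. -/
theorem TotalSpace.chartDeriv_mfderiv_proj {p p' : TotalSpace F Fib}
    (hp' : p' ∈ (extChartAt (𝓘(ℝ, E).prod 𝓘(ℝ, F)) p).source)
    (v : TangentSpace (𝓘(ℝ, E).prod 𝓘(ℝ, F)) p') :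
    chartDeriv 𝓘(ℝ, E) p.proj p'.proj
        (mfderiv (𝓘(ℝ, E).prod 𝓘(ℝ, F)) 𝓘(ℝ, E) (TotalSpace.proj : TotalSpace F Fib → Q) p' v)
      = (chartDeriv (𝓘(ℝ, E).prod 𝓘(ℝ, F)) p p' v).1 := by
  have hs := TotalSpace.mem_extChartAt_source.1 hp'
  have hproj : MDifferentiableAt (𝓘(ℝ, E).prod 𝓘(ℝ, F)) 𝓘(ℝ, E)
      (TotalSpace.proj : TotalSpace F Fib → Q) p' :=
    (contMDiffAt_proj Fib (n := ∞)).mdifferentiableAt (by simp)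
  have hχ : MDifferentiableAt 𝓘(ℝ, E) 𝓘(ℝ, E) (extChartAt 𝓘(ℝ, E) p.proj) p'.proj :=
    mdifferentiableAt_extChartAt hs.2
  have hφ : MDifferentiableAt (𝓘(ℝ, E).prod 𝓘(ℝ, F)) 𝓘(ℝ, E × F)
      (extChartAt (𝓘(ℝ, E).prod 𝓘(ℝ, F)) p) p' :=
    mdifferentiableAt_extChartAt (by rwa [← extChartAt_source (𝓘(ℝ, E).prod 𝓘(ℝ, F))])
  have hfst : MDifferentiableAt 𝓘(ℝ, E × F) 𝓘(ℝ, E) (Prod.fst : E × F → E)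
      (extChartAt (𝓘(ℝ, E).prod 𝓘(ℝ, F)) p p') := differentiableAt_fst.mdifferentiableAt
  have hev : (extChartAt 𝓘(ℝ, E) p.proj) ∘ (TotalSpace.proj : TotalSpace F Fib → Q) =ᶠ[𝓝 p']
      Prod.fst ∘ extChartAt (𝓘(ℝ, E).prod 𝓘(ℝ, F)) p := by
    filter_upwards [extChartAt_source_mem_nhds' hp'] with z hz
    rw [Function.comp_apply, Function.comp_apply,
      TotalSpace.extChartAt_apply (TotalSpace.mem_extChartAt_source.1 hz).1]
  have h := hev.mfderiv_eq (I := 𝓘(ℝ, E).prod 𝓘(ℝ, F)) (I' := 𝓘(ℝ, E))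
  rw [mfderiv_comp p' hχ hproj, mfderiv_comp p' hfst hφ, mfderiv_eq_fderiv, fderiv_fst] at h
  exact congrArg (fun L : TangentSpace (𝓘(ℝ, E).prod 𝓘(ℝ, F)) p' →L[ℝ] E ↦ L v) h

end BundleCharts

/-! ### The Liouville form in coordinates -/

section Cotangent

variable {E : Type*} [NormedAddCommGroup E] [NormedSpace ℝ E]
  {Q : Type*} [TopologicalSpace Q] [ChartedSpace E Q] [IsManifold 𝓘(ℝ, E) ∞ Q]

/-- The coordinates of a covector in the chart around `q₀`. -/
noncomputable def covectorInChart (q₀ q : Q) (p : TangentSpace 𝓘(ℝ, E) q →L[ℝ] ℝ) : E →L[ℝ] ℝ :=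
  p ∘L (trivializationAt E (TangentSpace 𝓘(ℝ, E) : Q → Type _) q₀).symmL ℝ q

theorem covectorInChart_chartDeriv {q₀ q : Q} (hq : q ∈ (chartAt E q₀).source)
    (p : TangentSpace 𝓘(ℝ, E) q →L[ℝ] ℝ) (v : TangentSpace 𝓘(ℝ, E) q) :
    covectorInChart q₀ q p (chartDeriv 𝓘(ℝ, E) q₀ q v) = p v :=
  congrArg p (symmL_chartDeriv hq v)

theorem trivializationAt_cotangent_snd (q₀ : Q) (p : CotangentBundle E Q) :
    (trivializationAt (E →L[ℝ] ℝ)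
      (fun q : Q ↦ TangentSpace 𝓘(ℝ, E) q →L[ℝ] Bundle.Trivial Q ℝ q) q₀ p).2
      = covectorInChart q₀ p.proj p.2 := by
  rw [hom_trivializationAt_apply]
  ext u
  simp [ContinuousLinearMap.inCoordinates, covectorInChart]

/-- The classical expression p dx: the projection is (x, p) ↦ x in the bundle chart, and the fibre
coordinate p is the covector read through the derivative of the chart of Q. -/
theorem liouvilleForm_inChart_apply {p : CotangentBundle E Q} {y : E × (E →L[ℝ] ℝ)}
    (hy : y ∈ (extChartAt (modelCotangent E) p).target) (v : Fin 1 → E × (E →L[ℝ] ℝ)) :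
    (liouvilleForm E Q).inChart p y v = y.2 (v 0).1 := by
  have hs := (extChartAt (modelCotangent E) p).map_target hy
  have h1 := TotalSpace.chartDeriv_mfderiv_proj hs (chartSymmDeriv (modelCotangent E) p y (v 0))
  rw [chartDeriv_chartSymmDeriv hy] at h1
  rw [← h1, ← TotalSpace.trivializationAt_extChartAt_symm hy, trivializationAt_cotangent_snd,
    covectorInChart_chartDeriv (TotalSpace.mem_extChartAt_source.1 hs).2]
  rfl

theorem contDiffOn_liouvilleForm_inChart (p : CotangentBundle E Q) :
    ContDiffOn ℝ ∞ ((liouvilleForm E Q).inChart p) (extChartAt (modelCotangent E) p).target := by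
  -- The coordinate expression p dx depends linearly on (x, p), so it is the restriction of a
  -- continuous linear map to the chart target.
  let L : (E × (E →L[ℝ] ℝ)) →L[ℝ] (E × (E →L[ℝ] ℝ)) [⋀^Fin 1]→L[ℝ] ℝ :=
    (ContinuousAlternatingMap.ofSubsingletonLIE
        (0 : Fin 1)).toContinuousLinearEquiv.toContinuousLinearMap ∘L
      (ContinuousLinearMap.precomp ℝ (ContinuousLinearMap.fst ℝ E (E →L[ℝ] ℝ))) ∘L
      ContinuousLinearMap.snd ℝ E (E →L[ℝ] ℝ)
  refine L.contDiff.contDiffOn.congr fun y hy ↦ ?_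
  ext v
  rw [liouvilleForm_inChart_apply hy]
  rfl

end Cotangent

/-! ### Pullback and exterior derivative -/

section Pullback

variable {EP : Type*} [NormedAddCommGroup EP] [NormedSpace ℝ EP]
  {HP : Type*} [TopologicalSpace HP] {J : ModelWithCorners ℝ EP HP}
  {P : Type*} [TopologicalSpace P] [ChartedSpace HP P]
  {EN : Type*} [NormedAddCommGroup EN] [NormedSpace ℝ EN]
  {HN : Type*} [TopologicalSpace HN] {JN : ModelWithCorners ℝ EN HN}
  {N : Type*} [TopologicalSpace N] [ChartedSpace HN N] [JN.Boundaryless] [IsManifold JN ∞ N]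
  {F : Type*} [NormedAddCommGroup F] [NormedSpace ℝ F]

theorem DForm.pullback_inChart {k : ℕ} (θ : DForm J P k F) {f : N → P}
    (hf : MDifferentiable JN J f) {x₀ : N} {y : EN} (hy : y ∈ (extChartAt JN x₀).target) :
    DForm.inChart (θ.pullback (JN := JN) f) x₀ y
      = (θ ((f ∘ (extChartAt JN x₀).symm) y)).compContinuousLinearMap
        (mfderiv 𝓘(ℝ, EN) J (f ∘ (extChartAt JN x₀).symm) y : EN →L[ℝ] _) := by
  have h := mfderiv_comp y (hf ((extChartAt JN x₀).symm y)) (mdifferentiableAt_extChartAt_symm hy)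
  ext v
  refine congrArg (θ (f ((extChartAt JN x₀).symm y))) (funext fun i ↦ ?_)
  exact congrArg (fun L : EN →L[ℝ] TangentSpace J (f ((extChartAt JN x₀).symm y)) ↦ L (v i)) h.symm

/-- Naturality of d, applied to f composed with the inverse chart. The derivative of θ at f(x) is
computed in the chart around f(x), which varies with the point; hence the smoothness of θ is
required in all charts. -/
theorem DForm.pullback_d_inChart [J.Boundaryless] [IsManifold J ∞ P] {k : ℕ}
    {θ : DForm J P k F} (hθ : θ.IsSmooth) {f : N → P} (hf : ContMDiff JN J ∞ f) {x₀ : N} {y : EN}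
    (hy : y ∈ (extChartAt JN x₀).target) :
    DForm.inChart (θ.d.pullback (JN := JN) f) x₀ y
      = extDeriv (DForm.inChart (θ.pullback (JN := JN) f) x₀) y := by
  have hfd : MDifferentiable JN J f := hf.mdifferentiable (by simp)
  rw [DForm.pullback_inChart _ hfd hy]
  have hθ' : DifferentiableAt ℝ (θ.inChart (f ((extChartAt JN x₀).symm y)))
      (extChartAt J (f ((extChartAt JN x₀).symm y)) (f ((extChartAt JN x₀).symm y))) :=
    ((hθ _).contDiffAt ((isOpen_extChartAt_target _).mem_nhds (mem_extChartAt_target _)))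
      |>.differentiableAt (by simp)
  refine (DForm.d_comp_mfderiv (f := f ∘ (extChartAt JN x₀).symm) hθ'
    ((hf _).comp y (contMDiffAt_extChartAt_symm hy))).trans ?_
  refine Filter.EventuallyEq.extDeriv_eq ?_
  filter_upwards [(isOpen_extChartAt_target x₀).mem_nhds hy] with z hz
  exact (DForm.pullback_inChart θ hfd hz).symm

end Pullback

/-! ### The 1-form ∑ c_a l_a(x) and its differential -/

section Coordinates

variable {E : Type*} [NormedAddCommGroup E] [NormedSpace ℝ E] {r : ℕ}

/-- The covector `∑ a, c a • l a x`, as a function of the pair `(x, c)`. -/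
noncomputable def frameSum (l : Fin r → E → E →L[ℝ] ℝ) (y : E × (Fin r → ℝ)) : E →L[ℝ] ℝ :=
  ∑ a, y.2 a • l a y.1

theorem frameSum_apply (l : Fin r → E → E →L[ℝ] ℝ) (y : E × (Fin r → ℝ)) (v : E) :
    frameSum l y v = ∑ a, y.2 a * l a y.1 v := by
  simp [frameSum]

theorem contDiffAt_frameSum {l : Fin r → E → E →L[ℝ] ℝ} {y : E × (Fin r → ℝ)}
    (hl : ∀ a, ContDiffAt ℝ ∞ (l a) y.1) : ContDiffAt ℝ ∞ (frameSum l) y := by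
  refine ContDiffAt.sum fun a _ ↦ ContDiffAt.fun_smul ?_ ?_
  · exact ((ContinuousLinearMap.proj (R := ℝ) (φ := fun _ : Fin r ↦ ℝ) a).contDiff.comp
      contDiff_snd).contDiffAt
  · exact (hl a).comp y contDiffAt_fst

theorem fderiv_frameSum_apply {l : Fin r → E → E →L[ℝ] ℝ} {y : E × (Fin r → ℝ)}
    (hl : ∀ a, ContDiffAt ℝ ∞ (l a) y.1) (u : E × (Fin r → ℝ)) (v : E) :
    fderiv ℝ (frameSum l) y u v
      = ∑ a, (u.2 a * l a y.1 v + y.2 a * fderiv ℝ (l a) y.1 u.1 v) := by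
  have h : HasFDerivAt (frameSum l)
      (∑ a, (y.2 a • (fderiv ℝ (l a) y.1 ∘L ContinuousLinearMap.fst ℝ E (Fin r → ℝ))
        + ((ContinuousLinearMap.proj (R := ℝ) (φ := fun _ : Fin r ↦ ℝ) a) ∘L
          ContinuousLinearMap.snd ℝ E (Fin r → ℝ)).smulRight (l a y.1))) y := by
    refine HasFDerivAt.fun_sum fun a _ ↦ ?_
    refine HasFDerivAt.fun_smul (c := fun z : E × (Fin r → ℝ) ↦ z.2 a)
      (f := fun z : E × (Fin r → ℝ) ↦ l a z.1) ?_ ?_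
    · exact ((ContinuousLinearMap.proj (R := ℝ) (φ := fun _ : Fin r ↦ ℝ) a) ∘L
        ContinuousLinearMap.snd ℝ E (Fin r → ℝ)).hasFDerivAt
    · exact ((hl a).differentiableAt (by simp)).hasFDerivAt.comp y (hasFDerivAt_fst (p := y))
  rw [h.fderiv, sum_apply, sum_apply]
  refine Finset.sum_congr rfl fun a _ ↦ ?_
  simp
  ring

/-- The 1-form `∑ a, c a • l a x` on the space of pairs `(x, c)`. -/
noncomputable def frameForm (l : Fin r → E → E →L[ℝ] ℝ) (y : E × (Fin r → ℝ)) :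
    (E × (Fin r → ℝ)) [⋀^Fin 1]→L[ℝ] ℝ :=
  ContinuousAlternatingMap.ofSubsingletonLIE (0 : Fin 1)
    (frameSum l y ∘L ContinuousLinearMap.fst ℝ E (Fin r → ℝ))

theorem frameForm_apply (l : Fin r → E → E →L[ℝ] ℝ) (y : E × (Fin r → ℝ))
    (v : Fin 1 → E × (Fin r → ℝ)) : frameForm l y v = frameSum l y (v 0).1 := rfl

theorem contDiffAt_frameForm {l : Fin r → E → E →L[ℝ] ℝ} {y : E × (Fin r → ℝ)}
    (hl : ∀ a, ContDiffAt ℝ ∞ (l a) y.1) : ContDiffAt ℝ ∞ (frameForm l) y :=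
  (ContinuousAlternatingMap.ofSubsingletonLIE (𝕜 := ℝ) (E := E × (Fin r → ℝ)) (F := ℝ)
    (0 : Fin 1)).toContinuousLinearEquiv.contDiff.contDiffAt.comp y
      ((contDiffAt_frameSum hl).clm_comp contDiffAt_const)

theorem extDeriv_frameForm {l : Fin r → E → E →L[ℝ] ℝ} {y : E × (Fin r → ℝ)}
    (hl : ∀ a, ContDiffAt ℝ ∞ (l a) y.1) (u v : E × (Fin r → ℝ)) :
    extDeriv (frameForm l) y ![u, v]
      = fderiv ℝ (frameSum l) y u v.1 - fderiv ℝ (frameSum l) y v u.1 := by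
  have hd := (contDiffAt_frameForm hl).differentiableAt (by simp)
  have key : ∀ u v : E × (Fin r → ℝ),
      fderiv ℝ (frameForm l) y u ![v] = fderiv ℝ (frameSum l) y u v.1 := by
    intro u v
    have h1 := (hd.hasFDerivAt.continuousAlternatingMap_apply_const ![v]).fderiv
    have h2 := (((contDiffAt_frameSum hl).differentiableAt (by simp)).hasFDerivAt.clm_apply
      (hasFDerivAt_const v.1 y)).fderiv
    have h3 := congrArg (fun L : (E × (Fin r → ℝ)) →L[ℝ] ℝ ↦ L u) (h1.symm.trans h2)
    refine h3.trans ?_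
    simp
  rw [extDeriv_one_apply hd, key, key]

end Coordinates

/-! ### The inclusion of M into the cotangent bundle -/

namespace NonholonomicSystem

variable {E : Type*} [NormedAddCommGroup E] [NormedSpace ℝ E]
  {Q : Type*} [TopologicalSpace Q] [ChartedSpace E Q] [IsManifold 𝓘(ℝ, E) ∞ Q]
  (S : NonholonomicSystem E Q)

/-- The local frame of `D` around `q₀` that gives the chart of `M`. -/
noncomputable def frameAt (q₀ : Q) : LocalFrame 𝓘(ℝ, E) S.D S.rank := (S.isRegular_D q₀).choose

theorem mem_frameAt_dom (q₀ : Q) : q₀ ∈ (S.frameAt q₀).dom := (S.isRegular_D q₀).choose_spec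

theorem trivializationAt_apply_snd (q₀ : Q) (m : S.M) (h : m.proj ∈ (S.frameAt q₀).dom) :
    (trivializationAt (Fin S.rank → ℝ) S.Fibre q₀ m).2
      = (frameBasis (S.frameAt q₀) h).equivFun m.2 :=
  pretriv_apply (S.frameAt q₀) h m.2

theorem covector_eq_sum (q₀ : Q) (m : S.M) (h : m.proj ∈ (S.frameAt q₀).dom) :
    S.covector m.proj m.2 = ∑ a, (trivializationAt (Fin S.rank → ℝ) S.Fibre q₀ m).2 a •
      S.κ.inner m.proj ((S.frameAt q₀).vec a m.proj) := by
  rw [trivializationAt_apply_snd S q₀ m h]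
  conv_lhs => rw [← (frameBasis (S.frameAt q₀) h).sum_equivFun m.2]
  rw [map_sum]
  simp only [map_smul, coe_frameBasis]

/-- The coordinates of the covector `κ(s_a, ·)` in the chart around `q₀`, for the elements `s_a` of
the frame of `D` around `q₀`. -/
noncomputable def frameCovector (q₀ : Q) (a : Fin S.rank) (q : Q) : E →L[ℝ] ℝ :=
  covectorInChart q₀ q (S.κ.inner q ((S.frameAt q₀).vec a q))

theorem contMDiffOn_frameCovector (q₀ : Q) (a : Fin S.rank) :
    ContMDiffOn 𝓘(ℝ, E) 𝓘(ℝ, E →L[ℝ] ℝ) ∞ (S.frameCovector q₀ a)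
      ((S.frameAt q₀).dom ∩ (chartAt E q₀).source) := by
  set s := S.frameAt q₀
  set e := trivializationAt (E →L[ℝ] ℝ)
    (fun q : Q ↦ TangentSpace 𝓘(ℝ, E) q →L[ℝ] Bundle.Trivial Q ℝ q) q₀
  have h : ContMDiffOn 𝓘(ℝ, E) (𝓘(ℝ, E).prod 𝓘(ℝ, E →L[ℝ] ℝ)) ∞
      (fun q ↦ (TotalSpace.mk' (E →L[ℝ] ℝ) q (S.κ.inner q (s.vec a q)) : CotangentBundle E Q))
      s.dom :=
    ContMDiffOn.clm_bundle_apply (b := fun q : Q ↦ q) (F₂ := E →L[ℝ] ℝ)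
      (E₂ := fun q : Q ↦ TangentSpace 𝓘(ℝ, E) q →L[ℝ] Bundle.Trivial Q ℝ q)
      (S.κ.contMDiff.contMDiffOn (s := s.dom)) (s.contMDiffOn_vec a)
  have h' := (e.contMDiffOn_section_iff (s.isOpen_dom.inter (chartAt E q₀).open_source)
    (fun q hq ↦ ⟨hq.2, mem_univ _⟩)).1 (h.mono inter_subset_left)
  exact h'.congr fun q hq ↦ (trivializationAt_cotangent_snd q₀ ⟨q, _⟩).symm

/-- In fibre coordinates the inclusion is c ↦ ∑ c_a κ(s_a, ·), linear in c with coefficients that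
are smooth on Q. -/
theorem contMDiff_incl : ContMDiff S.modelM (modelCotangent E) ∞ S.incl := by
  intro m
  rw [contMDiffAt_totalSpace]
  refine ⟨contMDiffAt_proj S.Fibre, ?_⟩
  have hm : m.proj ∈ (S.frameAt m.proj).dom ∩ (chartAt E m.proj).source :=
    ⟨S.mem_frameAt_dom _, mem_chart_source _ _⟩
  have hopen : IsOpen ((S.frameAt m.proj).dom ∩ (chartAt E m.proj).source) :=
    (S.frameAt m.proj).isOpen_dom.inter (chartAt E m.proj).open_source
  have hproj : ContMDiffAt S.modelM 𝓘(ℝ, E) ∞ (TotalSpace.proj : S.M → Q) m :=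
    contMDiffAt_proj S.Fibre
  have hsm : ContMDiffAt S.modelM 𝓘(ℝ, E →L[ℝ] ℝ) ∞ (fun m' : S.M ↦
      ∑ a, (trivializationAt (Fin S.rank → ℝ) S.Fibre m.proj m').2 a •
        S.frameCovector m.proj a m'.proj) m := by
    refine contMDiffAt_finsetSum fun a _ ↦ ?_
    have h := (contMDiffAt_totalSpace.1 (contMDiffAt_id (I := S.modelM) (n := ∞) (x := m))).2
    have h1 : ContMDiffAt S.modelM 𝓘(ℝ, ℝ) ∞
        (fun m' : S.M ↦ (trivializationAt (Fin S.rank → ℝ) S.Fibre m.proj m').2 a) m :=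
      (ContinuousLinearMap.proj (R := ℝ)
        (φ := fun _ : Fin S.rank ↦ ℝ) a).contMDiff.contMDiffAt.comp m h
    have h2 := ((S.contMDiffOn_frameCovector m.proj a).contMDiffAt (hopen.mem_nhds hm)).comp m hproj
    exact h1.smul h2
  refine hsm.congr_of_eventuallyEq ?_
  filter_upwards [hproj.continuousAt.preimage_mem_nhds (hopen.mem_nhds hm)] with m' hm'
  refine (trivializationAt_cotangent_snd _ (S.incl m')).trans ?_
  change covectorInChart m.proj m'.proj (S.covector m'.proj m'.2) = _
  rw [S.covector_eq_sum m.proj m' hm'.1]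
  ext u
  simp [covectorInChart, frameCovector]

end NonholonomicSystem

theorem chartDeriv_bijective {EP : Type*} [NormedAddCommGroup EP] [NormedSpace ℝ EP]
    {HP : Type*} [TopologicalSpace HP] {J : ModelWithCorners ℝ EP HP}
    {P : Type*} [TopologicalSpace P] [ChartedSpace HP P] [IsManifold J ∞ P] {x₀ x : P}
    (hx : x ∈ (extChartAt J x₀).source) : Function.Bijective (chartDeriv J x₀ x) := by
  obtain ⟨e, he⟩ := isInvertible_mfderiv_extChartAt (I := J) hx
  have : ⇑(chartDeriv J x₀ x) = e := congrArg DFunLike.coe he.symm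
  rw [this]
  exact e.bijective

/-! ### The forms on M in coordinates, and nondegeneracy on C -/

namespace NonholonomicSystem

variable {E : Type*} [NormedAddCommGroup E] [NormedSpace ℝ E]
  {Q : Type*} [TopologicalSpace Q] [ChartedSpace E Q] [IsManifold 𝓘(ℝ, E) ∞ Q]
  (S : NonholonomicSystem E Q)

/-- The derivative of the projection `M → Q`. -/
noncomputable def projDeriv (m : S.M) :
    TangentSpace S.modelM m →L[ℝ] TangentSpace 𝓘(ℝ, E) m.proj :=
  mfderiv S.modelM 𝓘(ℝ, E) (TotalSpace.proj : S.M → Q) m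

theorem mem_C {m : S.M} {v : TangentSpace S.modelM m} :
    v ∈ S.C m ↔ S.projDeriv m v ∈ S.D m.proj := Iff.rfl

variable {S} in
theorem chartDeriv_projDeriv {m m' : S.M} (hm' : m' ∈ (extChartAt S.modelM m).source)
    (v : TangentSpace S.modelM m') :
    chartDeriv 𝓘(ℝ, E) m.proj m'.proj (S.projDeriv m' v) = (chartDeriv S.modelM m m' v).1 :=
  TotalSpace.chartDeriv_mfderiv_proj hm' v

/-- The covectors `κ(s_a, ·)` of the frame around `q₀` as functions on the chart around `q₀`. -/
noncomputable def coordCovector (q₀ : Q) (a : Fin S.rank) (x : E) : E →L[ℝ] ℝ :=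
  S.frameCovector q₀ a ((extChartAt 𝓘(ℝ, E) q₀).symm x)

theorem fst_mem_of_mem_target {m : S.M} {y : E × (Fin S.rank → ℝ)}
    (hy : y ∈ (extChartAt S.modelM m).target) :
    y.1 ∈ (extChartAt 𝓘(ℝ, E) m.proj).target ∩
      (extChartAt 𝓘(ℝ, E) m.proj).symm ⁻¹' (S.frameAt m.proj).dom := by
  rw [FiberBundle.extChartAt_target] at hy
  exact hy.1

theorem isOpen_target_inter_preimage_dom (q₀ : Q) :
    IsOpen ((extChartAt 𝓘(ℝ, E) q₀).target ∩
      (extChartAt 𝓘(ℝ, E) q₀).symm ⁻¹' (S.frameAt q₀).dom) :=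
  (continuousOn_extChartAt_symm q₀).isOpen_inter_preimage (isOpen_extChartAt_target q₀)
    (S.frameAt q₀).isOpen_dom

theorem contDiffAt_coordCovector {q₀ : Q} {x : E} (hx : x ∈ (extChartAt 𝓘(ℝ, E) q₀).target ∩
      (extChartAt 𝓘(ℝ, E) q₀).symm ⁻¹' (S.frameAt q₀).dom) (a : Fin S.rank) :
    ContDiffAt ℝ ∞ (S.coordCovector q₀ a) x := by
  have hopen : IsOpen ((S.frameAt q₀).dom ∩ (chartAt E q₀).source) :=
    (S.frameAt q₀).isOpen_dom.inter (chartAt E q₀).open_source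
  have h := (S.contMDiffOn_frameCovector q₀ a).contMDiffAt
    (hopen.mem_nhds ⟨hx.2, symm_mem_chart_source hx.1⟩)
  exact (h.comp x (contMDiffAt_extChartAt_symm hx.1)).contDiffAt

theorem coordCovector_chartDeriv {m m' : S.M} (hm' : m' ∈ (extChartAt S.modelM m).source)
    (a : Fin S.rank) (v : TangentSpace 𝓘(ℝ, E) m'.proj) :
    S.coordCovector m.proj a (extChartAt S.modelM m m').1
        (chartDeriv 𝓘(ℝ, E) m.proj m'.proj v)
      = S.κ.inner m'.proj ((S.frameAt m.proj).vec a m'.proj) v := by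
  have hs := TotalSpace.mem_extChartAt_source.1 hm'
  rw [TotalSpace.extChartAt_apply hs.1, coordCovector, (extChartAt 𝓘(ℝ, E) m.proj).left_inv
    (by rw [extChartAt_source]; exact hs.2)]
  exact covectorInChart_chartDeriv hs.2 _ _

/-- The projection of T*Q composed with the inclusion is the projection of M; the chain rule does
the rest. -/
theorem ΘM_apply (m : S.M) (v : Fin 1 → TangentSpace S.modelM m) :
    S.ΘM m v = S.covector m.proj m.2 (S.projDeriv m (v 0)) := by
  have h := mfderiv_comp (I' := modelCotangent E) (I'' := 𝓘(ℝ, E)) m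
    (g := (TotalSpace.proj : CotangentBundle E Q → Q)) (f := S.incl)
    ((contMDiffAt_proj _ (n := ∞)).mdifferentiableAt (by simp))
    ((S.contMDiff_incl m).mdifferentiableAt (by simp))
  exact congrArg (fun L : TangentSpace S.modelM m →L[ℝ] TangentSpace 𝓘(ℝ, E) m.proj ↦
    S.covector m.proj m.2 (L (v 0))) h.symm

theorem ΘM_inChart {m : S.M} {y : E × (Fin S.rank → ℝ)}
    (hy : y ∈ (extChartAt S.modelM m).target) :
    S.ΘM.inChart m y = frameForm (S.coordCovector m.proj) y := by
  ext v
  have hs := (extChartAt S.modelM m).map_target hy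
  rw [frameForm_apply, frameSum_apply, DForm.inChart_apply, ΘM_apply,
    S.covector_eq_sum m.proj _ (TotalSpace.mem_extChartAt_source.1 hs).1,
    TotalSpace.trivializationAt_extChartAt_symm hy, sum_apply]
  refine Finset.sum_congr rfl fun a _ ↦ ?_
  have h := S.coordCovector_chartDeriv hs a
    (S.projDeriv _ (chartSymmDeriv S.modelM m y (v 0)))
  rw [(extChartAt S.modelM m).right_inv hy, chartDeriv_projDeriv hs,
    chartDeriv_chartSymmDeriv hy] at h
  rw [h]
  rfl

theorem ΩM_inChart {m : S.M} {y : E × (Fin S.rank → ℝ)}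
    (hy : y ∈ (extChartAt S.modelM m).target) :
    S.ΩM.inChart m y = -extDeriv (frameForm (S.coordCovector m.proj)) y := by
  have h := DForm.pullback_d_inChart (θ := liouvilleForm E Q)
    (fun p ↦ contDiffOn_liouvilleForm_inChart p) S.contMDiff_incl hy
  have h2 : extDeriv (DForm.inChart ((liouvilleForm E Q).pullback (JN := S.modelM) S.incl) m) y
      = extDeriv (frameForm (S.coordCovector m.proj)) y := by
    refine Filter.EventuallyEq.extDeriv_eq ?_
    filter_upwards [(isOpen_extChartAt_target m).mem_nhds hy] with z hz
    exact S.ΘM_inChart hz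
  rw [← h2, ← h]
  rfl

/-- The 2-form `Ω_M` is nondegenerate on `C`. -/
theorem injective_flatOn_ΩM (m : S.M) : Function.Injective (S.ΩM.flatOn m (S.C m)) := by
  have hs := mem_extChartAt_source (I := S.modelM) m
  have hy := mem_extChartAt_target (I := S.modelM) m
  have hl := S.contDiffAt_coordCovector (S.fst_mem_of_mem_target hy)
  have hbij := chartDeriv_bijective hs
  have hbijQ := chartDeriv_bijective (mem_extChartAt_source (I := 𝓘(ℝ, E)) m.proj)
  have hdom := S.mem_frameAt_dom m.proj
  rw [← LinearMap.ker_eq_bot, LinearMap.ker_eq_bot']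
  rintro ⟨X, hX⟩ hX0
  have h0 : ∀ Z ∈ S.C m, extDeriv (frameForm (S.coordCovector m.proj)) (extChartAt S.modelM m m)
      ![chartDeriv S.modelM m m X, chartDeriv S.modelM m m Z] = 0 := by
    intro Z hZ
    have h1 : S.ΩM m ![X, Z] = 0 :=
      congrArg (fun L : S.C m →ₗ[ℝ] ℝ ↦ L ⟨Z, hZ⟩) hX0
    rw [← S.ΩM.inChart_chartDeriv hs, S.ΩM_inChart hy] at h1
    have e : (fun i ↦ chartDeriv S.modelM m m (![X, Z] i))
        = ![chartDeriv S.modelM m m X, chartDeriv S.modelM m m Z] := by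
      ext i <;> fin_cases i <;> rfl
    rw [e] at h1
    exact neg_eq_zero.1 h1
  -- Vertical vectors project to 0 and so lie in C. Testing X against the coordinate vectors (0,
  -- e_a) shows that its projection is κ-orthogonal to every s_a, hence to D; but it also lies in D.
  have hd : S.projDeriv m X = 0 := by
    have h2 : ∀ a, S.κ.inner m.proj ((S.frameAt m.proj).vec a m.proj) (S.projDeriv m X) = 0 := by
      intro a
      obtain ⟨Z, hZ⟩ := hbij.2 ((0 : E), Pi.single a (1 : ℝ))
      have hZC : S.projDeriv m Z = 0 := by
        refine hbijQ.1 ?_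
        rw [chartDeriv_projDeriv hs, hZ, map_zero]
      have h3 := h0 Z (by rw [mem_C, hZC]; exact zero_mem _)
      rw [extDeriv_frameForm hl, fderiv_frameSum_apply hl, fderiv_frameSum_apply hl, hZ] at h3
      rw [← S.coordCovector_chartDeriv hs, chartDeriv_projDeriv hs]
      simpa [Pi.single_apply] using h3
    by_contra hne
    refine (S.κ.pos m.proj _ hne).ne' ?_
    have h3 : ∀ w ∈ S.D m.proj, S.κ.inner m.proj w (S.projDeriv m X) = 0 := by
      intro w hw
      rw [← (S.frameAt m.proj).span_eq _ hdom] at hw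
      induction hw using Submodule.span_induction with
      | mem w hw => obtain ⟨a, rfl⟩ := hw; exact h2 a
      | zero => simp
      | add u v _ _ hu hv => rw [map_add, add_apply, hu, hv, add_zero]
      | smul c u _ hu => rw [map_smul, smul_apply, hu, smul_zero]
    exact h3 _ hX
  have hu1 : (chartDeriv S.modelM m m X).1 = 0 := by
    rw [← chartDeriv_projDeriv hs, hd, map_zero]
  set c := (chartDeriv S.modelM m m X).2 with hc
  set d : TangentSpace 𝓘(ℝ, E) m.proj := ∑ a, c a • (S.frameAt m.proj).vec a m.proj with hdd
  have hdD : d ∈ S.D m.proj := by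
    rw [← (S.frameAt m.proj).span_eq _ hdom]
    exact Submodule.sum_mem _ fun a _ ↦ Submodule.smul_mem _ _ (Submodule.subset_span ⟨a, rfl⟩)
  -- Now X is vertical, with fibre components c. It is tested against a vector with coordinates (d,
  -- 0), which lies in C because d = ∑ c_a s_a is in D; the result is κ(d, d) = 0.
  have hd0 : d = 0 := by
    obtain ⟨Z, hZ⟩ := hbij.2 (chartDeriv 𝓘(ℝ, E) m.proj m.proj d, (0 : Fin S.rank → ℝ))
    have hZC : S.projDeriv m Z = d := by
      refine hbijQ.1 ?_
      rw [chartDeriv_projDeriv hs, hZ]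
    have h3 := h0 Z (by rw [mem_C, hZC]; exact hdD)
    rw [extDeriv_frameForm hl, fderiv_frameSum_apply hl, fderiv_frameSum_apply hl, hZ, hu1] at h3
    by_contra hne
    refine (S.κ.pos m.proj _ hne).ne' ?_
    have h4 : ∀ w, S.κ.inner m.proj d w
        = ∑ a, c a * S.κ.inner m.proj ((S.frameAt m.proj).vec a m.proj) w := by
      intro w
      rw [hdd, map_sum, sum_apply]
      exact Finset.sum_congr rfl fun a _ ↦ by rw [map_smul]; rfl
    rw [h4]
    simp only [S.coordCovector_chartDeriv hs] at h3
    simpa using h3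
  have hc0 := Fintype.linearIndependent_iff.mp ((S.frameAt m.proj).linearIndependent _ hdom) c hd0
  have hX' : X = 0 := by
    refine hbij.1 ?_
    rw [map_zero]
    exact Prod.ext hu1 (funext hc0)
  exact Subtype.ext hX'

end NonholonomicSystem

/-! ### The action of the group in charts -/

section Action

variable {E : Type*} [NormedAddCommGroup E] [NormedSpace ℝ E]
  {Q : Type*} [TopologicalSpace Q] [ChartedSpace E Q]
  {EG : Type*} [NormedAddCommGroup EG] [NormedSpace ℝ EG]
  {G : Type*} [Group G] [TopologicalSpace G] [ChartedSpace EG G] [MulAction G Q]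

/-- A tangent vector at g is by definition its coordinate vector in the chart around g itself, so ξ
appears unchanged on both sides. -/
theorem mfderiv_eq_fderiv_extChartAt_symm {EG : Type*} [NormedAddCommGroup EG] [NormedSpace ℝ EG]
    {G : Type*} [TopologicalSpace G] [ChartedSpace EG G]
    {F : Type*} [NormedAddCommGroup F] [NormedSpace ℝ F]
    {f : G → F} {g : G} (hf : MDifferentiableAt 𝓘(ℝ, EG) 𝓘(ℝ, F) f g) (ξ : EG) :
    (mfderiv 𝓘(ℝ, EG) 𝓘(ℝ, F) f g ξ : F)
      = fderiv ℝ (f ∘ (extChartAt 𝓘(ℝ, EG) g).symm) (extChartAt 𝓘(ℝ, EG) g g) ξ := by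
  let L : EG →L[ℝ] F := mfderiv 𝓘(ℝ, EG) 𝓘(ℝ, F) f g
  have h : HasFDerivWithinAt (f ∘ (extChartAt 𝓘(ℝ, EG) g).symm) L (range 𝓘(ℝ, EG))
      (extChartAt 𝓘(ℝ, EG) g g) := hf.hasMFDerivAt.2
  rw [ModelWithCorners.range_eq_univ, hasFDerivWithinAt_univ] at h
  exact congrArg (fun L : EG →L[ℝ] F ↦ L ξ) h.fderiv.symm

/-- The point x is a variable with f g = x, since the orbit map takes 1 to 1 • q, which equals q but
not definitionally, and tangent spaces depend on the point. -/
theorem chartDeriv_mfderiv {EG : Type*} [NormedAddCommGroup EG] [NormedSpace ℝ EG]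
    {G : Type*} [TopologicalSpace G] [ChartedSpace EG G]
    {EP : Type*} [NormedAddCommGroup EP] [NormedSpace ℝ EP]
    {HP : Type*} [TopologicalSpace HP] {J : ModelWithCorners ℝ EP HP}
    {P : Type*} [TopologicalSpace P] [ChartedSpace HP P] [IsManifold J ∞ P]
    {f : G → P} {g : G} {x x₀ : P} (hf : MDifferentiableAt 𝓘(ℝ, EG) J f g) (hx : f g = x)
    (hx₀ : x ∈ (extChartAt J x₀).source) (ξ : EG) :
    chartDeriv J x₀ x (mfderiv 𝓘(ℝ, EG) J f g ξ : EP)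
      = fderiv ℝ (extChartAt J x₀ ∘ f ∘ (extChartAt 𝓘(ℝ, EG) g).symm)
        (extChartAt 𝓘(ℝ, EG) g g) ξ := by
  subst hx
  have hφ : MDifferentiableAt J 𝓘(ℝ, EP) (extChartAt J x₀) (f g) :=
    mdifferentiableAt_extChartAt (by rwa [← extChartAt_source J])
  have h := mfderiv_eq_fderiv_extChartAt_symm (hφ.comp g hf) ξ
  rw [mfderiv_comp g hφ hf] at h
  exact h

/-- The action of `G` on `Q` in the charts around `1` and `q₀`. -/
noncomputable def coordAction (G : Type*) [Group G] [TopologicalSpace G] [ChartedSpace EG G]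
    [MulAction G Q] (q₀ : Q) (z : EG × E) : E :=
  extChartAt 𝓘(ℝ, E) q₀
    ((extChartAt 𝓘(ℝ, EG) (1 : G)).symm z.1 • (extChartAt 𝓘(ℝ, E) q₀).symm z.2)

theorem coordAction_one {q₀ : Q} {x : E} (hx : x ∈ (extChartAt 𝓘(ℝ, E) q₀).target) :
    coordAction G q₀ (extChartAt 𝓘(ℝ, EG) (1 : G) 1, x) = x := by
  rw [coordAction, extChartAt_to_inv, one_smul, (extChartAt 𝓘(ℝ, E) q₀).right_inv hx]

variable [IsManifold 𝓘(ℝ, E) ∞ Q] [IsManifold 𝓘(ℝ, EG) ∞ G]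

theorem contDiffAt_coordAction
    (hsm : ContMDiff (𝓘(ℝ, EG).prod 𝓘(ℝ, E)) 𝓘(ℝ, E) ∞ (fun p : G × Q ↦ p.1 • p.2)) {q₀ : Q}
    {z : EG × E} (hz1 : z.1 ∈ (extChartAt 𝓘(ℝ, EG) (1 : G)).target)
    (hz2 : z.2 ∈ (extChartAt 𝓘(ℝ, E) q₀).target)
    (hz : (extChartAt 𝓘(ℝ, EG) (1 : G)).symm z.1 • (extChartAt 𝓘(ℝ, E) q₀).symm z.2
      ∈ (chartAt E q₀).source) :
    ContDiffAt ℝ ∞ (coordAction (EG := EG) G q₀) z := by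
  have h1 : ContMDiffAt 𝓘(ℝ, EG × E) 𝓘(ℝ, EG) ∞
      (fun z : EG × E ↦ (extChartAt 𝓘(ℝ, EG) (1 : G)).symm z.1) z :=
    (contMDiffAt_extChartAt_symm hz1).comp z contDiffAt_fst.contMDiffAt
  have h2 : ContMDiffAt 𝓘(ℝ, EG × E) 𝓘(ℝ, E) ∞
      (fun z : EG × E ↦ (extChartAt 𝓘(ℝ, E) q₀).symm z.2) z :=
    (contMDiffAt_extChartAt_symm hz2).comp z contDiffAt_snd.contMDiffAt
  have h3 : ContMDiffAt 𝓘(ℝ, E) 𝓘(ℝ, E) ∞ (extChartAt 𝓘(ℝ, E) q₀)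
      ((extChartAt 𝓘(ℝ, EG) (1 : G)).symm z.1 • (extChartAt 𝓘(ℝ, E) q₀).symm z.2) :=
    contMDiffAt_extChartAt' hz
  exact ((h3.comp z ((hsm _).comp z (h1.prodMk h2)))).contDiffAt

/-- The tangent map of g is the partial derivative of the action in the second variable. This form
shows how it depends on g, which the pointwise definition hides. -/
theorem chartDeriv_tangentSMul
    (hsm : ContMDiff (𝓘(ℝ, EG).prod 𝓘(ℝ, E)) 𝓘(ℝ, E) ∞ (fun p : G × Q ↦ p.1 • p.2)) {q₀ q : Q}
    {g : G} (hg : g ∈ (chartAt EG (1 : G)).source) (hq : q ∈ (chartAt E q₀).source)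
    (hgq : g • q ∈ (chartAt E q₀).source) (v : TangentSpace 𝓘(ℝ, E) q) :
    chartDeriv 𝓘(ℝ, E) q₀ (g • q) (tangentSMul E g q v)
      = fderiv ℝ (coordAction (EG := EG) G q₀)
        (extChartAt 𝓘(ℝ, EG) (1 : G) g, extChartAt 𝓘(ℝ, E) q₀ q)
        ((0 : EG), chartDeriv 𝓘(ℝ, E) q₀ q v) := by
  set ζ := extChartAt 𝓘(ℝ, EG) (1 : G) with hζ
  set χ := extChartAt 𝓘(ℝ, E) q₀ with hχ
  have hg' : g ∈ ζ.source := by rwa [hζ, extChartAt_source]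
  have hq' : q ∈ χ.source := by rwa [hχ, extChartAt_source]
  have hact : MDifferentiableAt 𝓘(ℝ, E) 𝓘(ℝ, E) (fun x : Q ↦ g • x) q :=
    ((hsm (g, q)).comp q (contMDiffAt_const.prodMk contMDiffAt_id)).mdifferentiableAt (by simp)
  have hφ : MDifferentiableAt 𝓘(ℝ, E) 𝓘(ℝ, E) χ (g • q) := mdifferentiableAt_extChartAt hgq
  have hφ' : MDifferentiableAt 𝓘(ℝ, E) 𝓘(ℝ, E) χ q := mdifferentiableAt_extChartAt hq
  have ha : DifferentiableAt ℝ (coordAction (EG := EG) G q₀) (ζ g, χ q) := by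
    refine (contDiffAt_coordAction hsm (ζ.map_source hg') (χ.map_source hq') ?_).differentiableAt
      (by simp)
    change ζ.symm (ζ g) • χ.symm (χ q) ∈ _
    rwa [ζ.left_inv hg', χ.left_inv hq']
  have hev : χ ∘ (fun x : Q ↦ g • x) =ᶠ[𝓝 q]
      (fun x : E ↦ coordAction (EG := EG) G q₀ (ζ g, x)) ∘ χ := by
    filter_upwards [extChartAt_source_mem_nhds' hq'] with x hx
    have hx' : χ.symm (χ x) = x := χ.left_inv hx
    change χ (g • x) = χ (ζ.symm (ζ g) • χ.symm (χ x))
    rw [ζ.left_inv hg', hx']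
  have h2 : HasFDerivAt (fun x : E ↦ coordAction (EG := EG) G q₀ (ζ g, x))
      (fderiv ℝ (coordAction (EG := EG) G q₀) (ζ g, χ q) ∘L ContinuousLinearMap.inr ℝ EG E)
      (χ q) :=
    ha.hasFDerivAt.comp (χ q) (hasFDerivAt_prodMk_right (ζ g) (χ q))
  have h := hev.mfderiv_eq (I := 𝓘(ℝ, E)) (I' := 𝓘(ℝ, E))
  rw [mfderiv_comp q hφ hact, mfderiv_comp q h2.differentiableAt.mdifferentiableAt hφ',
    mfderiv_eq_fderiv, h2.fderiv] at h
  exact congrArg (fun L : TangentSpace 𝓘(ℝ, E) q →L[ℝ] E ↦ L v) h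

theorem contDiffAt_coordAction_one
    (hsm : ContMDiff (𝓘(ℝ, EG).prod 𝓘(ℝ, E)) 𝓘(ℝ, E) ∞ (fun p : G × Q ↦ p.1 • p.2)) {q₀ : Q}
    {x : E} (hx : x ∈ (extChartAt 𝓘(ℝ, E) q₀).target) :
    ContDiffAt ℝ ∞ (coordAction (EG := EG) G q₀) (extChartAt 𝓘(ℝ, EG) (1 : G) 1, x) := by
  refine contDiffAt_coordAction hsm (mem_extChartAt_target _) hx ?_
  rw [extChartAt_to_inv, one_smul]
  exact symm_mem_chart_source hx

end Action

/-! ### Generators of a free action -/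

section FreeAction

variable {E : Type*} [NormedAddCommGroup E] [NormedSpace ℝ E]
  {Q : Type*} [TopologicalSpace Q] [ChartedSpace E Q] [IsManifold 𝓘(ℝ, E) ∞ Q]
  {EG : Type*} [NormedAddCommGroup EG] [NormedSpace ℝ EG]
  {G : Type*} [Group G] [TopologicalSpace G] [ChartedSpace EG G] [MulAction G Q]

/-- A curve in a manifold whose derivative vanishes near a point is constant near that point. -/
theorem eventually_eq_of_hasMFDerivAt_zero {c : ℝ → Q} {t₀ : ℝ}
    (hc : ∀ᶠ t in 𝓝 t₀, HasMFDerivAt 𝓘(ℝ, ℝ) 𝓘(ℝ, E) c t 0) : ∀ᶠ t in 𝓝 t₀, c t = c t₀ := by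
  have hs : ∀ᶠ t in 𝓝 t₀, c t ∈ (extChartAt 𝓘(ℝ, E) (c t₀)).source :=
    hc.self_of_nhds.continuousAt.preimage_mem_nhds (extChartAt_source_mem_nhds (c t₀))
  obtain ⟨ε, hε, hball⟩ := Metric.eventually_nhds_iff_ball.1 (hc.and hs)
  have hd : ∀ t ∈ Metric.ball t₀ ε,
      HasFDerivAt (extChartAt 𝓘(ℝ, E) (c t₀) ∘ c) (0 : ℝ →L[ℝ] E) t := by
    intro t ht
    have h1 : HasMFDerivAt 𝓘(ℝ, E) 𝓘(ℝ, E) (extChartAt 𝓘(ℝ, E) (c t₀)) (c t) _ :=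
      (mdifferentiableAt_extChartAt (by rw [← extChartAt_source 𝓘(ℝ, E)];
                                        exact (hball t ht).2)).hasMFDerivAt
    have h2 := (h1.comp t (hball t ht).1).hasFDerivAt
    rwa [ContinuousLinearMap.comp_zero] at h2
  filter_upwards [Metric.ball_mem_nhds t₀ hε] with t ht
  have h := (convex_ball t₀ ε).is_const_of_fderivWithin_eq_zero (𝕜 := ℝ)
    (fun s hs ↦ (hd s hs).differentiableAt.differentiableWithinAt)
    (fun s hs ↦ by
      rw [fderivWithin_of_isOpen Metric.isOpen_ball hs, (hd s hs).fderiv]) ht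
    (Metric.mem_ball_self hε)
  exact (extChartAt 𝓘(ℝ, E) (c t₀)).injOn (hball t ht).2 (mem_extChartAt_source _) h

/-- For a free action the infinitesimal generators vanish nowhere. -/
theorem eq_zero_of_mfderiv_smul_eq_zero [FiniteDimensional ℝ EG] [LieGroup 𝓘(ℝ, EG) ∞ G]
    (hsm : ContMDiff (𝓘(ℝ, EG).prod 𝓘(ℝ, E)) 𝓘(ℝ, E) ∞ (fun p : G × Q ↦ p.1 • p.2))
    {q : Q} (hfree : ∀ g : G, g • q = q → g = 1) {ξ : EG}
    (hξ : (mfderiv 𝓘(ℝ, EG) 𝓘(ℝ, E) (fun g : G ↦ g • q) 1 ξ : E) = 0) : ξ = 0 := by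
  have : CompleteSpace EG := FiniteDimensional.complete ℝ EG
  have : LieGroup 𝓘(ℝ, EG) (minSmoothness ℝ 3) G := LieGroup.of_le (n := ∞) (by
    rw [minSmoothness_of_isRCLikeNormedField]
    exact WithTop.coe_le_coe.2 (le_top : (3 : ℕ∞) ≤ ⊤))
  have horb : ∀ g : G, MDifferentiableAt 𝓘(ℝ, EG) 𝓘(ℝ, E) (fun g : G ↦ g • q) g := fun g ↦
    ((hsm (g, q)).comp g (contMDiffAt_id.prodMk contMDiffAt_const)).mdifferentiableAt (by simp)
  have hact : ∀ (g : G) (x : Q), MDifferentiableAt 𝓘(ℝ, E) 𝓘(ℝ, E) (fun x : Q ↦ g • x) x :=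
    fun g x ↦
      ((hsm (g, x)).comp x (contMDiffAt_const.prodMk contMDiffAt_id)).mdifferentiableAt (by simp)
  have hmul : ∀ g : G, MDifferentiableAt 𝓘(ℝ, EG) 𝓘(ℝ, EG) (g * ·) (1 : G) := fun g ↦
    (contMDiff_mul_left (I := 𝓘(ℝ, EG)) (n := ∞)).contMDiffAt.mdifferentiableAt (by simp)
  -- From (g k) • q = g • (k • q): the derivative of the orbit map at g, on the left translate of ξ,
  -- is the tangent map of g applied to the generator at q, which vanishes.
  have hzero : ∀ g k : G, g * 1 = k →
      (mfderiv 𝓘(ℝ, EG) 𝓘(ℝ, E) (fun g : G ↦ g • q) k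
        (mfderiv 𝓘(ℝ, EG) 𝓘(ℝ, EG) (g * ·) (1 : G) ξ : EG) : E) = 0 := by
    rintro g _ rfl
    have h1 := mfderiv_comp (1 : G) (horb (g * 1)) (hmul g)
    have h2 := mfderiv_comp (1 : G) (hact g ((1 : G) • q)) (horb 1)
    have h3 : (fun g : G ↦ g • q) ∘ (g * ·) = (fun x : Q ↦ g • x) ∘ fun g : G ↦ g • q :=
      funext fun k ↦ mul_smul g k q
    rw [h3] at h1
    have h4 := congrArg (fun L : EG →L[ℝ] E ↦ L ξ) (h1.symm.trans h2)
    refine h4.trans ?_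
    change mfderiv 𝓘(ℝ, E) 𝓘(ℝ, E) (fun x : Q ↦ g • x) ((1 : G) • q)
      (mfderiv 𝓘(ℝ, EG) 𝓘(ℝ, E) (fun g : G ↦ g • q) 1 ξ) = 0
    refine (congrArg (mfderiv 𝓘(ℝ, E) 𝓘(ℝ, E) (fun x : Q ↦ g • x) ((1 : G) • q)) hξ).trans ?_
    exact map_zero _
  -- An integral curve of the left-invariant field of ξ plays the role of the one-parameter
  -- subgroup; it is needed only near time 0. By `hzero` its orbit through q is stationary, so
  -- freeness forces the curve to stay at 1, and its velocity ξ is 0.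
  obtain ⟨γ, hγ0, hγ⟩ := exists_isMIntegralCurveAt_of_contMDiffAt_boundaryless (I := 𝓘(ℝ, EG))
    (v := mulInvariantVectorField (I := 𝓘(ℝ, EG)) (G := G) ξ) (x₀ := (1 : G)) (0 : ℝ)
    ((contMDiff_mulInvariantVectorField (I := 𝓘(ℝ, EG)) (G := G) ξ).contMDiffAt.of_le (by
      rw [minSmoothness_of_isRCLikeNormedField]
      exact one_le_two))
  have hconst : ∀ᶠ t in 𝓝 (0 : ℝ), γ t • q = γ 0 • q := by
    refine eventually_eq_of_hasMFDerivAt_zero (E := E) ?_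
    filter_upwards [hγ] with t ht
    have h := (horb (γ t)).hasMFDerivAt.comp t ht
    refine h.congr_mfderiv (ContinuousLinearMap.ext fun x : ℝ ↦ ?_)
    have h' : (mfderiv 𝓘(ℝ, EG) 𝓘(ℝ, E) (fun g : G ↦ g • q) (γ t)
        (mulInvariantVectorField (I := 𝓘(ℝ, EG)) (G := G) ξ (γ t))) = 0 :=
      hzero (γ t) (γ t) (mul_one _)
    change mfderiv 𝓘(ℝ, EG) 𝓘(ℝ, E) (fun g : G ↦ g • q) (γ t)
        (x • mulInvariantVectorField (I := 𝓘(ℝ, EG)) (G := G) ξ (γ t)) = 0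
    rw [map_smul, h', smul_zero]
  have hγ1 : γ =ᶠ[𝓝 0] fun _ ↦ (1 : G) := by
    filter_upwards [hconst] with t ht
    rw [hγ0, one_smul] at ht
    exact hfree _ ht
  have h1 := hγ.self_of_nhds
  have h2 := (hasMFDerivAt_const (I := 𝓘(ℝ, ℝ)) (I' := 𝓘(ℝ, EG)) (1 : G)
    (0 : ℝ)).congr_of_eventuallyEq hγ1
  have h3 : mulInvariantVectorField (I := 𝓘(ℝ, EG)) (G := G) ξ (γ 0) = 0 := by
    have h := congrArg (fun L : ℝ →L[ℝ] TangentSpace 𝓘(ℝ, EG) (γ 0) ↦ L 1)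
      (hasMFDerivAt_unique h1 h2)
    refine Eq.trans ?_ h
    exact (one_smul ℝ _).symm
  rw [hγ0] at h3
  have h4 : ((1 : G) * ·) = (id : G → G) := funext one_mul
  have h5 : (mfderiv 𝓘(ℝ, EG) 𝓘(ℝ, EG) ((1 : G) * ·) (1 : G) ξ : EG) = 0 := h3
  rw [h4, mfderiv_id] at h5
  exact h5

end FreeAction

/-! ### Infinitesimal generators on Q in coordinates -/

section Orbit

variable {E : Type*} [NormedAddCommGroup E] [NormedSpace ℝ E]
  {Q : Type*} [TopologicalSpace Q] [ChartedSpace E Q]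
  {EG : Type*} [NormedAddCommGroup EG] [NormedSpace ℝ EG]
  {G : Type*} [Group G] [TopologicalSpace G] [ChartedSpace EG G] [MulAction G Q]

/-- The infinitesimal generators of the action on `Q` in the chart around `q₀`. -/
noncomputable def coordGenerator (G : Type*) [Group G] [TopologicalSpace G] [ChartedSpace EG G]
    [MulAction G Q] (q₀ : Q) (x : E) : EG →L[ℝ] E :=
  fderiv ℝ (coordAction (EG := EG) G q₀) (extChartAt 𝓘(ℝ, EG) (1 : G) 1, x) ∘L
    ContinuousLinearMap.inl ℝ EG E

theorem mdifferentiableAt_orbit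
    (hsm : ContMDiff (𝓘(ℝ, EG).prod 𝓘(ℝ, E)) 𝓘(ℝ, E) ∞ (fun p : G × Q ↦ p.1 • p.2))
    (g : G) (q : Q) : MDifferentiableAt 𝓘(ℝ, EG) 𝓘(ℝ, E) (fun g : G ↦ g • q) g :=
  ((hsm (g, q)).comp g (contMDiffAt_id.prodMk contMDiffAt_const)).mdifferentiableAt (by simp)

variable [IsManifold 𝓘(ℝ, E) ∞ Q]

section

variable [IsManifold 𝓘(ℝ, EG) ∞ G]

theorem contDiffAt_coordGenerator
    (hsm : ContMDiff (𝓘(ℝ, EG).prod 𝓘(ℝ, E)) 𝓘(ℝ, E) ∞ (fun p : G × Q ↦ p.1 • p.2)) {q₀ : Q}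
    {x : E} (hx : x ∈ (extChartAt 𝓘(ℝ, E) q₀).target) :
    ContDiffAt ℝ ∞ (coordGenerator (EG := EG) G q₀) x := by
  refine ContDiffAt.clm_comp ?_ contDiffAt_const
  have h : ContDiffAt ℝ ∞ (fderiv ℝ (coordAction (EG := EG) G q₀))
      (extChartAt 𝓘(ℝ, EG) (1 : G) 1, x) :=
    (contDiffAt_coordAction_one hsm hx).fderiv_right (m := ∞) (by simp)
  exact h.comp x (contDiffAt_const.prodMk contDiffAt_id)

theorem fderiv_extChartAt_orbit
    (hsm : ContMDiff (𝓘(ℝ, EG).prod 𝓘(ℝ, E)) 𝓘(ℝ, E) ∞ (fun p : G × Q ↦ p.1 • p.2)) {q₀ q : Q}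
    (hq : q ∈ (extChartAt 𝓘(ℝ, E) q₀).source) :
    fderiv ℝ (extChartAt 𝓘(ℝ, E) q₀ ∘ (fun g : G ↦ g • q) ∘ (extChartAt 𝓘(ℝ, EG) (1 : G)).symm)
      (extChartAt 𝓘(ℝ, EG) (1 : G) 1) = coordGenerator G q₀ (extChartAt 𝓘(ℝ, E) q₀ q) := by
  have hx := (extChartAt 𝓘(ℝ, E) q₀).map_source hq
  have h := ((contDiffAt_coordAction_one (G := G) hsm hx).differentiableAt
    (by simp)).hasFDerivAt.comp (f := fun ε ↦ (ε, extChartAt 𝓘(ℝ, E) q₀ q))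
    (extChartAt 𝓘(ℝ, EG) (1 : G) 1)
    (hasFDerivAt_prodMk_left (extChartAt 𝓘(ℝ, EG) (1 : G) 1) (extChartAt 𝓘(ℝ, E) q₀ q))
  refine Eq.trans ?_ h.fderiv
  congr 1
  ext ε
  simp only [Function.comp_apply, coordAction, (extChartAt 𝓘(ℝ, E) q₀).left_inv hq]

theorem coordAction_fderiv_inr
    (hsm : ContMDiff (𝓘(ℝ, EG).prod 𝓘(ℝ, E)) 𝓘(ℝ, E) ∞ (fun p : G × Q ↦ p.1 • p.2)) {q₀ : Q}
    {x : E} (hx : x ∈ (extChartAt 𝓘(ℝ, E) q₀).target) (v : E) :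
    fderiv ℝ (coordAction (EG := EG) G q₀) (extChartAt 𝓘(ℝ, EG) (1 : G) 1, x) (0, v) = v := by
  have h := ((contDiffAt_coordAction_one (G := G) hsm hx).differentiableAt
    (by simp)).hasFDerivAt.comp x
    (hasFDerivAt_prodMk_right (extChartAt 𝓘(ℝ, EG) (1 : G) 1) x)
  have hev : (coordAction (EG := EG) G q₀ ∘ fun x ↦ (extChartAt 𝓘(ℝ, EG) (1 : G) 1, x))
      =ᶠ[𝓝 x] id := by
    filter_upwards [(isOpen_extChartAt_target q₀).mem_nhds hx] with z hz
    exact coordAction_one hz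
  have h2 := h.fderiv.symm.trans (hev.fderiv_eq.trans fderiv_id)
  exact congrArg (fun L : E →L[ℝ] E ↦ L v) h2

end

theorem injective_coordGenerator [FiniteDimensional ℝ EG] [LieGroup 𝓘(ℝ, EG) ∞ G]
    (hsm : ContMDiff (𝓘(ℝ, EG).prod 𝓘(ℝ, E)) 𝓘(ℝ, E) ∞ (fun p : G × Q ↦ p.1 • p.2)) {q₀ q : Q}
    (hq : q ∈ (extChartAt 𝓘(ℝ, E) q₀).source) (hfree : ∀ g : G, g • q = q → g = 1) :
    Function.Injective (coordGenerator (EG := EG) G q₀ (extChartAt 𝓘(ℝ, E) q₀ q)) := by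
  rw [injective_iff_map_eq_zero]
  intro ξ hξ
  refine eq_zero_of_mfderiv_smul_eq_zero hsm hfree ?_
  have h := chartDeriv_mfderiv (mdifferentiableAt_orbit hsm (1 : G) q) (one_smul G q) hq ξ
  rw [fderiv_extChartAt_orbit hsm hq, hξ] at h
  exact (chartDeriv_bijective hq).1 (h.trans (map_zero _).symm)

end Orbit

/-! ### The action on M and its infinitesimal generators -/

namespace NonholonomicSystem

namespace IsSymmetry

variable {E : Type*} [NormedAddCommGroup E] [NormedSpace ℝ E]
  {Q : Type*} [TopologicalSpace Q] [ChartedSpace E Q] [IsManifold 𝓘(ℝ, E) ∞ Q]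
  {EG : Type*} [NormedAddCommGroup EG] [NormedSpace ℝ EG]
  {G : Type*} [Group G] [TopologicalSpace G] [ChartedSpace EG G] [MulAction G Q]
  {S : NonholonomicSystem E Q} (h : S.IsSymmetry EG G)

theorem covector_act (g : G) (m : S.M) (w : TangentSpace 𝓘(ℝ, E) (g • m.proj)) :
    S.covector (g • m.proj) (h.act g m).2 w
      = S.covector m.proj m.2 ((tangentSMul E g m.proj).inverse w) := rfl

theorem covector_act_tangentSMul (g : G) (m : S.M) (u : TangentSpace 𝓘(ℝ, E) m.proj) :
    S.covector (g • m.proj) (h.act g m).2 (tangentSMul E g m.proj u)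
      = S.covector m.proj m.2 u := by
  obtain ⟨e, he⟩ := h.isInvertible_tangentSMul g m.proj
  rw [covector_act, ← he, ContinuousLinearMap.inverse_equiv]
  simp

theorem act_one (m : S.M) : h.act 1 m = m := by
  -- The fibres over 1 • q and q are different types, so the covectors are compared in the model
  -- space, with which all tangent spaces of Q are definitionally identified.
  have key : ∀ (q : Q) (v : S.Fibre q) (q' : Q) (v' : S.Fibre q'), q' = q →
      ((S.covector q' v' : E →L[ℝ] ℝ) = (S.covector q v : E →L[ℝ] ℝ)) →
      (⟨q', v'⟩ : S.M) = ⟨q, v⟩ := by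
    rintro q v _ v' rfl hv
    congr 1
    exact Subtype.ext hv
  have hinv : ∀ f : Q → Q, f = id →
      ((mfderiv 𝓘(ℝ, E) 𝓘(ℝ, E) f m.proj).inverse : E →L[ℝ] E) = ContinuousLinearMap.id ℝ E := by
    rintro _ rfl
    rw [mfderiv_id]
    exact ContinuousLinearMap.inverse_id
  refine key m.proj m.2 ((1 : G) • m.proj) (h.act 1 m).2 (one_smul G m.proj) ?_
  refine ContinuousLinearMap.ext fun w ↦ ?_
  refine (h.covector_act 1 m w).trans ?_
  exact congrArg (fun L : E →L[ℝ] E ↦ S.covector m.proj m.2 (L w))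
    (hinv (fun x ↦ (1 : G) • x) (funext (one_smul G)))

/-- The covector of `φ_g(m)` is `κ(T_q g v, ·)` if the covector of `m` is `κ(v, ·)`. -/
theorem covector_act_eq_inner (g : G) (m : S.M) (v : TangentSpace 𝓘(ℝ, E) m.proj)
    (hv : S.covector m.proj m.2 = S.κ.inner m.proj v) (w : TangentSpace 𝓘(ℝ, E) (g • m.proj)) :
    S.covector (g • m.proj) (h.act g m).2 w
      = S.κ.inner (g • m.proj) w (tangentSMul E g m.proj v) := by
  obtain ⟨e, he⟩ := h.isInvertible_tangentSMul g m.proj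
  obtain ⟨u, rfl⟩ : ∃ u, tangentSMul E g m.proj u = w := by
    rw [← he]
    exact e.surjective w
  rw [covector_act_tangentSMul, hv, h.inner_eq, S.κ.symm]

/-- The pairings of the covector ∑ c_a κ(s_a, ·) with the frame vectors are the Gram matrix applied
to c; inverting that matrix recovers the fibre coordinates. -/
theorem trivializationAt_act (q₀ : Q) (g : G) (m : S.M)
    (hq : g • m.proj ∈ (S.frameAt q₀).dom) :
    (trivializationAt (Fin S.rank → ℝ) S.Fibre q₀ (h.act g m)).2
      = (gram (S.frameAt q₀) (S.frameAt q₀) (g • m.proj)).inverse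
        (fun b ↦ S.covector (g • m.proj) (h.act g m).2 ((S.frameAt q₀).vec b (g • m.proj))) := by
  have h1 := S.trivializationAt_apply_snd q₀ (h.act g m) hq
  obtain ⟨e, he⟩ := isInvertible_gram (S.frameAt q₀) (g • m.proj) hq
  have h2 : (fun b ↦ S.covector (g • m.proj) (h.act g m).2 ((S.frameAt q₀).vec b (g • m.proj)))
      = e ((trivializationAt (Fin S.rank → ℝ) S.Fibre q₀ (h.act g m)).2) := by
    ext b
    have h3 := gram_apply (S.frameAt q₀) (S.frameAt q₀) (g • m.proj) hq
      ((trivializationAt (Fin S.rank → ℝ) S.Fibre q₀ (h.act g m)).2) b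
    rw [← he] at h3
    refine Eq.trans ?_ h3.symm
    rw [h1]
    exact congrArg (fun x ↦ S.covector (g • m.proj) x ((S.frameAt q₀).vec b (g • m.proj)))
      (LinearEquiv.symm_apply_apply _ _).symm
  rw [h2, ← he, ContinuousLinearMap.inverse_equiv]
  simp

section

variable [IsManifold 𝓘(ℝ, EG) ∞ G]

/-- The fibre coordinates are given by `trivializationAt_act`. If the covector of m is κ(v, ·),
invariance of κ makes the pairings κ(s_b, T_q g v), so the inverse tangent map in the cotangent lift
disappears and the dependence on g is visibly smooth. -/
theorem contMDiffAt_act (m : S.M) :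
    ContMDiffAt 𝓘(ℝ, EG) S.modelM ∞ (fun g : G ↦ h.act g m) 1 := by
  set q := m.proj with hqdef
  have horb : ContMDiffAt 𝓘(ℝ, EG) 𝓘(ℝ, E) ∞ (fun g : G ↦ g • q) 1 :=
    (h.contMDiff_smul (1, q)).comp (1 : G) (contMDiffAt_id.prodMk contMDiffAt_const)
  have hdom := S.mem_frameAt_dom q
  have hsrc := mem_chart_source E q
  have hopen : IsOpen ((S.frameAt q).dom ∩ (chartAt E q).source) :=
    (S.frameAt q).isOpen_dom.inter (chartAt E q).open_source
  have h1q : (1 : G) • q ∈ (S.frameAt q).dom ∩ (chartAt E q).source := by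
    rw [one_smul]; exact ⟨hdom, hsrc⟩
  have he : h.act 1 m ∈ (trivializationAt (Fin S.rank → ℝ) S.Fibre q).source := by
    rw [Trivialization.mem_source]
    exact h1q.1
  rw [(trivializationAt (Fin S.rank → ℝ) S.Fibre q).contMDiffAt_iff
    (f := fun g : G ↦ h.act g m) he]
  refine ⟨horb, ?_⟩
  obtain ⟨v, hvD, hv⟩ : ∃ v ∈ S.D q, S.κ.inner q v = S.covector q m.2 :=
    Subtype.prop (p := (· ∈ S.fibre q)) m.2
  have hζ : ContMDiffAt 𝓘(ℝ, EG) 𝓘(ℝ, EG) ∞ (extChartAt 𝓘(ℝ, EG) (1 : G)) 1 :=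
    contMDiffAt_extChartAt
  have hD : ContMDiffAt 𝓘(ℝ, EG) 𝓘(ℝ, E) ∞ (fun g : G ↦
      fderiv ℝ (coordAction (EG := EG) G q) (extChartAt 𝓘(ℝ, EG) (1 : G) g, extChartAt 𝓘(ℝ, E) q q)
        ((0 : EG), chartDeriv 𝓘(ℝ, E) q q v)) 1 := by
    have h1 : ContDiffAt ℝ ∞ (fderiv ℝ (coordAction (EG := EG) G q))
        (extChartAt 𝓘(ℝ, EG) (1 : G) 1, extChartAt 𝓘(ℝ, E) q q) :=
      (contDiffAt_coordAction_one h.contMDiff_smul (mem_extChartAt_target q)).fderiv_right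
        (m := ∞) (by simp)
    have h2 : ContDiffAt ℝ ∞ (fun ε : EG ↦ fderiv ℝ (coordAction (EG := EG) G q)
        (ε, extChartAt 𝓘(ℝ, E) q q) ((0 : EG), chartDeriv 𝓘(ℝ, E) q q v))
        (extChartAt 𝓘(ℝ, EG) (1 : G) 1) :=
      (h1.comp (f := fun ε ↦ (ε, extChartAt 𝓘(ℝ, E) q q)) _
        (contDiffAt_id.prodMk contDiffAt_const)).clm_apply contDiffAt_const
    exact h2.contMDiffAt.comp (1 : G) hζ
  have hw : ContMDiffAt 𝓘(ℝ, EG) 𝓘(ℝ, Fin S.rank → ℝ) ∞ (fun g : G ↦ fun b ↦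
      S.frameCovector q b (g • q) (fderiv ℝ (coordAction (EG := EG) G q)
        (extChartAt 𝓘(ℝ, EG) (1 : G) g, extChartAt 𝓘(ℝ, E) q q)
        ((0 : EG), chartDeriv 𝓘(ℝ, E) q q v))) 1 := by
    rw [contMDiffAt_pi_space]
    intro b
    have h1 := ((S.contMDiffOn_frameCovector q b).contMDiffAt (hopen.mem_nhds h1q)).comp
      (1 : G) horb
    exact h1.clm_apply hD
  have hg : ContMDiffAt 𝓘(ℝ, EG) 𝓘(ℝ, (Fin S.rank → ℝ) →L[ℝ] (Fin S.rank → ℝ)) ∞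
      (fun g : G ↦ (gram (S.frameAt q) (S.frameAt q) (g • q)).inverse) 1 := by
    have h1 := (contMDiffOn_gram (S.frameAt q) (S.frameAt q)).contMDiffAt
      (((S.frameAt q).isOpen_dom.inter (S.frameAt q).isOpen_dom).mem_nhds ⟨h1q.1, h1q.1⟩)
    have h2 := (ContinuousLinearMap.IsInvertible.contDiffAt_map_inverse (n := ∞)
      (isInvertible_gram (S.frameAt q) ((1 : G) • q) h1q.1)).contMDiffAt
    exact (h2.comp _ h1).comp (1 : G) horb
  refine (hg.clm_apply hw).congr_of_eventuallyEq ?_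
  filter_upwards [horb.continuousAt.preimage_mem_nhds (hopen.mem_nhds h1q),
    (chartAt EG (1 : G)).open_source.mem_nhds (mem_chart_source EG (1 : G))] with g hgq hg1
  refine (h.trivializationAt_act q g m hgq.1).trans ?_
  congr 1
  ext b
  rw [h.covector_act_eq_inner g m v hv.symm,
    ← chartDeriv_tangentSMul h.contMDiff_smul hg1 hsrc hgq.2]
  exact (covectorInChart_chartDeriv hgq.2 _ _).symm

theorem chartDeriv_generator {m₀ m : S.M} (hm : m ∈ (extChartAt S.modelM m₀).source) (ξ : EG) :
    chartDeriv S.modelM m₀ m (h.generator m ξ)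
      = fderiv ℝ (extChartAt S.modelM m₀ ∘ (fun g : G ↦ h.act g m) ∘
        (extChartAt 𝓘(ℝ, EG) (1 : G)).symm) (extChartAt 𝓘(ℝ, EG) (1 : G) 1) ξ :=
  chartDeriv_mfderiv ((h.contMDiffAt_act m).mdifferentiableAt (by simp)) (h.act_one m) hm ξ

theorem differentiableAt_act_inChart {m₀ m : S.M} (hm : m ∈ (extChartAt S.modelM m₀).source) :
    DifferentiableAt ℝ (extChartAt S.modelM m₀ ∘ (fun g : G ↦ h.act g m) ∘
      (extChartAt 𝓘(ℝ, EG) (1 : G)).symm) (extChartAt 𝓘(ℝ, EG) (1 : G) 1) := by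
  have h1 := mdifferentiableAt_extChartAt_symm (mem_extChartAt_target (I := 𝓘(ℝ, EG)) (1 : G))
  have h2 : MDifferentiableAt 𝓘(ℝ, EG) S.modelM (fun g : G ↦ h.act g m)
      ((extChartAt 𝓘(ℝ, EG) (1 : G)).symm (extChartAt 𝓘(ℝ, EG) (1 : G) 1)) := by
    rw [extChartAt_to_inv]
    exact (h.contMDiffAt_act m).mdifferentiableAt (by simp)
  have h3 : MDifferentiableAt S.modelM 𝓘(ℝ, E × (Fin S.rank → ℝ)) (extChartAt S.modelM m₀)
      (h.act ((extChartAt 𝓘(ℝ, EG) (1 : G)).symm (extChartAt 𝓘(ℝ, EG) (1 : G) 1)) m) := by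
    rw [extChartAt_to_inv, act_one]
    exact mdifferentiableAt_extChartAt (by rwa [← extChartAt_source S.modelM])
  exact (h3.comp (f := (fun g : G ↦ h.act g m) ∘ (extChartAt 𝓘(ℝ, EG) (1 : G)).symm) _
    (h2.comp _ h1)).differentiableAt

/-- The projection from M to Q is equivariant, so ξ_M projects to ξ_Q. -/
theorem fst_chartDeriv_generator {m₀ m : S.M} (hm : m ∈ (extChartAt S.modelM m₀).source) (ξ : EG) :
    (chartDeriv S.modelM m₀ m (h.generator m ξ)).1
      = coordGenerator G m₀.proj (extChartAt S.modelM m₀ m).1 ξ := by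
  have hs := TotalSpace.mem_extChartAt_source.1 hm
  have hd := h.differentiableAt_act_inChart hm
  rw [chartDeriv_generator h hm, TotalSpace.extChartAt_apply hs.1,
    ← fderiv_extChartAt_orbit h.contMDiff_smul (by rw [extChartAt_source]; exact hs.2)]
  have h1 := (hasFDerivAt_fst.comp _ hd.hasFDerivAt).fderiv
  refine (congrArg (fun L : EG →L[ℝ] E ↦ L ξ) h1).symm.trans ?_
  refine congrArg (fun L : EG →L[ℝ] E ↦ L ξ) (Filter.EventuallyEq.fderiv_eq ?_)
  have hc : ContinuousAt (fun ε ↦ (extChartAt 𝓘(ℝ, EG) (1 : G)).symm ε • m.proj)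
      (extChartAt 𝓘(ℝ, EG) (1 : G) 1) := by
    refine ContinuousAt.comp (g := fun g : G ↦ g • m.proj) ?_ (continuousAt_extChartAt_symm _)
    exact (mdifferentiableAt_orbit h.contMDiff_smul _ _).continuousAt
  have hn : (S.frameAt m₀.proj).dom ∈
      𝓝 ((extChartAt 𝓘(ℝ, EG) (1 : G)).symm (extChartAt 𝓘(ℝ, EG) (1 : G) 1) • m.proj) := by
    rw [extChartAt_to_inv, one_smul]
    exact (S.frameAt m₀.proj).isOpen_dom.mem_nhds hs.1
  filter_upwards [hc.preimage_mem_nhds hn] with ε hε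
  exact congrArg Prod.fst (TotalSpace.extChartAt_apply (E := E) (p := m₀)
    (p' := h.act ((extChartAt 𝓘(ℝ, EG) (1 : G)).symm ε) m) hε)

end

theorem injective_generator [FiniteDimensional ℝ EG] [LieGroup 𝓘(ℝ, EG) ∞ G] (m : S.M)
    (hfree : ∀ g : G, g • m.proj = m.proj → g = 1) : Function.Injective (h.generator m) := by
  rw [injective_iff_map_eq_zero]
  intro ξ hξ
  have hs := mem_extChartAt_source (I := S.modelM) m
  have h1 := h.fst_chartDeriv_generator hs ξ
  rw [hξ, map_zero, TotalSpace.extChartAt_apply (TotalSpace.mem_extChartAt_source.1 hs).1] at h1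
  exact (injective_iff_map_eq_zero _).1 (injective_coordGenerator h.contMDiff_smul
    (mem_extChartAt_source m.proj) hfree) ξ h1.symm

end IsSymmetry

end NonholonomicSystem

/-! ### The momentum map and its differential -/

namespace NonholonomicSystem

namespace IsSymmetry

variable {E : Type*} [NormedAddCommGroup E] [NormedSpace ℝ E]
  {Q : Type*} [TopologicalSpace Q] [ChartedSpace E Q] [IsManifold 𝓘(ℝ, E) ∞ Q]
  {EG : Type*} [NormedAddCommGroup EG] [NormedSpace ℝ EG]
  {G : Type*} [Group G] [TopologicalSpace G] [ChartedSpace EG G] [MulAction G Q]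
  [IsManifold 𝓘(ℝ, EG) ∞ G]
  {S : NonholonomicSystem E Q} (h : S.IsSymmetry EG G)

theorem covector_eq_frameSum {m m' : S.M} (hm' : m' ∈ (extChartAt S.modelM m).source)
    (v : TangentSpace 𝓘(ℝ, E) m'.proj) :
    S.covector m'.proj m'.2 v = frameSum (S.coordCovector m.proj) (extChartAt S.modelM m m')
      (chartDeriv 𝓘(ℝ, E) m.proj m'.proj v) := by
  have hs := TotalSpace.mem_extChartAt_source.1 hm'
  rw [S.covector_eq_sum m.proj m' hs.1, frameSum_apply, sum_apply]
  refine Finset.sum_congr rfl fun a _ ↦ ?_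
  rw [S.coordCovector_chartDeriv hm', TotalSpace.extChartAt_apply hs.1]
  rfl

/-- Since ξ_M projects to ξ_Q, the momentum is the pairing of the covector of m' with ξ_Q; only the
generators on Q enter. -/
theorem momentum_eq {m m' : S.M} (hm' : m' ∈ (extChartAt S.modelM m).source) :
    h.momentum m' = frameSum (S.coordCovector m.proj) (extChartAt S.modelM m m') ∘L
      coordGenerator G m.proj (extChartAt S.modelM m m').1 := by
  ext ξ
  have h1 : h.momentum m' ξ = S.ΘM m' (fun _ ↦ h.generator m' ξ) := rfl
  rw [h1, ΘM_apply, covector_eq_frameSum hm', chartDeriv_projDeriv hm',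
    h.fst_chartDeriv_generator hm']
  rfl

/-- The derivative of the momentum map. -/
noncomputable def momentumDeriv (m : S.M) : TangentSpace S.modelM m →L[ℝ] (EG →L[ℝ] ℝ) :=
  mfderiv S.modelM 𝓘(ℝ, EG →L[ℝ] ℝ) h.momentum m

theorem momentumDeriv_apply (m : S.M) (X : TangentSpace S.modelM m) (ξ : EG) :
    h.momentumDeriv m X ξ
      = fderiv ℝ (frameSum (S.coordCovector m.proj)) (extChartAt S.modelM m m)
          (chartDeriv S.modelM m m X) (coordGenerator G m.proj (extChartAt S.modelM m m).1 ξ)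
        + frameSum (S.coordCovector m.proj) (extChartAt S.modelM m m)
          (fderiv ℝ (coordGenerator (EG := EG) G m.proj) (extChartAt S.modelM m m).1
            (chartDeriv S.modelM m m X).1 ξ) := by
  have hy := mem_extChartAt_target (I := S.modelM) m
  have hl := S.contDiffAt_coordCovector (S.fst_mem_of_mem_target hy)
  have hT := ((contDiffAt_frameSum hl).differentiableAt (by simp)).hasFDerivAt
  have hG := ((contDiffAt_coordGenerator (EG := EG) (G := G) h.contMDiff_smul
    (S.fst_mem_of_mem_target hy).1).differentiableAt (by simp)).hasFDerivAt
  have hG' := hG.comp (extChartAt S.modelM m m) hasFDerivAt_fst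
  have hJ := hT.clm_comp hG'
  have hφ : MDifferentiableAt S.modelM 𝓘(ℝ, E × (Fin S.rank → ℝ)) (extChartAt S.modelM m) m :=
    mdifferentiableAt_extChartAt (mem_chart_source _ _)
  have hev : h.momentum =ᶠ[𝓝 m] (fun y ↦ frameSum (S.coordCovector m.proj) y ∘L
      (coordGenerator (EG := EG) G m.proj ∘ Prod.fst) y) ∘ extChartAt S.modelM m := by
    filter_upwards [extChartAt_source_mem_nhds (I := S.modelM) m] with m' hm'
    exact h.momentum_eq hm'
  have h1 := hev.mfderiv_eq (I := S.modelM) (I' := 𝓘(ℝ, EG →L[ℝ] ℝ))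
  rw [mfderiv_comp m hJ.differentiableAt.mdifferentiableAt hφ, mfderiv_eq_fderiv, hJ.fderiv] at h1
  refine (congrArg (fun L : TangentSpace S.modelM m →L[ℝ] (EG →L[ℝ] ℝ) ↦ L X ξ) h1).trans ?_
  rw [add_comm]
  rfl

/-- The invariance of the Liouville form under the action, differentiated at the identity. -/
theorem fderiv_frameSum_generator (m : S.M) (ξ : EG) (v : E) :
    fderiv ℝ (frameSum (S.coordCovector m.proj)) (extChartAt S.modelM m m)
        (chartDeriv S.modelM m m (h.generator m ξ)) v
      + frameSum (S.coordCovector m.proj) (extChartAt S.modelM m m)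
        (fderiv ℝ (coordGenerator (EG := EG) G m.proj) (extChartAt S.modelM m m).1 v ξ) = 0 := by
  have hs := mem_extChartAt_source (I := S.modelM) m
  have hy := mem_extChartAt_target (I := S.modelM) m
  have hx := (S.fst_mem_of_mem_target hy).1
  have hl := S.contDiffAt_coordCovector (S.fst_mem_of_mem_target hy)
  have hxq : (extChartAt S.modelM m m).1 = extChartAt 𝓘(ℝ, E) m.proj m.proj := by
    rw [TotalSpace.extChartAt_apply (E := E) (TotalSpace.mem_extChartAt_source.1 hs).1]
  set ε₀ := extChartAt 𝓘(ℝ, EG) (1 : G) 1 with hε₀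
  set y₀ := extChartAt S.modelM m m with hy₀
  set a : EG × E → E := coordAction (EG := EG) G m.proj with ha
  set f := extChartAt S.modelM m ∘ (fun g : G ↦ h.act g m) ∘ (extChartAt 𝓘(ℝ, EG) (1 : G)).symm
    with hf
  have hf0 : f ε₀ = y₀ := by
    simp only [hf, hε₀, Function.comp_apply, extChartAt_to_inv, act_one, hy₀]
  have hac : ContDiffAt ℝ ∞ a (ε₀, y₀.1) := contDiffAt_coordAction_one h.contMDiff_smul hx
  have ha2 : DifferentiableAt ℝ (fderiv ℝ a) (ε₀, y₀.1) :=
    (hac.fderiv_right (m := ∞) (by simp)).differentiableAt (by simp)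
  have hsymm : IsSymmSndFDerivAt ℝ a (ε₀, y₀.1) :=
    hac.isSymmSndFDerivAt minSmoothness_two_le_infty
  have hT : HasFDerivAt (frameSum (S.coordCovector m.proj))
      (fderiv ℝ (frameSum (S.coordCovector m.proj)) y₀) (f ε₀) := by
    rw [hf0]
    exact ((contDiffAt_frameSum hl).differentiableAt (by simp)).hasFDerivAt
  have hfd := (h.differentiableAt_act_inChart hs).hasFDerivAt
  have hY := (ha2.hasFDerivAt.comp (f := fun ε ↦ (ε, y₀.1)) ε₀
    (hasFDerivAt_prodMk_left ε₀ y₀.1)).clm_apply (hasFDerivAt_const ((0 : EG), v) ε₀)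
  have hd := (hT.comp ε₀ hfd).clm_apply hY
  -- The covector of φ_g(m) on T_q g u equals that of m on u, by the definition of the cotangent
  -- lift. So this function of g is constant near 1, and its derivative in the direction ξ is 0.
  have hev : (fun ε ↦ (frameSum (S.coordCovector m.proj) ∘ f) ε
      ((fderiv ℝ a ∘ fun ε ↦ (ε, y₀.1)) ε (0, v))) =ᶠ[𝓝 ε₀]
      fun _ ↦ frameSum (S.coordCovector m.proj) y₀ v := by
    have hc : ContinuousAt (fun ε ↦ (extChartAt 𝓘(ℝ, EG) (1 : G)).symm ε • m.proj) ε₀ := by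
      refine ContinuousAt.comp (g := fun g : G ↦ g • m.proj) ?_ (continuousAt_extChartAt_symm _)
      exact (mdifferentiableAt_orbit h.contMDiff_smul _ _).continuousAt
    have hn : (S.frameAt m.proj).dom ∩ (chartAt E m.proj).source ∈
        𝓝 ((extChartAt 𝓘(ℝ, EG) (1 : G)).symm ε₀ • m.proj) := by
      rw [hε₀, extChartAt_to_inv, one_smul]
      exact ((S.frameAt m.proj).isOpen_dom.inter (chartAt E m.proj).open_source).mem_nhds
        (TotalSpace.mem_extChartAt_source.1 hs)
    filter_upwards [hc.preimage_mem_nhds hn,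
      (isOpen_extChartAt_target (I := 𝓘(ℝ, EG)) (1 : G)).mem_nhds
        (mem_extChartAt_target (1 : G))] with ε hε hε'
    set g := (extChartAt 𝓘(ℝ, EG) (1 : G)).symm ε with hg
    obtain ⟨u, rfl⟩ := (chartDeriv_bijective (mem_extChartAt_source (I := 𝓘(ℝ, E)) m.proj)).2 v
    have hg' : g ∈ (chartAt EG (1 : G)).source := symm_mem_chart_source hε'
    have h1 := chartDeriv_tangentSMul h.contMDiff_smul hg' (mem_chart_source E m.proj) hε.2 u
    rw [hg, (extChartAt 𝓘(ℝ, EG) (1 : G)).right_inv hε', ← hxq] at h1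
    have hact : h.act g m ∈ (extChartAt S.modelM m).source :=
      TotalSpace.mem_extChartAt_source.2 hε
    have h2 := covector_eq_frameSum hact (tangentSMul E g m.proj u)
    have h3 := covector_eq_frameSum hs u
    rw [← hy₀, ← h.covector_act_tangentSMul g m u] at h3
    refine Eq.trans ?_ (h2.symm.trans h3)
    exact congrArg (frameSum (S.coordCovector m.proj) (extChartAt S.modelM m (h.act g m))) h1.symm
  have hzero := congrArg (fun L : EG →L[ℝ] ℝ ↦ L ξ)
    (hd.unique ((hasFDerivAt_const _ ε₀).congr_of_eventuallyEq hev))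
  -- The derivative of ξ_Q along v and the derivative of T_q g v in the direction ξ are the two
  -- mixed second derivatives of the action at the identity; they agree by symmetry.
  have hGd : fderiv ℝ (coordGenerator (EG := EG) G m.proj) y₀.1 v ξ
      = fderiv ℝ (fderiv ℝ a) (ε₀, y₀.1) (0, v) (ξ, 0) := by
    have h1 := ((ha2.hasFDerivAt.comp (f := fun x ↦ (ε₀, x)) y₀.1
      (hasFDerivAt_prodMk_right ε₀ y₀.1)).clm_comp
      (hasFDerivAt_const (ContinuousLinearMap.inl ℝ EG E) y₀.1)).fderiv
    refine (congrArg (fun L : E →L[ℝ] (EG →L[ℝ] E) ↦ L v ξ) h1).trans ?_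
    simp
  have hval : fderiv ℝ a (ε₀, y₀.1) (0, v) = v := coordAction_fderiv_inr h.contMDiff_smul hx v
  rw [hGd, hsymm.eq, h.chartDeriv_generator hs]
  simp only [hf0, Function.comp_apply, hval] at hzero
  simpa [hf0, hval, add_comm] using hzero

/-- The momentum map satisfies `i_{ξ_M} Ω_M = d⟨J, ξ⟩`. -/
theorem ΩM_generator (m : S.M) (ξ : EG) (X : TangentSpace S.modelM m) :
    S.ΩM m ![h.generator m ξ, X]
      = h.momentumDeriv m X ξ := by
  have hs := mem_extChartAt_source (I := S.modelM) m
  have hy := mem_extChartAt_target (I := S.modelM) m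
  have hl := S.contDiffAt_coordCovector (S.fst_mem_of_mem_target hy)
  have e : (fun i ↦ chartDeriv S.modelM m m (![h.generator m ξ, X] i))
      = ![chartDeriv S.modelM m m (h.generator m ξ), chartDeriv S.modelM m m X] := by
    ext i <;> fin_cases i <;> rfl
  -- In -dΘ_M(ξ_M, X) one term differentiates the covector along X and pairs it with ξ_Q, the other
  -- differentiates it along ξ_M. Invariance turns the latter into the derivative of ξ_Q along X,
  -- and the product rule for ⟨J, ξ⟩ is obtained.
  have h1 := h.fderiv_frameSum_generator m ξ (chartDeriv S.modelM m m X).1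
  rw [← S.ΩM.inChart_chartDeriv hs, S.ΩM_inChart hy, e, h.momentumDeriv_apply,
    ← h.fst_chartDeriv_generator hs, ContinuousAlternatingMap.neg_apply, extDeriv_frameForm hl]
  linarith

end IsSymmetry

end NonholonomicSystem

/-! ### Linear algebra with smooth parameters -/

theorem ContinuousLinearMap.IsInvertible.eventually {X : Type*} [TopologicalSpace X]
    {V : Type*} [NormedAddCommGroup V] [NormedSpace ℝ V] [CompleteSpace V] {L : X → V →L[ℝ] V}
    {y : X} (hL : ContinuousAt L y) (h : (L y).IsInvertible) :
    ∀ᶠ z in 𝓝 y, (L z).IsInvertible := by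
  obtain ⟨u, hu⟩ := h
  have h1 := ContinuousLinearEquiv.nhds (𝕜 := ℝ) u
  rw [hu] at h1
  exact hL.preimage_mem_nhds h1

section Frames

variable {X : Type*} [NormedAddCommGroup X] [NormedSpace ℝ X]
  {V : Type*} [NormedAddCommGroup V] [NormedSpace ℝ V]
  {F : Type*} [NormedAddCommGroup F] [NormedSpace ℝ F] {n : WithTop ℕ∞} {y : X}

theorem contDiffAt_sum_smulRight {ι : Type*} [Fintype ι] {f : ι → X → F}
    (hf : ∀ i, ContDiffAt ℝ n (f i) y) : ContDiffAt ℝ n (fun z ↦ ∑ i,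
      (ContinuousLinearMap.proj (R := ℝ) (φ := fun _ : ι ↦ ℝ) i).smulRight (f i z)) y := by
  refine ContDiffAt.sum fun i _ ↦ ?_
  exact (ContinuousLinearMap.smulRightL ℝ (ι → ℝ) F (ContinuousLinearMap.proj
    i)).contDiff.contDiffAt.comp y (hf i)

/-- A field of linear maps is smooth if its values on the elements of a smooth spanning family of
vector fields are so. -/
theorem contDiffAt_of_span_eq_top [FiniteDimensional ℝ V] {ι : Type*} [Fintype ι]
    {e : ι → X → V} {A : X → V →L[ℝ] F}
    (he : ∀ i, ContDiffAt ℝ n (e i) y)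
    (hspan : Submodule.span ℝ (range fun i ↦ e i y) = ⊤)
    (hA : ∀ i, ContDiffAt ℝ n (fun z ↦ A z (e i z)) y) : ContDiffAt ℝ n A y := by
  set Φ : X → (ι → ℝ) →L[ℝ] V := fun z ↦ ∑ i,
    (ContinuousLinearMap.proj (R := ℝ) (φ := fun _ : ι ↦ ℝ) i).smulRight (e i z) with hΦ
  have hΦa : ∀ z c, Φ z c = ∑ i, c i • e i z := fun z c ↦ by simp [hΦ]
  have hsurj : LinearMap.range (Φ y : (ι → ℝ) →ₗ[ℝ] V) = ⊤ := by
    rw [eq_top_iff, ← hspan, Submodule.span_le]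
    rintro _ ⟨i, rfl⟩
    classical
    refine ⟨Pi.single i 1, ?_⟩
    rw [ContinuousLinearMap.coe_coe, hΦa]
    simp [Pi.single_apply]
  obtain ⟨R, hR⟩ := LinearMap.exists_rightInverse_of_surjective _ hsurj
  set R' : V →L[ℝ] (ι → ℝ) := LinearMap.toContinuousLinearMap R with hR'
  have hΦR : Φ y ∘L R' = ContinuousLinearMap.id ℝ V := by
    ext v
    exact congrArg (fun L : V →ₗ[ℝ] V ↦ L v) hR
  have hinv : (Φ y ∘L R').IsInvertible := by
    rw [hΦR]
    exact ⟨ContinuousLinearEquiv.refl ℝ V, rfl⟩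
  have hΦs : ContDiffAt ℝ n (fun z ↦ Φ z ∘L R') y :=
    (contDiffAt_sum_smulRight he).clm_comp contDiffAt_const
  have : CompleteSpace V := FiniteDimensional.complete ℝ V
  have hev := hinv.eventually hΦs.continuousAt
  -- With Φ the map from coefficients to vectors and R' a right inverse at y only, Φ ∘ R' is
  -- invertible near y, and A = (A ∘ Φ) ∘ R' ∘ (Φ ∘ R')⁻¹ there. The family need not be a basis, so
  -- no count of its elements is required.
  have hAΦ := ((contDiffAt_sum_smulRight hA).clm_comp (contDiffAt_const (c := R'))).clm_comp
    ((ContinuousLinearMap.IsInvertible.contDiffAt_map_inverse (n := n) hinv).comp y hΦs)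
  refine hAΦ.congr_of_eventuallyEq ?_
  filter_upwards [hev] with z hz
  ext v
  obtain ⟨u, hu⟩ := hz
  obtain ⟨w, rfl⟩ := u.surjective v
  have h1 : (Φ z ∘L R').inverse (u w) = w := by
    rw [← hu, ContinuousLinearMap.inverse_equiv]
    simp
  have h2 : u w = Φ z (R' w) := congrArg (fun L : V →L[ℝ] V ↦ L w) hu
  simp only [Function.comp_apply, ContinuousLinearMap.comp_apply, h1]
  rw [h2, hΦa, map_sum]
  simp

/-- A function is smooth if its image under a smooth field of injective linear maps is so. -/
theorem contDiffAt_of_injective_clm {EG : Type*} [NormedAddCommGroup EG] [NormedSpace ℝ EG]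
    [FiniteDimensional ℝ V] [FiniteDimensional ℝ EG] {L : X → EG →L[ℝ] V} {f : X → EG}
    (hL : ContDiffAt ℝ n L y) (hinj : Function.Injective (L y))
    (hf : ContDiffAt ℝ n (fun z ↦ L z (f z)) y) :
    ContDiffAt ℝ n f y := by
  obtain ⟨R, hR⟩ := LinearMap.exists_leftInverse_of_injective (L y : EG →ₗ[ℝ] V)
    (LinearMap.ker_eq_bot.2 hinj)
  set R' : V →L[ℝ] EG := LinearMap.toContinuousLinearMap R with hR'
  have hRL : R' ∘L L y = ContinuousLinearMap.id ℝ EG := by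
    ext v
    exact congrArg (fun L : EG →ₗ[ℝ] EG ↦ L v) hR
  have hinv : (R' ∘L L y).IsInvertible := by
    rw [hRL]
    exact ⟨ContinuousLinearEquiv.refl ℝ EG, rfl⟩
  have hs : ContDiffAt ℝ n (fun z ↦ R' ∘L L z) y := contDiffAt_const.clm_comp hL
  have : CompleteSpace EG := FiniteDimensional.complete ℝ EG
  have hev := hinv.eventually hs.continuousAt
  -- Here R' is a left inverse of L at y only; near y it still holds that f = (R' ∘ L)⁻¹ (R' (L f)).
  have h := ((ContinuousLinearMap.IsInvertible.contDiffAt_map_inverse (n := n) hinv).comp y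
    hs).clm_apply ((contDiffAt_const (c := R')).clm_apply hf)
  refine h.congr_of_eventuallyEq ?_
  filter_upwards [hev] with z hz
  obtain ⟨u, hu⟩ := hz
  have h2 : R' (L z (f z)) = u (f z) := congrArg (fun L : EG →L[ℝ] EG ↦ L (f z)) hu.symm
  simp only [Function.comp_apply]
  rw [h2, ← hu, ContinuousLinearMap.inverse_equiv]
  simp

end Frames

/-- C constrains only the projection to Q, which is the first component in the chart of M; fibre
directions are free. -/
theorem NonholonomicSystem.chartSymmDeriv_mem_C {E : Type*} [NormedAddCommGroup E] [NormedSpace ℝ E]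
    {Q : Type*} [TopologicalSpace Q] [ChartedSpace E Q] [IsManifold 𝓘(ℝ, E) ∞ Q]
    {S : NonholonomicSystem E Q} {m : S.M} {y : E × (Fin S.rank → ℝ)}
    (hy : y ∈ (extChartAt S.modelM m).target) {u : E × (Fin S.rank → ℝ)}
    {w : TangentSpace 𝓘(ℝ, E) ((extChartAt S.modelM m).symm y).proj} (hw : w ∈ S.D _)
    (hwu : chartDeriv 𝓘(ℝ, E) m.proj _ w = u.1) :
    chartSymmDeriv S.modelM m y u ∈ S.C ((extChartAt S.modelM m).symm y) := by
  have hs := (extChartAt S.modelM m).map_target hy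
  have h1 := chartDeriv_projDeriv hs (chartSymmDeriv S.modelM m y u)
  rw [chartDeriv_chartSymmDeriv hy, ← hwu] at h1
  have hq : ((extChartAt S.modelM m).symm y).proj ∈ (extChartAt 𝓘(ℝ, E) m.proj).source := by
    rw [extChartAt_source]
    exact (TotalSpace.mem_extChartAt_source.1 hs).2
  rw [mem_C, (chartDeriv_bijective hq).1 h1]
  exact hw

/-! ### The connection A_W and its smoothness -/

namespace NonholonomicSystem

namespace IsSymmetry

variable {E : Type*} [NormedAddCommGroup E] [NormedSpace ℝ E] [FiniteDimensional ℝ E]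
  {Q : Type*} [TopologicalSpace Q] [ChartedSpace E Q] [IsManifold 𝓘(ℝ, E) ∞ Q]
  {EG : Type*} [NormedAddCommGroup EG] [NormedSpace ℝ EG]
  {G : Type*} [Group G] [TopologicalSpace G] [ChartedSpace EG G] [MulAction G Q]
  {S : NonholonomicSystem E Q} {h : S.IsSymmetry EG G}
  {W : (m : S.M) → Submodule ℝ (TangentSpace S.modelM m)}

namespace IsVerticalComplement

variable (hW : h.IsVerticalComplement W)

theorem connection_apply (m : S.M) (v : Fin 1 → TangentSpace S.modelM m) :
    hW.connection m v = (h.generator m : EG →ₗ[ℝ] TangentSpace S.modelM m).leftInverse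
      ((W m).projection (S.C m) (hW.isCompl m).symm (v 0)) := rfl

theorem connection_eq_zero {m : S.M} {v : Fin 1 → TangentSpace S.modelM m} (hv : v 0 ∈ S.C m) :
    hW.connection m v = 0 := by
  rw [connection_apply, (Submodule.projection_apply_eq_zero_iff _).2 hv, map_zero]

/-- The inclusion of W in the orbit directions puts P_W(v) in the range of ξ ↦ ξ_M(m), where
injectivity makes `leftInverse` a genuine inverse. -/
theorem generator_connection {m : S.M} (hinj : Function.Injective (h.generator m))
    (v : Fin 1 → TangentSpace S.modelM m) :
    h.generator m (hW.connection m v) = (W m).projection (S.C m) (hW.isCompl m).symm (v 0) := by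
  obtain ⟨ξ, hξ⟩ := hW.le_vertical m
    (Submodule.projection_apply_mem (hW.isCompl m).symm (v 0))
  rw [connection_apply, ← hξ,
    LinearMap.leftInverse_apply_of_inj (LinearMap.ker_eq_bot.2 hinj)]
  rfl

theorem generator_connection_of_mem {m : S.M} (hinj : Function.Injective (h.generator m))
    {v : Fin 1 → TangentSpace S.modelM m} (hv : v 0 ∈ W m) :
    h.generator m (hW.connection m v) = v 0 := by
  rw [hW.generator_connection hinj]
  exact Submodule.projection_apply_left _ ⟨v 0, hv⟩

theorem generator_connection_mem {m : S.M} (hinj : Function.Injective (h.generator m))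
    (v : Fin 1 → TangentSpace S.modelM m) : h.generator m (hW.connection m v) ∈ W m := by
  rw [hW.generator_connection hinj]
  exact Submodule.projection_apply_mem _ _

theorem sub_generator_connection_mem {m : S.M} (hinj : Function.Injective (h.generator m))
    (v : Fin 1 → TangentSpace S.modelM m) :
    v 0 - h.generator m (hW.connection m v) ∈ S.C m := by
  rw [hW.generator_connection hinj]
  exact Submodule.sub_projection_mem _ _

/-- A_W is smooth because its values on a smooth spanning family are: it vanishes on sections of C,
and on a section w of W it solves ξ_M = w. This equation is already injective in ξ after projection
to Q, so only the smoothness of ξ_Q is used. -/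
theorem contDiffAt_connection_inChart [FiniteDimensional ℝ EG] [LieGroup 𝓘(ℝ, EG) ∞ G]
    (hfree : ∀ (g : G) (q : Q), g • q = q → g = 1) (m : S.M) :
    ContDiffAt ℝ ∞ (hW.connection.inChart m) (extChartAt S.modelM m m) := by
  obtain ⟨k, hk⟩ := hW.isRegular
  obtain ⟨t, ht⟩ := hk m
  have hs := mem_extChartAt_source (I := S.modelM) m
  have hy := mem_extChartAt_target (I := S.modelM) m
  have hbij := chartDeriv_bijective hs
  have hx := S.fst_mem_of_mem_target hy
  set y₀ := extChartAt S.modelM m m with hy₀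
  have hsymm : (extChartAt S.modelM m).symm y₀ = m := extChartAt_to_inv m
  have hopen : IsOpen ((extChartAt S.modelM m).target ∩ (extChartAt S.modelM m).symm ⁻¹' t.dom) :=
    (continuousOn_extChartAt_symm m).isOpen_inter_preimage (isOpen_extChartAt_target m)
      t.isOpen_dom
  have hnhds := hopen.mem_nhds (x := y₀) ⟨hy, by rw [mem_preimage, hsymm]; exact ht⟩
  set L := ContinuousAlternatingMap.ofSubsingletonLIE (𝕜 := ℝ) (E := E × (Fin S.rank → ℝ)) (F := EG)
    (0 : Fin 1)
  set A : E × (Fin S.rank → ℝ) → (E × (Fin S.rank → ℝ)) →L[ℝ] EG :=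
    fun z ↦ L.symm (hW.connection.inChart m z) with hA
  have hAa : ∀ z u, A z u = hW.connection ((extChartAt S.modelM m).symm z)
      (fun _ ↦ chartSymmDeriv S.modelM m z u) := fun z u ↦ rfl
  suffices hsm : ContDiffAt ℝ ∞ A y₀ by
    have h1 := L.toContinuousLinearEquiv.contDiff.contDiffAt.comp y₀ hsm
    exact h1.congr_of_eventuallyEq (Filter.Eventually.of_forall fun z ↦
      (L.apply_symm_apply (hW.connection.inChart m z)).symm)
  -- Horizontal coordinate lifts of the frame of D and the vertical coordinate vectors span C; a
  -- frame of W completes them.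
  let e : Fin S.rank ⊕ Fin S.rank ⊕ Fin k → E × (Fin S.rank → ℝ) → E × (Fin S.rank → ℝ) :=
    Sum.elim (fun a z ↦ (vectorFieldInChart ((S.frameAt m.proj).vec a) m.proj z.1, 0))
      (Sum.elim (fun a _ ↦ (0, Pi.single a 1)) (fun j z ↦ vectorFieldInChart (t.vec j) m z))
  have hWsm : ∀ j, ContDiffAt ℝ ∞ (vectorFieldInChart (t.vec j) m) y₀ := fun j ↦
    (contDiffOn_vectorFieldInChart t.isOpen_dom (t.contMDiffOn_vec j) m).contDiffAt hnhds
  have hDsm : ∀ a, ContDiffAt ℝ ∞ (vectorFieldInChart ((S.frameAt m.proj).vec a) m.proj) y₀.1 :=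
    fun a ↦ (contDiffOn_vectorFieldInChart (S.frameAt m.proj).isOpen_dom
      ((S.frameAt m.proj).contMDiffOn_vec a) m.proj).contDiffAt
      ((S.isOpen_target_inter_preimage_dom m.proj).mem_nhds hx)
  have hDval : ∀ a z, z ∈ (extChartAt S.modelM m).target →
      chartDeriv 𝓘(ℝ, E) m.proj ((extChartAt S.modelM m).symm z).proj
        ((S.frameAt m.proj).vec a ((extChartAt S.modelM m).symm z).proj)
      = vectorFieldInChart ((S.frameAt m.proj).vec a) m.proj z.1 := by
    intro a z hz
    rw [vectorFieldInChart, TotalSpace.proj_extChartAt_symm hz]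
  have hdom : ∀ z, z ∈ (extChartAt S.modelM m).target →
      ((extChartAt S.modelM m).symm z).proj ∈ (S.frameAt m.proj).dom := fun z hz ↦
    (TotalSpace.mem_extChartAt_source.1 ((extChartAt S.modelM m).map_target hz)).1
  refine contDiffAt_of_span_eq_top (e := e) ?_ ?_ ?_
  · rintro (a | a | j)
    · exact ((hDsm a).comp y₀ contDiffAt_fst).prodMk contDiffAt_const
    · exact contDiffAt_const
    · exact hWsm j
  · set T := Submodule.span ℝ (range fun i ↦ e i y₀) with hT
    have hmem : ∀ i, e i y₀ ∈ T := fun i ↦ Submodule.subset_span ⟨i, rfl⟩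
    have hWT : ∀ v ∈ W m, chartDeriv S.modelM m m v ∈ T := by
      intro v hv
      rw [← t.span_eq m ht] at hv
      induction hv using Submodule.span_induction with
      | mem v hv =>
        obtain ⟨j, rfl⟩ := hv
        have h1 := hmem (Sum.inr (Sum.inr j))
        simp only [e, Sum.elim_inr, vectorFieldInChart] at h1
        rw [hsymm] at h1
        exact h1
      | zero => rw [map_zero]; exact zero_mem _
      | add u v _ _ hu hv => rw [map_add]; exact add_mem hu hv
      | smul c u _ hu => rw [map_smul]; exact Submodule.smul_mem _ _ hu
    have hDT : ∀ w ∈ S.D m.proj, ((chartDeriv 𝓘(ℝ, E) m.proj m.proj w, 0) :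
        E × (Fin S.rank → ℝ)) ∈ T := by
      intro w hw
      rw [← (S.frameAt m.proj).span_eq _ (S.mem_frameAt_dom m.proj)] at hw
      have hlin : ∀ w, ((chartDeriv 𝓘(ℝ, E) m.proj m.proj w, 0) : E × (Fin S.rank → ℝ))
        = ContinuousLinearMap.inl ℝ E (Fin S.rank → ℝ)
          (chartDeriv 𝓘(ℝ, E) m.proj m.proj w) := fun w ↦ rfl
      induction hw using Submodule.span_induction with
      | mem w hw =>
        obtain ⟨a, rfl⟩ := hw
        have h1 := hmem (Sum.inl a)
        simp only [e, Sum.elim_inl] at h1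
        rw [← hDval a y₀ hy, hsymm] at h1
        exact h1
      | zero => rw [hlin, map_zero, map_zero]; exact zero_mem _
      | add u v _ _ hu hv =>
        rw [hlin] at hu hv ⊢
        rw [map_add, map_add]
        exact add_mem hu hv
      | smul c u _ hu =>
        rw [hlin] at hu ⊢
        rw [map_smul, map_smul]
        exact Submodule.smul_mem _ _ hu
    have hcT : ∀ c : Fin S.rank → ℝ, ((0, c) : E × (Fin S.rank → ℝ)) ∈ T := by
      intro c
      have h1 : ((0, c) : E × (Fin S.rank → ℝ)) = ∑ a, c a • e (Sum.inr (Sum.inl a)) y₀ := by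
        refine Prod.ext ?_ ?_
        · simp [e, Prod.fst_sum]
        · ext b
          simp [e, Prod.snd_sum, Finset.sum_apply, Pi.single_apply]
      rw [h1]
      exact Submodule.sum_mem _ fun a _ ↦ Submodule.smul_mem _ _ (hmem _)
    rw [eq_top_iff]
    intro u _
    obtain ⟨v, rfl⟩ := hbij.2 u
    -- The component c in C has coordinates (projection in D, 0) plus (0, fibre part), which the
    -- first two groups of the family span.
    obtain ⟨c, hc, w, hw, rfl⟩ := Submodule.mem_sup.1
      ((hW.isCompl m).sup_eq_top ▸ Submodule.mem_top : v ∈ S.C m ⊔ W m)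
    rw [map_add]
    refine add_mem ?_ (hWT w hw)
    have h1 := add_mem (hDT _ hc) (hcT (chartDeriv S.modelM m m c).2)
    have h2 := chartDeriv_projDeriv hs c
    convert h1 using 1
    refine Prod.ext ?_ ?_
    · simp [← h2]
      rfl
    · simp
  · have hspanD : ∀ a z, z ∈ (extChartAt S.modelM m).target →
        (S.frameAt m.proj).vec a ((extChartAt S.modelM m).symm z).proj ∈ S.D _ := by
      intro a z hz
      rw [← (S.frameAt m.proj).span_eq _ (hdom z hz)]
      exact Submodule.subset_span ⟨a, rfl⟩
    rintro (a | a | j)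
    · refine (contDiffAt_const (c := (0 : EG))).congr_of_eventuallyEq ?_
      filter_upwards [hnhds] with z hz
      rw [hAa]
      exact hW.connection_eq_zero (chartSymmDeriv_mem_C hz.1 (hspanD a z hz.1) (hDval a z hz.1))
    · refine (contDiffAt_const (c := (0 : EG))).congr_of_eventuallyEq ?_
      filter_upwards [hnhds] with z hz
      rw [hAa]
      exact hW.connection_eq_zero (chartSymmDeriv_mem_C hz.1 (zero_mem _) (map_zero _))
    -- The generators on Q serve as the smooth injective field, and the projection of the W-frame
    -- vector as the known smooth image.
    · refine contDiffAt_of_injective_clm (V := E)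
        (L := coordGenerator (EG := EG) G m.proj ∘ Prod.fst)
        ((contDiffAt_coordGenerator h.contMDiff_smul hx.1).comp y₀ contDiffAt_fst) ?_ ?_
      · have h1 : y₀.1 = extChartAt 𝓘(ℝ, E) m.proj m.proj := by
          rw [hy₀, TotalSpace.extChartAt_apply (E := E) (TotalSpace.mem_extChartAt_source.1 hs).1]
        rw [Function.comp_apply, h1]
        exact injective_coordGenerator h.contMDiff_smul (mem_extChartAt_source m.proj)
          fun g ↦ hfree g m.proj
      · refine (contDiffAt_fst.comp y₀ (hWsm j)).congr_of_eventuallyEq ?_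
        filter_upwards [hnhds] with z hz
        have hsz := (extChartAt S.modelM m).map_target hz.1
        have hinj := h.injective_generator ((extChartAt S.modelM m).symm z) fun g ↦ hfree g _
        have h1 := h.fst_chartDeriv_generator hsz (A z (vectorFieldInChart (t.vec j) m z))
        rw [(extChartAt S.modelM m).right_inv hz.1] at h1
        refine h1.symm.trans ?_
        have h2 : chartSymmDeriv S.modelM m z (vectorFieldInChart (t.vec j) m z)
            = t.vec j ((extChartAt S.modelM m).symm z) := chartSymmDeriv_chartDeriv hz.1 _
        rw [hAa, h2, hW.generator_connection_of_mem hinj]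
        · rfl
        · rw [← t.span_eq _ hz.2]
          exact Submodule.subset_span ⟨j, rfl⟩

end IsVerticalComplement

end IsSymmetry

end NonholonomicSystem

/-! ### The bivector of a 2-form on C and its gauge transformation -/

section Sharp

variable {EP : Type*} [NormedAddCommGroup EP] [NormedSpace ℝ EP]
  {HP : Type*} [TopologicalSpace HP] {J : ModelWithCorners ℝ EP HP}
  {P : Type*} [TopologicalSpace P] [ChartedSpace HP P]

/-- An injective map from a finite-dimensional space to its dual is bijective, so the `leftInverse`
in the definition is the true inverse and not a default value. -/
theorem sharpOfForm_spec [FiniteDimensional ℝ EP] {C : (x : P) → Submodule ℝ (TangentSpace J x)}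
    {Ω : DForm J P 2 ℝ} {x : P} (hΩ : Function.Injective (Ω.flatOn x (C x)))
    (α : TangentSpace J x →L[ℝ] ℝ) :
    sharpOfForm C Ω x α ∈ C x ∧ ∀ Z ∈ C x, Ω x ![sharpOfForm C Ω x α, Z] = -α Z := by
  have : FiniteDimensional ℝ (TangentSpace J x) := finiteDimensional_tangentSpace J x
  have hker := LinearMap.ker_eq_bot.2 hΩ
  have hsurj : Function.Surjective (Ω.flatOn x (C x)) :=
    (LinearMap.injective_iff_surjective_of_finrank_eq_finrank
      (Subspace.dual_finrank_eq (K := ℝ) (V := C x)).symm).1 hΩ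
  obtain ⟨X, hX⟩ := hsurj ((α : TangentSpace J x →ₗ[ℝ] ℝ) ∘ₗ (C x).subtype)
  have h : sharpOfForm C Ω x α = ((-X : C x) : TangentSpace J x) := by
    change -((Ω.flatOn x (C x)).leftInverse ((α : TangentSpace J x →ₗ[ℝ] ℝ) ∘ₗ (C x).subtype) :
      TangentSpace J x) = _
    rw [← hX, LinearMap.leftInverse_apply_of_inj hker, Submodule.coe_neg]
  refine ⟨h ▸ (-X).2, fun Z hZ ↦ ?_⟩
  rw [h]
  have h2 : Ω.flatOn x (C x) (-X) ⟨Z, hZ⟩ = -α Z := by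
    rw [map_neg, hX]
    rfl
  exact h2

/-- The gauge transformation of the bivector of a 2-form `Ω` on `C` is the bivector of `Ω - B`
on `C`. -/
theorem IsGaugeTransformation.spec [FiniteDimensional ℝ EP]
    {C : (x : P) → Submodule ℝ (TangentSpace J x)} {Ω B : DForm J P 2 ℝ} {q : SharpField J P}
    (hq : IsGaugeTransformation (sharpOfForm C Ω) B q) {x : P}
    (hΩ : Function.Injective (Ω.flatOn x (C x))) (α : TangentSpace J x →L[ℝ] ℝ) :
    q x α ∈ C x ∧ ∀ Z ∈ C x, Ω x ![Z, q x α] - B x ![Z, q x α] = α Z := by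
  -- By surjectivity α = β + i_Y B with Y = π♯β, and then q♯α = Y. On C, Ω(Z, Y) is β(Z), while
  -- -B(Z, Y) = B(Y, Z) supplies the rest of α(Z).
  obtain ⟨β, rfl⟩ := (hq x).1.2 α
  rw [(hq x).2]
  obtain ⟨h1, h2⟩ := sharpOfForm_spec hΩ β
  refine ⟨h1, fun Z hZ ↦ ?_⟩
  have h3 : Ω x ![Z, sharpOfForm C Ω x β] = β Z :=
    ((Ω x).pair_swap _ _).trans (by rw [h2 Z hZ, neg_neg])
  have h4 : B x ![Z, sharpOfForm C Ω x β] = -B x ![sharpOfForm C Ω x β, Z] := (B x).pair_swap _ _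
  rw [h3, h4, sub_neg_eq_add]
  rfl

theorem SharpField.inChart_apply (p : SharpField J P) (x₀ : P) (y : EP) (l : EP →L[ℝ] ℝ) :
    p.inChart x₀ y l = chartDeriv J x₀ ((extChartAt J x₀).symm y)
      (p ((extChartAt J x₀).symm y) (l ∘L chartDeriv J x₀ ((extChartAt J x₀).symm y))) := rfl

theorem inverse_chartDeriv_chartDeriv [IsManifold J ∞ P] {x₀ x : P}
    (hx : x ∈ (extChartAt J x₀).source) (v : TangentSpace J x) :
    (chartDeriv J x₀ x).inverse (chartDeriv J x₀ x v) = v := by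
  obtain ⟨e, he⟩ : (chartDeriv J x₀ x).IsInvertible :=
    isInvertible_mfderiv_extChartAt (I := J) hx
  rw [← he, ContinuousLinearMap.inverse_equiv]
  simp

end Sharp

theorem extDeriv_sub {V : Type*} [NormedAddCommGroup V] [NormedSpace ℝ V]
    {F : Type*} [NormedAddCommGroup F] [NormedSpace ℝ F] {k : ℕ} {σ τ : V → V [⋀^Fin k]→L[ℝ] F}
    {y : V} (hσ : DifferentiableAt ℝ σ y) (hτ : DifferentiableAt ℝ τ y) :
    extDeriv (fun z ↦ σ z - τ z) y = extDeriv σ y - extDeriv τ y := by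
  have h : (fun z ↦ σ z - τ z) = σ + (-1 : ℝ) • τ := by
    ext z : 1
    simp [sub_eq_add_neg]
  rw [h, extDeriv_add hσ (hτ.const_smul _), extDeriv_smul, neg_one_smul, sub_eq_add_neg]

theorem comp_pair {V V' : Type*} (f : V → V') (u v : V) :
    (fun i ↦ f (![u, v] i)) = ![f u, f v] := by
  ext i; fin_cases i <;> rfl

theorem comp_triple {V V' : Type*} (f : V → V') (u v w : V) :
    (fun i ↦ f (![u, v, w] i)) = ![f u, f v, f w] := by
  ext i; fin_cases i <;> rfl

/-! ### Closedness of Ω_M, and the curvature on C -/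

namespace NonholonomicSystem

variable {E : Type*} [NormedAddCommGroup E] [NormedSpace ℝ E]
  {Q : Type*} [TopologicalSpace Q] [ChartedSpace E Q] [IsManifold 𝓘(ℝ, E) ∞ Q]
  (S : NonholonomicSystem E Q)

theorem ΩM_inChart_eventuallyEq (m : S.M) :
    S.ΩM.inChart m =ᶠ[𝓝 (extChartAt S.modelM m m)]
      fun y ↦ -extDeriv (frameForm (S.coordCovector m.proj)) y := by
  filter_upwards [(isOpen_extChartAt_target m).mem_nhds (mem_extChartAt_target m)] with z hz
  exact S.ΩM_inChart hz

theorem differentiableAt_extDeriv_frameForm (m : S.M) :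
    DifferentiableAt ℝ (extDeriv (frameForm (S.coordCovector m.proj)))
      (extChartAt S.modelM m m) := by
  have hy := mem_extChartAt_target (I := S.modelM) m
  have hl := S.contDiffAt_coordCovector (S.fst_mem_of_mem_target hy)
  have h : ContDiffAt ℝ ∞ (fderiv ℝ (frameForm (S.coordCovector m.proj)))
      (extChartAt S.modelM m m) := (contDiffAt_frameForm hl).fderiv_right (m := ∞) (by simp)
  exact (ContinuousAlternatingMap.alternatizeUncurryFinCLM ℝ _ ℝ).differentiableAt.comp _
    (h.differentiableAt (by simp))

theorem differentiableAt_ΩM_inChart (m : S.M) :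
    DifferentiableAt ℝ (S.ΩM.inChart m) (extChartAt S.modelM m m) :=
  (S.differentiableAt_extDeriv_frameForm m).neg.congr_of_eventuallyEq (S.ΩM_inChart_eventuallyEq m)

theorem extDeriv_ΩM_inChart (m : S.M) :
    extDeriv (S.ΩM.inChart m) (extChartAt S.modelM m m) = 0 := by
  have hy := mem_extChartAt_target (I := S.modelM) m
  have hl := S.contDiffAt_coordCovector (S.fst_mem_of_mem_target hy)
  have h : (fun y ↦ -extDeriv (frameForm (S.coordCovector m.proj)) y)
      = (-1 : ℝ) • extDeriv (frameForm (S.coordCovector m.proj)) := by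
    ext y : 1
    simp
  rw [(S.ΩM_inChart_eventuallyEq m).extDeriv_eq, h, extDeriv_smul,
    extDeriv_extDeriv_apply (contDiffAt_frameForm hl) minSmoothness_two_le_infty, smul_zero]

theorem IsSymmetry.IsVerticalComplement.curvature_apply_of_mem [FiniteDimensional ℝ E]
    {EG : Type*} [NormedAddCommGroup EG] [NormedSpace ℝ EG]
    {G : Type*} [Group G] [TopologicalSpace G] [ChartedSpace EG G] [MulAction G Q]
    {S : NonholonomicSystem E Q} {h : S.IsSymmetry EG G}
    {W : (m : S.M) → Submodule ℝ (TangentSpace S.modelM m)} (hW : h.IsVerticalComplement W)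
    {m : S.M} {X Y : TangentSpace S.modelM m} (hX : X ∈ S.C m) (hY : Y ∈ S.C m) :
    hW.curvature m ![X, Y] = hW.connection.d m ![X, Y] := by
  change hW.connection.d m (fun i ↦ (S.C m).projection (W m) (hW.isCompl m) (![X, Y] i)) = _
  rw [comp_pair, Submodule.projection_apply_of_mem_left _ hX,
    Submodule.projection_apply_of_mem_left _ hY]

end NonholonomicSystem

/-! ### The Jacobiator of the gauge transformed bivector -/

theorem mainTheorem2
    {E : Type*} [NormedAddCommGroup E] [NormedSpace ℝ E] [FiniteDimensional ℝ E]
    {Q : Type*} [TopologicalSpace Q] [T2Space Q] [SecondCountableTopology Q]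
    [ChartedSpace E Q] [IsManifold 𝓘(ℝ, E) ∞ Q]
    {EG : Type*} [NormedAddCommGroup EG] [NormedSpace ℝ EG] [FiniteDimensional ℝ EG]
    {G : Type*} [Group G] [TopologicalSpace G] [T2Space G] [ChartedSpace EG G]
    [LieGroup 𝓘(ℝ, EG) ∞ G] [MulAction G Q] [ProperSMul G Q]
    (hfree : ∀ (g : G) (q : Q), g • q = q → g = 1)
    (S : NonholonomicSystem E Q) (hS : S.IsSymmetry EG G)
    (hdim : ∀ m : S.M, S.C m ⊔ hS.V m = ⊤)
    (W : (m : S.M) → Submodule ℝ (TangentSpace S.modelM m)) (hW : hS.IsVerticalComplement W)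
    (B : DForm S.modelM S.M 2 ℝ) (hB : B.IsSmooth)
    (hBW : ∀ (m : S.M), ∀ Z ∈ W m, B.contract m Z = 0)
    (πB : BivectorField S.modelM S.M) (hπB : IsGaugeTransformation S.nhSharp B πB.sharp)
    (m : S.M) (α β γ : TangentSpace S.modelM m →L[ℝ] ℝ) :
    (1 / 2) * πB.schouten m α β γ
      = - πB.sharp₃ m (fun X Y Z ↦ B.d m ![X, Y, Z] + hW.dJWedgeK m X Y Z) α β γ
        - hW.ψ πB m α β γ := by
  have hs := mem_extChartAt_source (I := S.modelM) m
  have hy := mem_extChartAt_target (I := S.modelM) m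
  have hnhds := (isOpen_extChartAt_target (I := S.modelM) m).mem_nhds hy
  have hsymm : (extChartAt S.modelM m).symm (extChartAt S.modelM m m) = m := extChartAt_to_inv m
  have hinj := hS.injective_generator m fun g ↦ hfree g m.proj
  have hspec := fun (m' : S.M) (δ : TangentSpace S.modelM m' →L[ℝ] ℝ) ↦
    IsGaugeTransformation.spec (x := m') hπB (S.injective_flatOn_ΩM m') δ
  set y₀ := extChartAt S.modelM m m with hy₀
  set δ : Fin 3 → TangentSpace S.modelM m →L[ℝ] ℝ := ![α, β, γ] with hδ
  -- The constant-coefficient extensions of the covectors in the chart around m, as in the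
  -- definition of `schouten`; X i is the field obtained from ℓ i by π_B♯.
  set ℓ : Fin 3 → (E × (Fin S.rank → ℝ)) →L[ℝ] ℝ :=
    fun i ↦ δ i ∘L (chartDeriv S.modelM m m).inverse with hℓ
  set X : Fin 3 → E × (Fin S.rank → ℝ) → E × (Fin S.rank → ℝ) :=
    fun i y ↦ πB.sharp.inChart m y (ℓ i) with hX
  have hℓd : ∀ i, ℓ i ∘L chartDeriv S.modelM m m = δ i := by
    intro i
    ext v
    exact congrArg (δ i) (inverse_chartDeriv_chartDeriv hs v)
  have hX0 : ∀ i, X i y₀ = chartDeriv S.modelM m m (πB.sharp m (δ i)) := by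
    intro i
    rw [← hℓd i, hX]
    simp only [SharpField.inChart_apply]
    rw [hsymm]
  have hXsymm : ∀ {z}, z ∈ (extChartAt S.modelM m).target → ∀ i, chartSymmDeriv S.modelM m z (X i z)
      = πB.sharp ((extChartAt S.modelM m).symm z)
        (ℓ i ∘L chartDeriv S.modelM m ((extChartAt S.modelM m).symm z)) := fun hz i ↦
    chartSymmDeriv_chartDeriv hz _
  set σ : E × (Fin S.rank → ℝ) → (E × (Fin S.rank → ℝ)) [⋀^Fin 2]→L[ℝ] ℝ :=
    fun y ↦ S.ΩM.inChart m y - B.inChart m y with hσdef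
  -- The defining property of π_B relative to Ω_M - B, on the whole chart target. The vector u is
  -- arbitrary in C so that the corrected brackets are covered as well as the X i.
  have hσ : ∀ {z}, z ∈ (extChartAt S.modelM m).target → ∀ u i,
      chartSymmDeriv S.modelM m z u ∈ S.C ((extChartAt S.modelM m).symm z) →
      σ z ![u, X i z] = ℓ i u := by
    intro z hz u i hu
    have h1 := (hspec _ (ℓ i ∘L chartDeriv S.modelM m ((extChartAt S.modelM m).symm z))).2 _ hu
    rw [← hXsymm hz] at h1
    simp only [hσdef, ContinuousAlternatingMap.sub_apply, DForm.inChart_apply, comp_pair]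
    rw [h1, ContinuousLinearMap.comp_apply, chartDeriv_chartSymmDeriv hz]
  have hXC : ∀ {z}, z ∈ (extChartAt S.modelM m).target → ∀ i,
      chartSymmDeriv S.modelM m z (X i z) ∈ S.C ((extChartAt S.modelM m).symm z) := by
    intro z hz i
    rw [hXsymm hz]
    exact (hspec _ _).1
  have hBd : DifferentiableAt ℝ (B.inChart m) y₀ :=
    ((hB m).contDiffAt hnhds).differentiableAt (by simp)
  have hΩd := S.differentiableAt_ΩM_inChart m
  have hAd : DifferentiableAt ℝ (hW.connection.inChart m) y₀ :=
    (hW.contDiffAt_connection_inChart hfree m).differentiableAt (by simp)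
  have hXd : ∀ i, DifferentiableAt ℝ (X i) y₀ := fun i ↦
    (((πB.smooth m).contDiffAt hnhds).clm_apply contDiffAt_const).differentiableAt (by simp)
  have hAX : ∀ i, ∀ᶠ z in 𝓝 y₀, hW.connection.inChart m z ![X i z] = 0 := by
    intro i
    filter_upwards [hnhds] with z hz
    exact hW.connection_eq_zero (v := fun j ↦ chartSymmDeriv S.modelM m z (![X i z] j)) (hXC hz i)
  set gen : EG →L[ℝ] E × (Fin S.rank → ℝ) := chartDeriv S.modelM m m ∘L hS.generator m with hgen
  have hA0 : ∀ v, hW.connection.inChart m y₀ ![chartDeriv S.modelM m m v]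
      = hW.connection m (fun _ ↦ v) := by
    intro v
    rw [← hW.connection.inChart_chartDeriv hs]
    congr 1
    ext i : 1
    fin_cases i
    rfl
  have hCm : ∀ x, x = (extChartAt S.modelM m).symm y₀ → ∀ w ∈ S.C x,
      chartSymmDeriv S.modelM m y₀ (chartDeriv S.modelM m x w) ∈ S.C _ := by
    rintro _ rfl w hw
    rwa [chartSymmDeriv_chartDeriv hy]
  have hmain := jacobiator_eq (σ := σ) (A := hW.connection.inChart m) (gen := gen) (ℓ := ℓ) (X := X)
    (hΩd.sub hBd) hAd hXd (fun i j ↦ by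
      filter_upwards [hnhds] with z hz
      exact hσ hz _ j (hXC hz i)) hAX (fun v i ↦ by
      obtain ⟨w, rfl⟩ := (chartDeriv_bijective hs).2 v
      refine hσ hy _ i ?_
      rw [hA0, hgen, ContinuousLinearMap.comp_apply, ← map_sub]
      exact hCm m hsymm.symm _ (hW.sub_generator_connection_mem hinj fun _ ↦ w))
  have hK : ∀ i j, extDeriv (hW.connection.inChart m) y₀ ![X i y₀, X j y₀]
      = hW.curvature m ![πB.sharp m (δ i), πB.sharp m (δ j)] := by
    intro i j
    rw [hX0, hX0, hW.curvature_apply_of_mem (hspec m _).1 (hspec m _).1, DForm.d_apply, comp_pair]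
  have hσK : ∀ i j k, σ y₀ ![gen (hW.curvature m ![πB.sharp m (δ i), πB.sharp m (δ j)]), X k y₀]
      = hS.momentumDeriv m (πB.sharp m (δ k))
        (hW.curvature m ![πB.sharp m (δ i), πB.sharp m (δ j)]) := by
    intro i j k
    -- On these fields the curvature is -A_W of their bracket, so its generator is minus the
    -- W-component of that bracket. It therefore lies in W, and B drops out.
    have hmem : hS.generator m (hW.curvature m ![πB.sharp m (δ i), πB.sharp m (δ j)]) ∈ W m := by
      obtain ⟨w, hw⟩ := (chartDeriv_bijective hs).2
        (fderiv ℝ (X j) y₀ (X i y₀) - fderiv ℝ (X i) y₀ (X j y₀))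
      rw [← hK, extDeriv_one_apply_of_eventually_zero hAd (hXd i) (hXd j) (hAX i) (hAX j), ← hw,
        hA0, map_neg]
      exact neg_mem (hW.generator_connection_mem hinj _)
    have h1 : B m ![hS.generator m (hW.curvature m ![πB.sharp m (δ i), πB.sharp m (δ j)]),
        πB.sharp m (δ k)] = 0 :=
      congrArg (fun L : TangentSpace S.modelM m →L[ℝ] ℝ ↦ L (πB.sharp m (δ k))) (hBW m _ hmem)
    rw [← hS.ΩM_generator, ← S.ΩM.inChart_chartDeriv hs, hX0, ← sub_zero (S.ΩM.inChart m _ _), ← h1,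
      ← B.inChart_chartDeriv hs, comp_pair]
    rfl
  have hℓK : ∀ i ξ, ℓ i (gen ξ) = δ i (hS.generator m ξ) := fun i ξ ↦
    congrArg (fun L : TangentSpace S.modelM m →L[ℝ] ℝ ↦ L (hS.generator m ξ)) (hℓd i)
  -- Only B contributes, as Ω_M is closed; the minus sign cancels the one in front of dσ in the
  -- Jacobiator.
  have hdσ : extDeriv σ y₀ ![X 0 y₀, X 1 y₀, X 2 y₀]
      = -B.d m ![πB.sharp m α, πB.sharp m β, πB.sharp m γ] := by
    have h1 := DForm.d_apply B m ![πB.sharp m α, πB.sharp m β, πB.sharp m γ]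
    rw [comp_triple] at h1
    rw [hX0, hX0, hX0, extDeriv_sub hΩd hBd, S.extDeriv_ΩM_inChart, zero_sub, h1]
    rfl
  rw [hdσ, hK, hK, hK, hσK, hσK, hσK, hℓK, hℓK, hℓK] at hmain
  have hsch : πB.schouten m α β γ = 2 * (fderiv ℝ (fun z ↦ ℓ 2 (X 1 z)) y₀ (X 0 y₀)
    + fderiv ℝ (fun z ↦ ℓ 0 (X 2 z)) y₀ (X 1 y₀)
    + fderiv ℝ (fun z ↦ ℓ 1 (X 0 z)) y₀ (X 2 y₀)) := rfl
  have hwedge : hW.dJWedgeK m (πB.sharp m α) (πB.sharp m β) (πB.sharp m γ)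
      = hS.momentumDeriv m (πB.sharp m (δ 2)) (hW.curvature m ![πB.sharp m (δ 0), πB.sharp m (δ 1)])
      + hS.momentumDeriv m (πB.sharp m (δ 0)) (hW.curvature m ![πB.sharp m (δ 1), πB.sharp m (δ 2)])
      + hS.momentumDeriv m (πB.sharp m (δ 1))
        (hW.curvature m ![πB.sharp m (δ 2), πB.sharp m (δ 0)]) := rfl
  have hψ : hW.ψ πB m α β γ
      = δ 2 (hS.generator m (hW.curvature m ![πB.sharp m (δ 0), πB.sharp m (δ 1)]))
      + δ 0 (hS.generator m (hW.curvature m ![πB.sharp m (δ 1), πB.sharp m (δ 2)]))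
      + δ 1 (hS.generator m (hW.curvature m ![πB.sharp m (δ 2), πB.sharp m (δ 0)])) := rfl
  rw [hsch, hmain, hψ, BivectorField.sharp₃, hwedge]
  ring
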